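/- **Setting.** Let $\mathcal G=(V,E)$ be a connected, locally finite planar graph embedded in $\mathbb R^2$ (finitely many vertices in every bounded region, finite degrees), whose edges are straight segments that intersect only at common end-points. Assume that $\mathcal G$ is invariant under the translations by $(1,0)$ and $(0,1)$, the rotation by $\pi/2$ around the origin, and the orthogonal reflection with respect to the vertical axis, and that some vertex lies on the horizontal axis (for instance $0\in V$). Fix a real $q\ge 1$. For a finite set of edges $F\subset E$ let $V_F$ be the set of end-points of the edges of $F$, and let $\partial F$ be the set of $x\in V_F$ that are incident to an edge of $E\setminus F$. For a partition $\xi$ of $\partial F$ and $p\in[0,1]$, the random-cluster measure on $\{0,1\}^F$ with boundary condition $\xi$ is $$\phi^{\xi}_{p,q,F}(\eta)=\frac{p^{o(\eta)}(1-p)^{c(\eta)}q^{k(\eta^\xi)}}{Z^\xi(p,q,F)},$$ where $o(\eta)$ and $c(\eta)$ are the numbers of open ($\eta(e)=1$) and closed ($\eta(e)=0$) edges, and $k(\eta^\xi)$ is the number of connected components of the graph on $V_F$ formed by the open edges after the vertices in each class of $\xi$ are identified. A configuration $\omega\in\{0,1\}^E$ induces the boundary condition $\chi_F(\omega)$ on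 $F$, in which two vertices of $\partial F$ are in the same class if and only if they are connected by a path of open edges of $E\setminus F$. An infinite-volume random-cluster measure with parameters $p,q$ is a probability measure $\phi$ on $\{0,1\}^{E}$ such that, for every finite $F\subset E$ and every partition $\xi$ of $\partial F$ with $\phi(\chi_F(\omega)=\xi)>0$, $$\phi\big(\omega_{|F}=\cdot \,\big|\, \chi_F(\omega)=\xi\big)=\phi^\xi_{p,q,F}(\cdot).$$ Let $\mathcal C_v(2n,n)$ be the event that there is a path of open edges, all of whose vertices lie in $[0,2n]\times[0,n]$, from a vertex in $[0,2n]\times\{0\}$ to a vertex in $[0,2n]\times\{n\}$. Let $x\longleftrightarrow y$ be the event that $x$ and $y$ are connected by a path of open edges. **Proposition.** Let $p_0\in(0,1)$ be such that there exists an infinite-volume random-cluster measure $\phi_{p_0}$ with parameters $p_0,q$ and $$\liminf_{n\to\infty}\phi_{p_0}\big(\mathcal C_v(2n,n)\big)=0 .$$ Then for every $p\in[0,p_0)$ there exists $c=c(p)>0$ such that, for every infinite-volume random-cluster measure $\phi_p$ with parameters $p,q$ and all $x,y\in V$, $$\phi_p(x\longleftrightarrow y)\le \exp(-c|x-y|),$$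 where $|\cdot|$ is the Euclidean norm. -/

import Mathlib

open MeasureTheory ProbabilityTheory

/-- The plane `ℝ²` is identified with `ℂ`. A graph `G` with vertices placed by `pos` is a
planar lattice with square symmetry: connected, locally finite, drawn with straight edges that meet
only at common end-points, and invariant under the translations by `(1,0)` and `(0,1)`, the rotation
by `π/2` around the origin, and the reflection with respect to the vertical axis. -/
structure IsPlanarLattice {V : Type*} (G : SimpleGraph V) (pos : V → ℂ) : Prop where
  connected : G.Connected
  finite_neighbors : ∀ x, (G.neighborSet x).Finite
  pos_injective : Function.Injective pos
  finite_in_ball : ∀ r : ℝ, {x | ‖pos x‖ ≤ r}.Finite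
  planar : ∀ a b c d, G.Adj a b → G.Adj c d → s(a, b) ≠ s(c, d) →
    segment ℝ (pos a) (pos b) ∩ segment ℝ (pos c) (pos d) ⊆
      {pos a, pos b} ∩ {pos c, pos d}
  translate_one : ∃ φ : G ≃g G, ∀ x, pos (φ x) = pos x + 1
  translate_I : ∃ φ : G ≃g G, ∀ x, pos (φ x) = pos x + Complex.I
  rotate : ∃ φ : G ≃g G, ∀ x, pos (φ x) = Complex.I * pos x
  reflect : ∃ φ : G ≃g G, ∀ x, pos (φ x) = -(starRingEnd ℂ) (pos x)

namespace FK

variable {V : Type*}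

/-- Edge configurations; `true` means open. -/
abbrev Config (G : SimpleGraph V) : Type _ := G.edgeSet → Bool

/-- The graph of open edges of a configuration. -/
def openGraph (G : SimpleGraph V) (ω : Config G) : SimpleGraph V where
  Adj x y := ∃ h : G.Adj x y, ω ⟨s(x, y), h⟩ = true
  symm := ⟨by
    rintro x y ⟨h, hω⟩
    refine ⟨h.symm, ?_⟩
    have e : (⟨s(y, x), h.symm⟩ : G.edgeSet) = ⟨s(x, y), h⟩ := Subtype.ext Sym2.eq_swap
    rw [e]
    exact hω⟩
  loopless := ⟨fun x ⟨h, _⟩ => G.loopless.irrefl x h⟩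

/-- The event that `x` and `y` are connected by an open path. -/
def connected (G : SimpleGraph V) (x y : V) : Set (Config G) :=
  {ω | (openGraph G ω).Reachable x y}

/-- The event that the rectangle `[0,a] × [0,b]` is crossed vertically: some open path, all of
whose vertices lie in the rectangle, joins a vertex on the bottom side to one on the top side. -/
def crossV (G : SimpleGraph V) (pos : V → ℂ) (a b : ℝ) : Set (Config G) :=
  {ω | ∃ x y : V, (pos x).im = 0 ∧ (pos y).im = b ∧
    ∃ w : (openGraph G ω).Walk x y,
      ∀ z ∈ w.support, (pos z).re ∈ Set.Icc 0 a ∧ (pos z).im ∈ Set.Icc 0 b}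

/-- The vertex set of the finite subgraph with edge set `E`: the end-points of the edges in `E`. -/
def verts (G : SimpleGraph V) (E : Finset G.edgeSet) : Set V :=
  {x | ∃ e ∈ E, x ∈ (e : Sym2 V)}

/-- The boundary of the finite subgraph with edge set `E`: its vertices that are incident to
an edge of `G` outside `E`. (For an induced subgraph these are the vertices with a neighbour
outside it.) -/
def boundary (G : SimpleGraph V) (E : Finset G.edgeSet) : Set V :=
  {x | x ∈ verts G E ∧ ∃ e : G.edgeSet, e ∉ E ∧ x ∈ (e : Sym2 V)}

/-- A boundary condition is a partition of the boundary. -/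
abbrev BoundaryCondition (G : SimpleGraph V) (E : Finset G.edgeSet) : Type _ :=
  Setoid (boundary G E)

open Classical in
/-- A configuration on `E`, extended by closed edges. -/
noncomputable def extend (G : SimpleGraph V) (E : Finset G.edgeSet) (η : E → Bool) : Config G :=
  fun e => if h : e ∈ E then η ⟨e, h⟩ else false

open Classical in
/-- The configuration `ω` with all the edges of `E` closed. -/
noncomputable def closeOn (G : SimpleGraph V) (E : Finset G.edgeSet) (ω : Config G) : Config G :=
  fun e => if e ∈ E then false else ω e

/-- The boundary condition on `E` induced by a configuration: two boundary vertices are wired if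
they are connected by open edges outside `E`. -/
noncomputable def inducedBC (G : SimpleGraph V) (E : Finset G.edgeSet) (ω : Config G) :
    BoundaryCondition G E where
  r x y := (openGraph G (closeOn G E ω)).Reachable x y
  iseqv := ⟨fun _ => SimpleGraph.Reachable.refl _, fun h => h.symm, fun h h' => h.trans h'⟩

/-- The graph `η^ξ` on the vertices of `E`: open edges of `η`, plus a link between any two boundary
vertices wired by `ξ`. -/
noncomputable def wiredGraph (G : SimpleGraph V) (E : Finset G.edgeSet)
    (ξ : BoundaryCondition G E) (η : E → Bool) : SimpleGraph (verts G E) :=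
  (openGraph G (extend G E η) ⊔
    SimpleGraph.fromRel (fun x y => ∃ (hx : x ∈ boundary G E) (hy : y ∈ boundary G E),
      ξ ⟨x, hx⟩ ⟨y, hy⟩)).induce (verts G E)

/-- `p ^ (#open edges) * (1 - p) ^ (#closed edges) * q ^ (#clusters of η^ξ)`. -/
noncomputable def weight (G : SimpleGraph V) (p q : ℝ) (E : Finset G.edgeSet)
    (ξ : BoundaryCondition G E) (η : E → Bool) : ℝ :=
  p ^ Nat.card {e : E // η e = true} * (1 - p) ^ Nat.card {e : E // η e = false} *
    q ^ Nat.card (wiredGraph G E ξ η).ConnectedComponent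

open Classical in
/-- The random-cluster probability of `η` on the finite subgraph with edge set `E`, with boundary
condition `ξ`. -/
noncomputable def prob (G : SimpleGraph V) (p q : ℝ) (E : Finset G.edgeSet)
    (ξ : BoundaryCondition G E) (η : E → Bool) : ℝ :=
  weight G p q E ξ η / ∑ η' : E → Bool, weight G p q E ξ η'

/-- Infinite-volume random-cluster measures: on every finite subgraph, conditionally on the
induced boundary condition, the configuration has the finite-volume random-cluster law. -/
structure IsInfiniteVolume (G : SimpleGraph V) (p q : ℝ) (μ : Measure (Config G)) : Prop where
  isProbabilityMeasure : IsProbabilityMeasure μ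
  cond_eq : ∀ (E : Finset G.edgeSet) (ξ : BoundaryCondition G E),
    μ {ω | inducedBC G E ω = ξ} ≠ 0 → ∀ η : E → Bool,
      μ[{ω | E.restrict ω = η} | {ω | inducedBC G E ω = ξ}] = ENNReal.ofReal (prob G p q E ξ η)

end FK

/-!
The number of clusters of a configuration is the dimension of the space of functions that are
constant along its open edges and on the classes of the boundary condition. It is therefore
supermodular, which makes random-cluster measures monotone in `p` and in the boundary condition.
Moreover, if `p < p'` and `f` is increasing with bounded differences, then for small `δ` the mean of
`exp (δ f)` at `p` is at most `exp (δ m)`, where `m` is the mean of `f` at `p'`. Applied to the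
number of translates, by the vectors of an `n × n` square, for which an increasing local event
occurs, this bounds every infinite-volume measure at `p` by the free finite-volume measures at `p'`,
since a boundary condition costs at most a factor `exp (O(n))`. The free measures at `p₀` are
dominated by `φ₀`.

Let `L` be a scale at which `φ₀` is unlikely to cross `2L × L` rectangles the easy way, and let `R`
be a large multiple of it. A path that leaves the neighbourhood of a cell of side `R` crosses `K`
nested annuli around it, each crossed with probability at most `1/2` at `p₀`. A long open path
yields a chain of `k` distinct cells all of whose annuli are crossed; by the exponential bound this
has probability at most `exp (-δ K k / 2)` below `p₀`, which for large `K` beats the number `9 ^ k`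
of chains.

The crossing of an annulus gives a crossing of a rectangle that only ends near its sides, whereas
`crossV` requires vertices on the sides. Folding the lattice along its mirror lines into the
corridor next to a side provides the missing links, which have bounded length and are opened at a
constant cost. By planarity an edge that crosses a mirror line is invariant under the reflection, so
folding collapses it and maps paths to paths.
-/

namespace FK

section Components

variable {W : Type*}

/-- The functions that are constant along the edges of `H`, hence on its connected components. -/
def locallyConstant (H : SimpleGraph W) : Submodule ℝ (W → ℝ) where
  carrier := {g | ∀ x y, H.Adj x y → g x = g y}
  add_mem' ha hb x y h := by rw [Pi.add_apply, Pi.add_apply, ha x y h, hb x y h]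
  zero_mem' _ _ _ := rfl
  smul_mem' c g hg x y h := by rw [Pi.smul_apply, Pi.smul_apply, hg x y h]

lemma locallyConstant_anti {A B : SimpleGraph W} (h : A ≤ B) :
    locallyConstant B ≤ locallyConstant A :=
  fun _ hg x y hxy => hg x y (h hxy)

variable [Finite W]

lemma card_connectedComponent_eq_finrank (H : SimpleGraph W) :
    Nat.card H.ConnectedComponent = Module.finrank ℝ (locallyConstant H) := by
  classical
  have := Fintype.ofFinite W
  have hker : locallyConstant H = (H.lapMatrix ℝ).toLin'.ker := by
    ext g
    rw [LinearMap.mem_ker, Matrix.toLin'_apply, H.lapMatrix_mulVec_eq_zero_iff_forall_adj]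
    rfl
  rw [Nat.card_eq_fintype_card, H.card_connectedComponent_eq_finrank_ker_toLin'_lapMatrix, hker]

lemma card_connectedComponent_anti {A B : SimpleGraph W} (h : A ≤ B) :
    Nat.card B.ConnectedComponent ≤ Nat.card A.ConnectedComponent := by
  rw [card_connectedComponent_eq_finrank, card_connectedComponent_eq_finrank]
  exact Submodule.finrank_mono (locallyConstant_anti h)

lemma card_connectedComponent_supermodular {A B I S : SimpleGraph W}
    (hA : I ≤ A) (hB : I ≤ B) (hS : S ≤ A ⊔ B) :
    Nat.card A.ConnectedComponent + Nat.card B.ConnectedComponent ≤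
      Nat.card I.ConnectedComponent + Nat.card S.ConnectedComponent := by
  simp only [card_connectedComponent_eq_finrank]
  rw [← Submodule.finrank_sup_add_finrank_inf_eq]
  refine add_le_add (Submodule.finrank_mono (sup_le (locallyConstant_anti hA)
    (locallyConstant_anti hB))) (Submodule.finrank_mono ?_)
  rintro g ⟨hgA, hgB⟩ x y hxy
  exact (hS hxy).elim (hgA x y) (hgB x y)

lemma card_le_card_connectedComponent_add_ncard (B : SimpleGraph W) (T : Set W)
    (hT : ∀ x y, B.Adj x y → x ∈ T) :
    Nat.card W ≤ Nat.card B.ConnectedComponent + T.ncard := by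
  have hfin : Finite B.ConnectedComponent := Quot.finite _
  have hinj : Function.Injective (fun x : (Tᶜ : Set W) => B.connectedComponentMk x) := by
    rintro ⟨x, hx⟩ ⟨y, hy⟩ h
    obtain ⟨w⟩ := SimpleGraph.ConnectedComponent.exact h
    cases w with
    | nil => rfl
    | cons h _ => exact absurd (hT _ _ h) hx
  have hcompl := Nat.card_le_card_of_injective _ hinj
  rw [Nat.card_coe_set_eq] at hcompl
  have := Set.ncard_add_ncard_compl T
  omega

lemma card_connectedComponent_le_add_ncard {A B S : SimpleGraph W} (hS : S ≤ A ⊔ B) (T : Set W)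
    (hT : ∀ x y, B.Adj x y → x ∈ T) :
    Nat.card A.ConnectedComponent ≤ Nat.card S.ConnectedComponent + T.ncard := by
  have hsuper := card_connectedComponent_supermodular (I := ⊥) bot_le bot_le hS
  have hB := card_le_card_connectedComponent_add_ncard B T hT
  have hbot : Nat.card (⊥ : SimpleGraph W).ConnectedComponent ≤ Nat.card W :=
    Nat.card_le_card_of_surjective _ (Quot.mk_surjective (r := (⊥ : SimpleGraph W).Reachable))
  omega

end Components

variable {V : Type*} {G : SimpleGraph V}

section OpenGraph

variable {E : Finset G.edgeSet}

lemma openGraph_le (ω : Config G) : openGraph G ω ≤ G := fun _ _ h => h.1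

lemma openGraph_mono {ω ω' : Config G} (h : ω ≤ ω') : openGraph G ω ≤ openGraph G ω' :=
  fun _ _ ⟨hxy, ho⟩ => ⟨hxy, Bool.le_iff_imp.1 (h _) ho⟩

lemma openGraph_sup_le (ω ω' : Config G) :
    openGraph G (ω ⊔ ω') ≤ openGraph G ω ⊔ openGraph G ω' := by
  rintro x y ⟨hxy, ho⟩
  simp only [Pi.sup_apply, Bool.max_eq_or, Bool.or_eq_true] at ho
  exact ho.imp (fun h => ⟨hxy, h⟩) fun h => ⟨hxy, h⟩

lemma extend_of_mem (η : E → Bool) {e : G.edgeSet} (h : e ∈ E) :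
    extend G E η e = η ⟨e, h⟩ := by
  simp [extend, h]

lemma extend_of_notMem (η : E → Bool) {e : G.edgeSet} (h : e ∉ E) :
    extend G E η e = false := by
  simp [extend, h]

lemma extend_bot (E : Finset G.edgeSet) : extend G E ⊥ = ⊥ := by
  funext e
  by_cases he : e ∈ E
  · exact extend_of_mem _ he
  · exact extend_of_notMem _ he

lemma extend_mono (E : Finset G.edgeSet) : Monotone (extend G E) := by
  intro η η' h e
  by_cases he : e ∈ E
  · simpa only [extend_of_mem _ he] using h _
  · simp only [extend_of_notMem _ he, le_refl]

lemma extend_sup (η η' : E → Bool) :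
    extend G E (η ⊔ η') = extend G E η ⊔ extend G E η' := by
  ext e
  by_cases he : e ∈ E <;> simp [extend, he]

lemma finite_verts (E : Finset G.edgeSet) : (verts G E).Finite := by
  classical
  refine (E.biUnion fun e => (e : Sym2 V).toFinset).finite_toSet.subset fun x hx => ?_
  simpa [verts] using hx

instance (E : Finset G.edgeSet) : Finite (verts G E) := finite_verts E

lemma boundary_subset_verts (E : Finset G.edgeSet) : boundary G E ⊆ verts G E := fun _ h => h.1

instance (E : Finset G.edgeSet) : Finite (boundary G E) :=
  (finite_verts E).subset (boundary_subset_verts E)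

variable {ξ ξ' : BoundaryCondition G E}

lemma wiredGraph_adj {η : E → Bool} {x y : verts G E} :
    (wiredGraph G E ξ η).Adj x y ↔ (openGraph G (extend G E η)).Adj x y ∨
      (x : V) ≠ y ∧ ((∃ (hx : (x : V) ∈ boundary G E) (hy : (y : V) ∈ boundary G E),
        ξ ⟨x, hx⟩ ⟨y, hy⟩) ∨ ∃ (hy : (y : V) ∈ boundary G E) (hx : (x : V) ∈ boundary G E),
        ξ ⟨y, hy⟩ ⟨x, hx⟩) :=
  Iff.rfl

lemma wiredGraph_mono (hξ : ξ ≤ ξ') {η η' : E → Bool} (h : η ≤ η') :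
    wiredGraph G E ξ η ≤ wiredGraph G E ξ' η' := by
  intro x y hxy
  rw [wiredGraph_adj] at hxy ⊢
  refine hxy.imp (fun ho => openGraph_mono (extend_mono E h) ho) (And.imp_right ?_)
  exact Or.imp (fun ⟨hx, hy, h⟩ => ⟨hx, hy, hξ h⟩) fun ⟨hx, hy, h⟩ => ⟨hx, hy, hξ h⟩

lemma wiredGraph_sup_le (η η' : E → Bool) :
    wiredGraph G E ξ' (η ⊔ η') ≤ wiredGraph G E ξ η ⊔ wiredGraph G E ξ' η' := by
  intro x y hxy
  rw [wiredGraph_adj, extend_sup] at hxy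
  rw [SimpleGraph.sup_adj, wiredGraph_adj, wiredGraph_adj]
  rcases hxy with ho | hw
  · exact (openGraph_sup_le _ _ ho).imp Or.inl Or.inl
  · exact Or.inr (Or.inr hw)

/-- The number `k(η^ξ)` of clusters of `η` with boundary condition `ξ`. -/
noncomputable def clusters (G : SimpleGraph V) (E : Finset G.edgeSet)
    (ξ : BoundaryCondition G E) (η : E → Bool) : ℕ :=
  Nat.card (wiredGraph G E ξ η).ConnectedComponent

lemma clusters_anti (hξ : ξ ≤ ξ') {η η' : E → Bool} (h : η ≤ η') :
    clusters G E ξ' η' ≤ clusters G E ξ η :=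
  card_connectedComponent_anti (wiredGraph_mono hξ h)

lemma clusters_supermodular (hξ : ξ ≤ ξ') (η η' : E → Bool) :
    clusters G E ξ η + clusters G E ξ' η' ≤
      clusters G E ξ (η ⊓ η') + clusters G E ξ' (η ⊔ η') :=
  card_connectedComponent_supermodular (wiredGraph_mono le_rfl inf_le_left)
    (wiredGraph_mono hξ inf_le_right) (wiredGraph_sup_le _ _)

lemma ncard_preimage_verts_le {S : Set V} (hS : S.Finite) :
    ((↑) ⁻¹' S : Set (verts G E)).ncard ≤ S.ncard := by
  rw [← Set.ncard_image_of_injective _ Subtype.val_injective]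
  exact Set.ncard_le_ncard (Set.image_preimage_subset _ _) hS

lemma clusters_le_add_boundary (E : Finset G.edgeSet) (η : E → Bool) :
    clusters G E ⊥ η ≤ clusters G E ⊤ η + (boundary G E).ncard := by
  have hsup : wiredGraph G E ⊤ η ≤ wiredGraph G E ⊥ η ⊔ wiredGraph G E ⊤ ⊥ := by
    simpa only [sup_bot_eq] using wiredGraph_sup_le (ξ := ⊥) (ξ' := ⊤) η ⊥
  have hT : ∀ x y, (wiredGraph G E ⊤ ⊥).Adj x y → x ∈ ((↑) ⁻¹' boundary G E : Set (verts G E)) := by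
    rintro x y (⟨_, ho⟩ | ⟨-, ⟨hx, _⟩ | ⟨_, hx, _⟩⟩)
    · rw [extend_bot] at ho
      exact absurd ho Bool.false_ne_true
    · exact hx
    · exact hx
  exact (card_connectedComponent_le_add_ncard hsup _ hT).trans
    (Nat.add_le_add_left (ncard_preimage_verts_le (Set.toFinite _)) _)

lemma clusters_le_update_add_two (ξ : BoundaryCondition G E) (η : E → Bool) (e : E)
    [DecidableEq E] : clusters G E ξ η ≤ clusters G E ξ (Function.update η e true) + 2 := by
  classical
  set single : E → Bool := Function.update ⊥ e true
  set B := (openGraph G (extend G E single)).induce (verts G E)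
  have hsup : wiredGraph G E ξ (Function.update η e true) ≤ wiredGraph G E ξ η ⊔ B := by
    have hle : Function.update η e true ≤ η ⊔ single := update_le_iff.2
      ⟨by simp [single], fun i hi => by simp [single, Function.update_of_ne hi]⟩
    intro x y hxy
    rcases wiredGraph_mono le_rfl hle hxy with ho | hw
    · rw [Function.Embedding.subtype_apply, Function.Embedding.subtype_apply, extend_sup] at ho
      exact (openGraph_sup_le _ _ ho).imp Or.inl id
    · exact Or.inl (Or.inr hw)
  have hB : ∀ x y, B.Adj x y → x ∈ ((↑) ⁻¹' (((e : Sym2 V).toFinset : Finset V) : Set V) :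
      Set (verts G E)) := by
    rintro x y ⟨hG, ho⟩
    by_cases hmem : (⟨s(x, y), hG⟩ : G.edgeSet) ∈ E
    · have he : (⟨_, hmem⟩ : E) = e := by
        by_contra hne
        simp [extend_of_mem single hmem, single, Function.update_of_ne hne] at ho
      simp [← he]
    · simp [extend_of_notMem _ hmem] at ho
  have hcard : (((e : Sym2 V).toFinset : Finset V) : Set V).ncard ≤ 2 := by
    rw [Set.ncard_coe_finset, Sym2.card_toFinset]
    split_ifs <;> omega
  exact (card_connectedComponent_le_add_ncard hsup _ hB).trans
    (Nat.add_le_add_left ((ncard_preimage_verts_le (Finset.finite_toSet _)).trans hcard) _)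

end OpenGraph

section Bernoulli

variable {ι : Type*} [Fintype ι]

/-- The product weight of a configuration whose coordinates are open with probability `p`. -/
def bernoulli (p : ℝ) (η : ι → Bool) : ℝ := ∏ e, if η e = true then p else 1 - p

lemma bernoulli_eq_pow (p : ℝ) (η : ι → Bool) :
    bernoulli p η = p ^ Nat.card {e // η e = true} * (1 - p) ^ Nat.card {e // η e = false} := by
  classical
  unfold bernoulli
  rw [Finset.prod_ite, Finset.prod_const, Finset.prod_const, Nat.card_eq_fintype_card,
    Nat.card_eq_fintype_card, Fintype.card_subtype, Fintype.card_subtype]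
  simp only [Bool.not_eq_true]

lemma bernoulli_nonneg {p : ℝ} (h0 : 0 ≤ p) (h1 : p ≤ 1) (η : ι → Bool) : 0 ≤ bernoulli p η :=
  Finset.prod_nonneg fun e _ => by split_ifs <;> linarith

lemma bernoulli_bot (p : ℝ) : bernoulli p (⊥ : ι → Bool) = (1 - p) ^ Fintype.card ι := by
  simp [bernoulli]

lemma sum_bernoulli [DecidableEq ι] (p : ℝ) : ∑ η : ι → Bool, bernoulli p η = 1 := by
  have hprod := Finset.prod_univ_sum (fun _ : ι => (Finset.univ : Finset Bool))
    (fun _ b => if b = true then p else 1 - p)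
  rw [Fintype.piFinset_univ] at hprod
  simpa [bernoulli] using hprod.symm

lemma mul_bernoulli_le_bernoulli_update [DecidableEq ι] {p : ℝ} (h0 : 0 ≤ p) (h1 : p ≤ 1)
    (η : ι → Bool) (e : ι) : p * bernoulli p η ≤ bernoulli p (Function.update η e true) := by
  have hrest : ∏ i ∈ {e}ᶜ, (if Function.update η e true i = true then p else 1 - p) =
      ∏ i ∈ {e}ᶜ, if η i = true then p else 1 - p :=
    Finset.prod_congr rfl fun i hi => by
      rw [Function.update_of_ne (by simpa using hi)]
  have hnonneg : 0 ≤ ∏ i ∈ {e}ᶜ, if η i = true then p else 1 - p :=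
    Finset.prod_nonneg fun i _ => by split_ifs <;> linarith
  rw [bernoulli, bernoulli, Fintype.prod_eq_mul_prod_compl e, Fintype.prod_eq_mul_prod_compl e,
    hrest, Function.update_self, if_pos rfl]
  refine mul_le_mul_of_nonneg_left (mul_le_of_le_one_left hnonneg ?_) h0
  split_ifs <;> linarith

-- `hammingDist a (a ⊓ b)` counts the coordinates that are open in `a` and closed in `b`.
lemma bernoulli_mul_bernoulli_le {p p' s : ℝ} (hp0 : 0 ≤ p) (hp1 : p ≤ 1) (hp'0 : 0 ≤ p')
    (hp'1 : p' ≤ 1) (hs : 0 ≤ s) (h : p * s * (1 - p') ≤ (1 - p) * p') (a b : ι → Bool) :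
    bernoulli p a * bernoulli p' b * s ^ hammingDist a (a ⊓ b) ≤
      bernoulli p (a ⊓ b) * bernoulli p' (a ⊔ b) := by
  have hpow : s ^ hammingDist a (a ⊓ b) = ∏ e, if a e ≠ (a ⊓ b) e then s else 1 := by
    rw [hammingDist, Finset.prod_ite, Finset.prod_const, Finset.prod_const_one, mul_one]
  rw [hpow, bernoulli, bernoulli, bernoulli, bernoulli, ← Finset.prod_mul_distrib,
    ← Finset.prod_mul_distrib, ← Finset.prod_mul_distrib]
  have hcp : 0 ≤ 1 - p := sub_nonneg.2 hp1
  have hcp' : 0 ≤ 1 - p' := sub_nonneg.2 hp'1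
  refine Finset.prod_le_prod (fun e _ => ?_) fun e _ => ?_
  · refine mul_nonneg (mul_nonneg ?_ ?_) ?_ <;> split_ifs <;> first | assumption | exact zero_le_one
  · cases ha : a e <;> cases hb : b e <;>
      (norm_num [ha, hb]; try linarith)

end Bernoulli

section CenterMass

variable {α : Type*} [Fintype α] {w w' g : α → ℝ}

lemma centerMass_le_centerMass_of_holley [DistribLattice α] (hw : 0 ≤ w) (hw' : 0 ≤ w')
    (hwpos : 0 < ∑ a, w a) (hwpos' : 0 < ∑ a, w' a) (hg : Monotone g)
    (h : ∀ a b, w a * w' b ≤ w (a ⊓ b) * w' (a ⊔ b)) :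
    Finset.univ.centerMass w g ≤ Finset.univ.centerMass w' g := by
  obtain ⟨c, hc⟩ := (Set.finite_range g).bddBelow
  have hnorm {v : α → ℝ} (hv : 0 < ∑ a, v a) : ∑ a, v a / ∑ b, v b = 1 := by
    rw [← Finset.sum_div, div_self hv.ne']
  have hshift {v : α → ℝ} (hv : 0 < ∑ a, v a) :
      ∑ a, (g a - c) * (v a / ∑ b, v b) = Finset.univ.centerMass v g - c := by
    simp_rw [sub_mul, Finset.sum_sub_distrib, ← Finset.mul_sum, hnorm hv, mul_one]
    rw [Finset.centerMass, smul_eq_mul, Finset.mul_sum]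
    congr 1
    exact Finset.sum_congr rfl fun a _ => by rw [smul_eq_mul]; ring
  have hholley := holley (μ := fun a => g a - c) (f := fun a => w a / ∑ b, w b)
    (g := fun a => w' a / ∑ b, w' b) (fun a => sub_nonneg.2 (hc ⟨a, rfl⟩))
    (fun a => div_nonneg (hw a) hwpos.le) (fun a => div_nonneg (hw' a) hwpos'.le)
    (fun a b hab => sub_le_sub_right (hg hab) c) ((hnorm hwpos).trans (hnorm hwpos').symm)
    fun a b => by
      rw [div_mul_div_comm, div_mul_div_comm]
      exact div_le_div_of_nonneg_right (h a b) (mul_pos hwpos hwpos').le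
  rw [hshift hwpos, hshift hwpos'] at hholley
  linarith

lemma exp_centerMass_le (hw : 0 ≤ w) (hwpos : 0 < ∑ a, w a) :
    Real.exp (Finset.univ.centerMass w g) ≤
      Finset.univ.centerMass w fun a => Real.exp (g a) :=
  convexOn_exp.map_centerMass_le (fun a _ => hw a) hwpos fun _ _ => Set.mem_univ _

lemma sum_mul_exp_pos (hw : 0 ≤ w) (hwpos : 0 < ∑ a, w a) :
    0 < ∑ a, w a * Real.exp (g a) := by
  obtain ⟨a, ha, hwa⟩ : ∃ a ∈ Finset.univ, 0 < w a :=
    Finset.exists_lt_of_sum_lt (by simpa using hwpos)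
  exact Finset.sum_pos' (fun b _ => mul_nonneg (hw b) (Real.exp_pos _).le)
    ⟨a, ha, mul_pos hwa (Real.exp_pos _)⟩

-- Jensen's inequality for `exp (-g)` under the tilted weights `w * exp g`.
lemma centerMass_exp_le (hw : 0 ≤ w) (hwpos : 0 < ∑ a, w a) :
    (Finset.univ.centerMass w fun a => Real.exp (g a)) ≤
      Real.exp (Finset.univ.centerMass (fun a => w a * Real.exp (g a)) g) := by
  set t : α → ℝ := fun a => w a * Real.exp (g a)
  have ht : 0 < ∑ a, t a := sum_mul_exp_pos hw hwpos
  have hneg : Finset.univ.centerMass t (fun a => -g a) = -Finset.univ.centerMass t g := by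
    simp [Finset.centerMass]
  have htilt : Finset.univ.centerMass t (fun a => Real.exp (-g a)) =
      (Finset.univ.centerMass w fun a => Real.exp (g a))⁻¹ := by
    have (a : α) : t a * Real.exp (-g a) = w a := by
      rw [mul_assoc, ← Real.exp_add, add_neg_cancel, Real.exp_zero, mul_one]
    simp_rw [Finset.centerMass, smul_eq_mul, this, mul_inv, inv_inv, mul_comm]
    rfl
  have hpos : 0 < Finset.univ.centerMass w fun a => Real.exp (g a) :=
    smul_pos (inv_pos.2 hwpos) ht
  have hjensen := exp_centerMass_le (g := fun a => -g a)
    (fun a => mul_nonneg (hw a) (Real.exp_pos _).le) ht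
  rw [hneg, htilt, Real.exp_neg] at hjensen
  exact (inv_le_inv₀ (Real.exp_pos _) hpos).1 hjensen

end CenterMass

section FiniteVolume

variable {E : Finset G.edgeSet} {p p' q : ℝ} {ξ ξ' : BoundaryCondition G E}

lemma weight_eq (p q : ℝ) (ξ : BoundaryCondition G E) (η : E → Bool) :
    weight G p q E ξ η = bernoulli p η * q ^ clusters G E ξ η := by
  rw [weight, bernoulli_eq_pow, clusters]

lemma weight_nonneg (hp0 : 0 ≤ p) (hp1 : p < 1) (hq : 1 ≤ q) (ξ : BoundaryCondition G E)
    (η : E → Bool) : 0 ≤ weight G p q E ξ η := by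
  rw [weight_eq]
  exact mul_nonneg (bernoulli_nonneg hp0 hp1.le _) (by positivity)

open Classical in
lemma sum_weight_pos (hp0 : 0 ≤ p) (hp1 : p < 1) (hq : 1 ≤ q) (ξ : BoundaryCondition G E) :
    0 < ∑ η : E → Bool, weight G p q E ξ η := by
  refine Finset.sum_pos' (fun η _ => weight_nonneg hp0 hp1 hq ξ η) ⟨⊥, Finset.mem_univ _, ?_⟩
  rw [weight_eq, bernoulli_bot]
  have : 0 < 1 - p := sub_pos.2 hp1
  positivity

lemma weight_mul_weight_le (hp0 : 0 ≤ p) (hp1 : p < 1) (hp'0 : 0 ≤ p') (hp'1 : p' < 1)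
    (hq : 1 ≤ q) {s : ℝ} (hs : 0 ≤ s) (h : p * s * (1 - p') ≤ (1 - p) * p')
    (hξ : ξ ≤ ξ') (a b : E → Bool) :
    weight G p q E ξ a * weight G p' q E ξ' b * s ^ hammingDist a (a ⊓ b) ≤
      weight G p q E ξ (a ⊓ b) * weight G p' q E ξ' (a ⊔ b) := by
  simp only [weight_eq]
  have hpow : q ^ (clusters G E ξ a + clusters G E ξ' b) ≤
      q ^ (clusters G E ξ (a ⊓ b) + clusters G E ξ' (a ⊔ b)) :=
    pow_le_pow_right₀ hq (clusters_supermodular hξ a b)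
  have hmul := mul_le_mul (bernoulli_mul_bernoulli_le hp0 hp1.le hp'0 hp'1.le hs h a b) hpow
    (by positivity) (mul_nonneg (bernoulli_nonneg hp0 hp1.le _) (bernoulli_nonneg hp'0 hp'1.le _))
  rw [pow_add, pow_add] at hmul
  linarith

open Classical in
lemma le_prob_bot (hp0 : 0 ≤ p) (hp1 : p < 1) (hq : 1 ≤ q) (ξ : BoundaryCondition G E) :
    (1 - p) ^ E.card ≤ prob G p q E ξ ⊥ := by
  rw [prob, le_div_iff₀ (sum_weight_pos hp0 hp1 hq ξ), weight_eq, bernoulli_bot, Fintype.card_coe]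
  refine mul_le_mul_of_nonneg_left ?_ (pow_nonneg (sub_nonneg.2 hp1.le) _)
  calc ∑ η : E → Bool, weight G p q E ξ η
      ≤ ∑ η : E → Bool, bernoulli p η * q ^ clusters G E ξ ⊥ :=
        Finset.sum_le_sum fun η _ => by
          rw [weight_eq]
          exact mul_le_mul_of_nonneg_left (pow_le_pow_right₀ hq (clusters_anti le_rfl bot_le))
            (bernoulli_nonneg hp0 hp1.le _)
    _ = q ^ clusters G E ξ ⊥ := by rw [← Finset.sum_mul, sum_bernoulli, one_mul]

open Classical in
/-- The expectation of `f` under the random-cluster measure on `E` with boundary condition `ξ`,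
the edges outside `E` being closed. -/
noncomputable def expect (G : SimpleGraph V) (p q : ℝ) (E : Finset G.edgeSet)
    (ξ : BoundaryCondition G E) (f : Config G → ℝ) : ℝ :=
  Finset.univ.centerMass (weight G p q E ξ) fun η => f (extend G E η)

open Classical in
lemma expect_eq_sum_prob (ξ : BoundaryCondition G E) (f : Config G → ℝ) :
    expect G p q E ξ f = ∑ η : E → Bool, prob G p q E ξ η * f (extend G E η) := by
  rw [expect, Finset.centerMass, smul_eq_mul, Finset.mul_sum]
  exact Finset.sum_congr rfl fun η _ => by rw [prob, smul_eq_mul]; ring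

lemma expect_sum {κ : Type*} (s : Finset κ) (ξ : BoundaryCondition G E) (f : κ → Config G → ℝ) :
    expect G p q E ξ (fun ω => ∑ i ∈ s, f i ω) = ∑ i ∈ s, expect G p q E ξ (f i) := by
  simp only [expect_eq_sum_prob, Finset.mul_sum]
  exact Finset.sum_comm

lemma expect_const_mul (c : ℝ) (ξ : BoundaryCondition G E) (f : Config G → ℝ) :
    expect G p q E ξ (fun ω => c * f ω) = c * expect G p q E ξ f :=
  Finset.centerMass_smul c _ _

section

variable (hp0 : 0 ≤ p) (hp1 : p < 1) (hq : 1 ≤ q)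
include hp0 hp1 hq

lemma expect_mono (ξ : BoundaryCondition G E) {f g : Config G → ℝ} (h : f ≤ g) :
    expect G p q E ξ f ≤ expect G p q E ξ g := by
  simp only [expect_eq_sum_prob]
  exact Finset.sum_le_sum fun η _ => mul_le_mul_of_nonneg_left (h _)
    (div_nonneg (weight_nonneg hp0 hp1 hq ξ η) (sum_weight_pos hp0 hp1 hq ξ).le)

lemma expect_const (ξ : BoundaryCondition G E) (c : ℝ) : expect G p q E ξ (fun _ => c) = c := by
  classical
  rw [expect_eq_sum_prob, ← Finset.sum_mul]
  simp only [prob]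
  rw [← Finset.sum_div, div_self (sum_weight_pos hp0 hp1 hq ξ).ne', one_mul]

lemma expect_nonneg (ξ : BoundaryCondition G E) {f : Config G → ℝ} (hf : 0 ≤ f) :
    0 ≤ expect G p q E ξ f :=
  (expect_const hp0 hp1 hq ξ 0).symm.trans_le (expect_mono hp0 hp1 hq ξ hf)

lemma exp_expect_le (ξ : BoundaryCondition G E) (f : Config G → ℝ) :
    Real.exp (expect G p q E ξ f) ≤ expect G p q E ξ (fun ω => Real.exp (f ω)) := by
  classical
  exact exp_centerMass_le (weight_nonneg hp0 hp1 hq ξ) (sum_weight_pos hp0 hp1 hq ξ)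

lemma expect_top_le_mul_expect_bot {f : Config G → ℝ} (hf : 0 ≤ f) :
    expect G p q E ⊤ f ≤ q ^ (boundary G E).ncard * expect G p q E ⊥ f := by
  classical
  have htop_le (η) : weight G p q E ⊤ η ≤ weight G p q E ⊥ η := by
    rw [weight_eq, weight_eq]
    exact mul_le_mul_of_nonneg_left (pow_le_pow_right₀ hq (clusters_anti bot_le le_rfl))
      (bernoulli_nonneg hp0 hp1.le _)
  have hle_top (η) : weight G p q E ⊥ η ≤ q ^ (boundary G E).ncard * weight G p q E ⊤ η := by
    rw [weight_eq, weight_eq, mul_left_comm, ← pow_add, add_comm]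
    exact mul_le_mul_of_nonneg_left (pow_le_pow_right₀ hq (clusters_le_add_boundary E η))
      (bernoulli_nonneg hp0 hp1.le _)
  have hprob (η) : prob G p q E ⊤ η ≤ q ^ (boundary G E).ncard * prob G p q E ⊥ η := by
    have hZ : ∑ η, weight G p q E ⊥ η ≤ q ^ (boundary G E).ncard * ∑ η, weight G p q E ⊤ η := by
      rw [Finset.mul_sum]
      exact Finset.sum_le_sum fun η _ => hle_top η
    rw [prob, prob, ← mul_div_assoc, div_le_div_iff₀ (sum_weight_pos hp0 hp1 hq ⊤)
      (sum_weight_pos hp0 hp1 hq ⊥)]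
    nlinarith [mul_le_mul (htop_le η) hZ (sum_weight_pos hp0 hp1 hq ⊥).le
      (weight_nonneg hp0 hp1 hq ⊥ η)]
  rw [expect_eq_sum_prob, expect_eq_sum_prob, Finset.mul_sum]
  refine Finset.sum_le_sum fun η _ => ?_
  rw [← mul_assoc]
  exact mul_le_mul_of_nonneg_right (hprob η) (hf _)

end

theorem expect_le_expect (hp0 : 0 ≤ p) (hpp' : p ≤ p') (hp'1 : p' < 1) (hq : 1 ≤ q) (hξ : ξ ≤ ξ')
    {f : Config G → ℝ} (hf : Monotone f) : expect G p q E ξ f ≤ expect G p' q E ξ' f := by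
  classical
  have hp1 := hpp'.trans_lt hp'1
  have hp'0 := hp0.trans hpp'
  refine centerMass_le_centerMass_of_holley (weight_nonneg hp0 hp1 hq ξ)
    (weight_nonneg hp'0 hp'1 hq ξ') (sum_weight_pos hp0 hp1 hq ξ) (sum_weight_pos hp'0 hp'1 hq ξ')
    (hf.comp (extend_mono E)) fun a b => ?_
  simpa only [one_pow, mul_one] using
    weight_mul_weight_le hp0 hp1 hp'0 hp'1 hq zero_le_one (by linarith) hξ a b

lemma tilted_weight_mul_weight_le (hp0 : 0 ≤ p) (hp1 : p < 1) (hp'0 : 0 ≤ p') (hp'1 : p' < 1)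
    (hq : 1 ≤ q) (ξ : BoundaryCondition G E) {C δ : ℝ} (hδ0 : 0 ≤ δ)
    (hδ : p * Real.exp (δ * C) * (1 - p') ≤ (1 - p) * p') {g : (E → Bool) → ℝ}
    (hLip : ∀ η η', η' ≤ η → g η ≤ g η' + C * hammingDist η η') (a b : E → Bool) :
    weight G p q E ξ a * Real.exp (δ * g a) * weight G p' q E ξ b ≤
      weight G p q E ξ (a ⊓ b) * Real.exp (δ * g (a ⊓ b)) * weight G p' q E ξ (a ⊔ b) := by
  have htilt : Real.exp (δ * g a) ≤
      Real.exp (δ * C) ^ hammingDist a (a ⊓ b) * Real.exp (δ * g (a ⊓ b)) := by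
    rw [← Real.exp_nat_mul, ← Real.exp_add, Real.exp_le_exp]
    linarith [mul_le_mul_of_nonneg_left (hLip a (a ⊓ b) inf_le_left) hδ0]
  calc weight G p q E ξ a * Real.exp (δ * g a) * weight G p' q E ξ b
      = weight G p q E ξ a * weight G p' q E ξ b * Real.exp (δ * g a) := by ring
    _ ≤ weight G p q E ξ a * weight G p' q E ξ b *
        (Real.exp (δ * C) ^ hammingDist a (a ⊓ b) * Real.exp (δ * g (a ⊓ b))) :=
      mul_le_mul_of_nonneg_left htilt
        (mul_nonneg (weight_nonneg hp0 hp1 hq ξ a) (weight_nonneg hp'0 hp'1 hq ξ b))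
    _ = weight G p q E ξ a * weight G p' q E ξ b * Real.exp (δ * C) ^ hammingDist a (a ⊓ b) *
        Real.exp (δ * g (a ⊓ b)) := by ring
    _ ≤ weight G p q E ξ (a ⊓ b) * weight G p' q E ξ (a ⊔ b) * Real.exp (δ * g (a ⊓ b)) :=
      mul_le_mul_of_nonneg_right (weight_mul_weight_le hp0 hp1 hp'0 hp'1 hq
        (Real.exp_pos _).le hδ le_rfl a b) (Real.exp_pos _).le
    _ = _ := by ring

theorem expect_exp_le (hp0 : 0 ≤ p) (hp1 : p < 1) (hp'0 : 0 ≤ p') (hp'1 : p' < 1) (hq : 1 ≤ q)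
    (ξ : BoundaryCondition G E) {C δ : ℝ} (hδ0 : 0 ≤ δ)
    (hδ : p * Real.exp (δ * C) * (1 - p') ≤ (1 - p) * p') {f : Config G → ℝ} (hf : Monotone f)
    (hLip : ∀ η η' : E → Bool, η' ≤ η →
      f (extend G E η) ≤ f (extend G E η') + C * hammingDist η η') :
    expect G p q E ξ (fun ω => Real.exp (δ * f ω)) ≤ Real.exp (δ * expect G p' q E ξ f) := by
  classical
  have hw := weight_nonneg hp0 hp1 hq ξ
  have hwpos := sum_weight_pos hp0 hp1 hq ξ
  refine (centerMass_exp_le hw hwpos).trans (Real.exp_le_exp.2 ?_)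
  rw [← expect_const_mul]
  exact centerMass_le_centerMass_of_holley
    (fun η => mul_nonneg (hw η) (Real.exp_pos _).le) (weight_nonneg hp'0 hp'1 hq ξ)
    (sum_mul_exp_pos hw hwpos) (sum_weight_pos hp'0 hp'1 hq ξ)
    (fun _ _ h => mul_le_mul_of_nonneg_left (hf (extend_mono E h)) hδ0)
    (tilted_weight_mul_weight_le hp0 hp1 hp'0 hp'1 hq ξ hδ0 hδ hLip)

end FiniteVolume

section EventProb

variable {E : Finset G.edgeSet} {p p' q : ℝ} {ξ ξ' : BoundaryCondition G E} {A B : Set (Config G)}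

lemma monotone_indicator_one (hA : IsUpperSet A) : Monotone (A.indicator (1 : Config G → ℝ)) := by
  intro ω ω' h
  by_cases hω : ω ∈ A
  · rw [Set.indicator_of_mem hω, Set.indicator_of_mem (hA h hω)]
    rfl
  · rw [Set.indicator_of_notMem hω]
    exact Set.indicator_nonneg (fun _ _ => zero_le_one) _

/-- The probability of an event under the random-cluster measure on `E` with boundary condition
`ξ`, the edges outside `E` being closed. -/
noncomputable def eventProb (G : SimpleGraph V) (p q : ℝ) (E : Finset G.edgeSet)
    (ξ : BoundaryCondition G E) (A : Set (Config G)) : ℝ :=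
  expect G p q E ξ (A.indicator 1)

lemma eventProb_mono (hp0 : 0 ≤ p) (hp1 : p < 1) (hq : 1 ≤ q) (ξ : BoundaryCondition G E)
    (h : A ⊆ B) : eventProb G p q E ξ A ≤ eventProb G p q E ξ B :=
  expect_mono hp0 hp1 hq ξ (Set.indicator_le_indicator_of_subset h fun _ => zero_le_one)

lemma eventProb_nonneg (hp0 : 0 ≤ p) (hp1 : p < 1) (hq : 1 ≤ q) (ξ : BoundaryCondition G E)
    (A : Set (Config G)) : 0 ≤ eventProb G p q E ξ A :=
  expect_nonneg hp0 hp1 hq ξ fun _ => Set.indicator_nonneg (fun _ _ => zero_le_one) _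

lemma eventProb_le_eventProb (hp0 : 0 ≤ p) (hpp' : p ≤ p') (hp'1 : p' < 1) (hq : 1 ≤ q)
    (hξ : ξ ≤ ξ') (hA : IsUpperSet A) : eventProb G p q E ξ A ≤ eventProb G p' q E ξ' A :=
  expect_le_expect hp0 hpp' hp'1 hq hξ (monotone_indicator_one hA)

end EventProb

section FiniteEnergy

variable {E : Finset G.edgeSet} {p q : ℝ}

open Classical in
/-- The configuration obtained from `ω` by opening the edges of `F`. -/
noncomputable def openOn (F : Finset G.edgeSet) (ω : Config G) : Config G :=
  fun e => if e ∈ F then true else ω e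

lemma openOn_of_mem {F : Finset G.edgeSet} {e : G.edgeSet} (he : e ∈ F) (ω : Config G) :
    openOn F ω e = true := if_pos he

lemma openOn_of_notMem {F : Finset G.edgeSet} {e : G.edgeSet} (he : e ∉ F) (ω : Config G) :
    openOn F ω e = ω e := if_neg he

lemma openOn_extend_singleton [DecidableEq E] (e : E) (η : E → Bool) :
    openOn {(e : G.edgeSet)} (extend G E η) = extend G E (Function.update η e true) := by
  funext i
  by_cases hi : i = e
  · subst hi
    rw [openOn_of_mem (Finset.mem_singleton_self _), extend_of_mem _ e.2, Function.update_self]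
  rw [openOn_of_notMem (mt Finset.mem_singleton.1 hi)]
  by_cases hE : i ∈ E
  · rw [extend_of_mem _ hE, extend_of_mem _ hE,
      Function.update_of_ne fun h => hi (congrArg Subtype.val h)]
  · rw [extend_of_notMem _ hE, extend_of_notMem _ hE]

lemma openOn_insert [DecidableEq G.edgeSet] (e : G.edgeSet) (F : Finset G.edgeSet)
    (ω : Config G) : openOn (insert e F) ω = openOn F (openOn {e} ω) := by
  funext i
  simp only [openOn, Finset.mem_insert, Finset.mem_singleton]
  split_ifs <;> tauto

lemma sum_update_true_le {ι : Type*} [Fintype ι] [DecidableEq ι] {g : (ι → Bool) → ℝ}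
    (hg : 0 ≤ g) (e : ι) : ∑ η, g (Function.update η e true) ≤ 2 * ∑ η, g η := by
  have hopen : ∑ η with η e = true, g (Function.update η e true) ≤ ∑ η, g η := by
    rw [Finset.sum_congr rfl fun η hη => by
      rw [← (Finset.mem_filter.1 hη).2, Function.update_eq_self]]
    exact Finset.sum_le_univ_sum_of_nonneg hg
  have hclosed : ∑ η with ¬η e = true, g (Function.update η e true) ≤ ∑ η, g η := by
    rw [← Finset.sum_image (f := g)]
    · exact Finset.sum_le_univ_sum_of_nonneg hg
    intro η hη η' hη' h
    funext i
    by_cases hi : i = e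
    · subst hi
      simp_all
    · simpa [Function.update_of_ne hi] using congrFun h i
  rw [← Finset.sum_filter_add_sum_filter_not _ (fun η : ι → Bool => η e = true)]
  linarith

variable (hp0 : 0 < p) (hp1 : p < 1) (hq : 1 ≤ q)
include hp0 hp1 hq

lemma weight_le_weight_update_true [DecidableEq E] (ξ : BoundaryCondition G E) (η : E → Bool)
    (e : E) :
    weight G p q E ξ η ≤ q ^ 2 / p * weight G p q E ξ (Function.update η e true) := by
  set η' := Function.update η e true
  have hbern : p * bernoulli p η ≤ bernoulli p η' :=
    mul_bernoulli_le_bernoulli_update hp0.le hp1.le η e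
  have hclus : q ^ clusters G E ξ η ≤ q ^ 2 * q ^ clusters G E ξ η' := by
    rw [← pow_add, add_comm]
    exact pow_le_pow_right₀ hq (clusters_le_update_add_two ξ η e)
  rw [weight_eq, weight_eq, div_mul_eq_mul_div, le_div_iff₀ hp0]
  have := mul_le_mul hbern hclus (by positivity) (bernoulli_nonneg hp0.le hp1.le η')
  linarith

lemma expect_openOn_singleton_le (ξ : BoundaryCondition G E) {f : Config G → ℝ} (hf : 0 ≤ f)
    {e : G.edgeSet} (he : e ∈ E) :
    expect G p q E ξ (fun ω => f (openOn {e} ω)) ≤ 2 * (q ^ 2 / p) * expect G p q E ξ f := by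
  classical
  set g : (E → Bool) → ℝ := fun η => weight G p q E ξ η * f (extend G E η)
  have hg : 0 ≤ g := fun η => mul_nonneg (weight_nonneg hp0.le hp1 hq ξ η) (hf _)
  have hsum : ∑ η, weight G p q E ξ η * f (openOn {e} (extend G E η)) ≤
      2 * (q ^ 2 / p) * ∑ η, g η := calc
    _ ≤ ∑ η, q ^ 2 / p * g (Function.update η ⟨e, he⟩ true) := by
      refine Finset.sum_le_sum fun η _ => ?_
      rw [← mul_assoc, openOn_extend_singleton ⟨e, he⟩]
      exact mul_le_mul_of_nonneg_right (weight_le_weight_update_true hp0 hp1 hq ξ η _) (hf _)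
    _ ≤ q ^ 2 / p * (2 * ∑ η, g η) := by
      rw [← Finset.mul_sum]
      exact mul_le_mul_of_nonneg_left (sum_update_true_le hg _) (by positivity)
    _ = _ := by ring
  simp only [expect, Finset.centerMass, smul_eq_mul]
  rw [mul_left_comm]
  exact mul_le_mul_of_nonneg_left hsum (inv_pos.2 (sum_weight_pos hp0.le hp1 hq ξ)).le

lemma expect_openOn_le (ξ : BoundaryCondition G E) {f : Config G → ℝ} (hf : 0 ≤ f)
    {F : Finset G.edgeSet} (hF : F ⊆ E) :
    expect G p q E ξ (fun ω => f (openOn F ω)) ≤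
      (2 * (q ^ 2 / p)) ^ F.card * expect G p q E ξ f := by
  classical
  induction F using Finset.induction_on with
  | empty =>
    have hempty (ω : Config G) : openOn ∅ ω = ω :=
      funext fun e => openOn_of_notMem (Finset.notMem_empty e) ω
    simp [hempty]
  | insert e F he ih =>
    simp only [openOn_insert]
    calc expect G p q E ξ (fun ω => f (openOn F (openOn {e} ω)))
        ≤ 2 * (q ^ 2 / p) * expect G p q E ξ (fun ω => f (openOn F ω)) :=
          expect_openOn_singleton_le hp0 hp1 hq ξ (f := fun ω => f (openOn F ω))
            (fun ω => hf (openOn F ω)) (hF (Finset.mem_insert_self e F))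
      _ ≤ 2 * (q ^ 2 / p) * ((2 * (q ^ 2 / p)) ^ F.card * expect G p q E ξ f) :=
          mul_le_mul_of_nonneg_left (ih ((Finset.subset_insert e F).trans hF)) (by positivity)
      _ = _ := by rw [Finset.card_insert_of_notMem he, pow_succ]; ring

-- `hF` says that the opened edges can be read off the resulting configuration.
lemma eventProb_le_of_openOn (ξ : BoundaryCondition G E) {U A : Set (Config G)} (D : ℕ)
    (F : Config G → Finset G.edgeSet) (hFE : ∀ ω, F ω ⊆ E) (hD : ∀ ω, (F ω).card ≤ D)
    (hF : ∀ ω, F (openOn (F ω) ω) = F ω) (hU : ∀ ω ∈ U, openOn (F ω) ω ∈ A) :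
    eventProb G p q E ξ U ≤ (2 * (q ^ 2 / p)) ^ D * eventProb G p q E ξ A := by
  classical
  have hbase : 1 ≤ 2 * (q ^ 2 / p) := by
    have : 1 ≤ q ^ 2 / p := (one_le_div hp0).2 (hp1.le.trans (one_le_pow₀ hq))
    linarith
  set piece : Finset G.edgeSet → Config G → ℝ := fun S ω => if ω ∈ A ∧ F ω = S then 1 else 0
  have hpiece0 (S) : 0 ≤ piece S := fun ω => by dsimp only [piece]; split_ifs <;> norm_num
  have hcover : U.indicator 1 ≤
      fun ω => ∑ S ∈ E.powerset with S.card ≤ D, piece S (openOn S ω) := by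
    refine Set.indicator_le' (fun ω hω => ?_) fun ω _ => ?_
    · refine le_trans ?_ (Finset.single_le_sum (f := fun S => piece S (openOn S ω))
        (fun S _ => hpiece0 S _)
        (Finset.mem_filter.2 ⟨Finset.mem_powerset.2 (hFE ω), hD ω⟩))
      simp [piece, hU ω hω, hF ω]
    · exact Finset.sum_nonneg fun S _ => hpiece0 S _
  have hdisj : (fun ω => ∑ S ∈ E.powerset with S.card ≤ D, piece S ω) ≤ A.indicator 1 := by
    intro ω
    by_cases hω : ω ∈ A
    · simp only [piece, hω, true_and, Finset.sum_ite_eq, Set.indicator_of_mem, Pi.one_apply]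
      split_ifs <;> norm_num
    · simp [piece, hω]
  calc eventProb G p q E ξ U
      ≤ ∑ S ∈ E.powerset with S.card ≤ D, expect G p q E ξ (fun ω => piece S (openOn S ω)) := by
        rw [← expect_sum]
        exact expect_mono hp0.le hp1 hq ξ hcover
    _ ≤ ∑ S ∈ E.powerset with S.card ≤ D, (2 * (q ^ 2 / p)) ^ D * expect G p q E ξ (piece S) := by
        refine Finset.sum_le_sum fun S hS => ?_
        obtain ⟨hSE, hSD⟩ := Finset.mem_filter.1 hS
        exact (expect_openOn_le hp0 hp1 hq ξ (hpiece0 S) (Finset.mem_powerset.1 hSE)).trans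
          (mul_le_mul_of_nonneg_right (pow_le_pow_right₀ hbase hSD)
            (expect_nonneg hp0.le hp1 hq ξ (hpiece0 S)))
    _ ≤ (2 * (q ^ 2 / p)) ^ D * eventProb G p q E ξ A := by
        rw [← Finset.mul_sum, ← expect_sum]
        exact mul_le_mul_of_nonneg_left (expect_mono hp0.le hp1 hq ξ hdisj) (by positivity)

theorem eventProb_iUnion_le_of_openOn {τ : Type*} (ξ : BoundaryCondition G E)
    {A : Set (Config G)} (D : ℕ) (good : τ → Set (Config G)) (F : τ → Finset G.edgeSet)
    (hFE : ∀ t, F t ⊆ E) (hD : ∀ t, (F t).card ≤ D)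
    (hinv : ∀ s t ω, openOn (F s) ω ∈ good t ↔ ω ∈ good t)
    (hA : ∀ t, ∀ ω ∈ good t, openOn (F t) ω ∈ A) :
    eventProb G p q E ξ (⋃ t, good t) ≤ (2 * (q ^ 2 / p)) ^ D * eventProb G p q E ξ A := by
  rcases isEmpty_or_nonempty τ with hτ | hτ
  · rw [Set.iUnion_of_empty]
    have hq2 : 0 ≤ (2 * (q ^ 2 / p)) ^ D := by positivity
    simpa [eventProb, expect_const hp0.le hp1 hq] using
      mul_nonneg hq2 (eventProb_nonneg hp0.le hp1 hq ξ A)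
  set choice : Config G → τ := fun ω => Classical.epsilon fun t => ω ∈ good t
  refine eventProb_le_of_openOn hp0 hp1 hq ξ D (fun ω => F (choice ω)) (fun _ => hFE _)
    (fun _ => hD _) (fun ω => ?_) fun ω hω => ?_
  · simp only [choice, hinv]
  · exact hA _ _ (Classical.epsilon_spec (Set.mem_iUnion.1 hω))

end FiniteEnergy

section Measurability

lemma reachable_iff_exists_finset (ω : Config G) (x y : V) :
    (openGraph G ω).Reachable x y ↔ ∃ S : Finset G.edgeSet, (∀ e ∈ S, ω e = true) ∧
      (openGraph G (extend G S fun _ => true)).Reachable x y := by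
  classical
  constructor
  · rintro ⟨w⟩
    induction w with
    | nil => exact ⟨∅, by simp, SimpleGraph.Reachable.refl _⟩
    | @cons a b _ h _ ih =>
      obtain ⟨S, hS, hr⟩ := ih
      obtain ⟨hG, ho⟩ := h
      refine ⟨insert ⟨s(a, b), hG⟩ S, by simpa [ho] using hS, ?_⟩
      have h1 : (openGraph G (extend G (insert ⟨s(a, b), hG⟩ S) fun _ => true)).Adj a b :=
        ⟨hG, by simp [extend]⟩
      refine h1.reachable.trans (hr.mono (openGraph_mono fun e => ?_))
      by_cases he : e ∈ S <;> simp [extend, he]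
  · rintro ⟨S, hS, hr⟩
    refine hr.mono (openGraph_mono fun e => ?_)
    by_cases he : e ∈ S
    · simp [extend, he, hS e he]
    · simp [extend, he]

lemma measurableSet_reachable [Countable V] (x y : V) :
    MeasurableSet {ω : Config G | (openGraph G ω).Reachable x y} := by
  have : Countable (Sym2 V) := Quot.mk_surjective.countable
  have hU : {ω : Config G | (openGraph G ω).Reachable x y} = ⋃ S : Finset G.edgeSet,
      {ω : Config G | ∀ e ∈ S, ω e = true} ∩
        {_ω | (openGraph G (extend G S fun _ => true)).Reachable x y} := by
    ext ω
    simp only [Set.mem_iUnion]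
    exact reachable_iff_exists_finset ω x y
  rw [hU]
  refine MeasurableSet.iUnion fun S => MeasurableSet.inter ?_ (MeasurableSet.const _)
  have : {ω : Config G | ∀ e ∈ S, ω e = true} = ⋂ e ∈ S, (fun ω => ω e) ⁻¹' {true} := by
    ext; simp
  rw [this]
  exact S.measurableSet_biInter fun e _ => measurable_pi_apply e (measurableSet_singleton _)

lemma measurable_closeOn (E : Finset G.edgeSet) : Measurable (closeOn G E) := by
  refine measurable_pi_lambda _ fun e => ?_
  unfold closeOn
  split_ifs
  · exact measurable_const
  · exact measurable_pi_apply e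

lemma measurableSet_inducedBC [Countable V] (E : Finset G.edgeSet) (ξ : BoundaryCondition G E) :
    MeasurableSet {ω | inducedBC G E ω = ξ} := by
  have : {ω | inducedBC G E ω = ξ} = ⋂ (x : boundary G E) (y : boundary G E),
      {ω | (openGraph G (closeOn G E ω)).Reachable x y ↔ ξ x y} := by
    ext ω
    simp only [Set.mem_ofPred_eq, Set.mem_iInter]
    constructor
    · rintro rfl x y
      rfl
    · intro h
      exact Setoid.ext fun x y => h x y
  rw [this]
  refine MeasurableSet.iInter fun x => MeasurableSet.iInter fun y => ?_
  have h1 : MeasurableSet {ω | (openGraph G (closeOn G E ω)).Reachable x y} :=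
    measurable_closeOn E (measurableSet_reachable (x : V) y)
  by_cases h : ξ x y
  · convert h1 using 1
    ext ω
    simp [h]
  · convert h1.compl using 1
    ext ω
    simp [h]

end Measurability

section DLR

/-- The event `A` depends only on the edges in `S`. -/
def DeterminedBy (A : Set (Config G)) (S : Set G.edgeSet) : Prop :=
  ∀ ω ω' : Config G, (∀ e ∈ S, ω e = ω' e) → ω ∈ A → ω' ∈ A

lemma DeterminedBy.mem_iff {A : Set (Config G)} {S : Set G.edgeSet} (h : DeterminedBy A S)
    {ω ω' : Config G} (hω : ∀ e ∈ S, ω e = ω' e) : ω ∈ A ↔ ω' ∈ A :=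
  ⟨h ω ω' hω, h ω' ω fun e he => (hω e he).symm⟩

lemma DeterminedBy.mono {A : Set (Config G)} {S T : Set G.edgeSet} (h : DeterminedBy A S)
    (hST : S ⊆ T) : DeterminedBy A T :=
  fun ω ω' hω => h ω ω' fun e he => hω e (hST he)

lemma determinedBy_extend_preimage (E : Finset G.edgeSet) (A : Set (Config G)) :
    DeterminedBy {ω | extend G E (E.restrict ω) ∈ A} (E : Set G.edgeSet) := by
  intro ω ω' h
  have : E.restrict ω = E.restrict ω' := by
    funext e
    exact h e e.2
  simp [this]

lemma extend_restrict_le (E : Finset G.edgeSet) (ω : Config G) :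
    extend G E (E.restrict ω) ≤ ω := by
  intro e
  by_cases he : e ∈ E <;> simp [extend, he]

instance (E : Finset G.edgeSet) : Finite (BoundaryCondition G E) :=
  Finite.of_injective (fun ξ : BoundaryCondition G E => fun x y => ξ x y) fun _ _ h =>
    Setoid.ext fun x y => iff_of_eq (congrFun (congrFun h x) y)

variable {p q : ℝ} {φ : Measure (Config G)} {E : Finset G.edgeSet}

lemma measurableSet_restrict_eq (E : Finset G.edgeSet) (η : E → Bool) :
    MeasurableSet {ω : Config G | E.restrict ω = η} :=
  (Finset.measurable_restrict (X := fun _ : G.edgeSet => Bool) E) (measurableSet_singleton η)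

lemma IsInfiniteVolume.measureReal_inter [Countable V] (hφ : IsInfiniteVolume G p q φ)
    (hp0 : 0 ≤ p) (hp1 : p < 1) (hq : 1 ≤ q)
    (ξ : BoundaryCondition G E) (η : E → Bool) :
    φ.real ({ω | inducedBC G E ω = ξ} ∩ {ω | E.restrict ω = η}) =
      φ.real {ω | inducedBC G E ω = ξ} * prob G p q E ξ η := by
  have := hφ.isProbabilityMeasure
  by_cases h0 : φ {ω | inducedBC G E ω = ξ} = 0
  · have h1 : φ ({ω | inducedBC G E ω = ξ} ∩ {ω | E.restrict ω = η}) = 0 :=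
      measure_mono_null Set.inter_subset_left h0
    simp [measureReal_def, h0, h1]
  have h := hφ.cond_eq E ξ h0 η
  rw [cond_apply (measurableSet_inducedBC E ξ)] at h
  have hprob : 0 ≤ prob G p q E ξ η :=
    div_nonneg (weight_nonneg hp0 hp1 hq ξ η) (sum_weight_pos hp0 hp1 hq ξ).le
  have h2 : φ ({ω | inducedBC G E ω = ξ} ∩ {ω | E.restrict ω = η}) =
      φ {ω | inducedBC G E ω = ξ} * ENNReal.ofReal (prob G p q E ξ η) := by
    rw [← h, ← mul_assoc, ENNReal.mul_inv_cancel h0 (measure_ne_top _ _), one_mul]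
  rw [measureReal_def, h2, ENNReal.toReal_mul, ENNReal.toReal_ofReal hprob, measureReal_def]

open Classical in
theorem IsInfiniteVolume.measureReal_eq_sum [Countable V] [Fintype (BoundaryCondition G E)]
    (hφ : IsInfiniteVolume G p q φ)
    (hp0 : 0 ≤ p) (hp1 : p < 1) (hq : 1 ≤ q) {A : Set (Config G)}
    (hA : DeterminedBy A (E : Set G.edgeSet)) :
    φ.real A = ∑ ξ : BoundaryCondition G E,
      φ.real {ω | inducedBC G E ω = ξ} * eventProb G p q E ξ A := by
  have := hφ.isProbabilityMeasure
  have hAe : ∀ ω, ω ∈ A ↔ extend G E (E.restrict ω) ∈ A := fun ω =>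
    hA.mem_iff fun e he => by simp [extend_of_mem _ (Finset.mem_coe.1 he)]
  set T := (Finset.univ ×ˢ Finset.univ.filter fun η : E → Bool => extend G E η ∈ A :
    Finset (BoundaryCondition G E × (E → Bool))) with hT
  have hAU : A = ⋃ t ∈ T, ({ω | inducedBC G E ω = t.1} ∩ {ω | E.restrict ω = t.2}) := by
    ext ω
    simp [hT, hAe ω]
  have hU : φ.real A = ∑ t ∈ T,
      φ.real ({ω | inducedBC G E ω = t.1} ∩ {ω | E.restrict ω = t.2}) := by
    conv_lhs => rw [hAU]
    refine measureReal_biUnion_finset ?_ fun t _ =>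
      (measurableSet_inducedBC E t.1).inter (measurableSet_restrict_eq E t.2)
    rintro ⟨ξ, η⟩ - ⟨ξ', η'⟩ - hne
    refine Set.disjoint_left.2 ?_
    rintro ω ⟨h1, h2⟩ ⟨h3, h4⟩
    exact hne (Prod.ext (h1.symm.trans h3) (h2.symm.trans h4))
  rw [hU, hT, Finset.sum_product]
  refine Finset.sum_congr rfl fun ξ _ => ?_
  rw [eventProb, expect_eq_sum_prob, Finset.mul_sum, Finset.sum_filter]
  refine Finset.sum_congr rfl fun η _ => ?_
  rw [hφ.measureReal_inter hp0 hp1 hq]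
  by_cases h : extend G E η ∈ A <;> simp [h]

lemma IsInfiniteVolume.sum_measureReal_inducedBC [Countable V] [Fintype (BoundaryCondition G E)]
    (hφ : IsInfiniteVolume G p q φ) :
    ∑ ξ : BoundaryCondition G E, φ.real {ω | inducedBC G E ω = ξ} = 1 := by
  have := hφ.isProbabilityMeasure
  rw [← measureReal_biUnion_finset (fun ξ _ ξ' _ h => Set.disjoint_left.2 fun ω h1 h2 =>
    h (h1.symm.trans h2)) fun ξ _ => measurableSet_inducedBC E ξ]
  have : (⋃ ξ ∈ (Finset.univ : Finset (BoundaryCondition G E)),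
      {ω | inducedBC G E ω = ξ}) = Set.univ := by
    ext; simp
  rw [this, probReal_univ]

lemma IsInfiniteVolume.measureReal_le [Countable V] (hφ : IsInfiniteVolume G p q φ)
    (hp0 : 0 ≤ p) (hp1 : p < 1) (hq : 1 ≤ q) {A : Set (Config G)}
    (hA : DeterminedBy A (E : Set G.edgeSet)) {b : ℝ}
    (hb : ∀ ξ, eventProb G p q E ξ A ≤ b) : φ.real A ≤ b := by
  have := Fintype.ofFinite (BoundaryCondition G E)
  rw [hφ.measureReal_eq_sum hp0 hp1 hq hA]
  calc _ ≤ ∑ ξ : BoundaryCondition G E, φ.real {ω | inducedBC G E ω = ξ} * b :=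
        Finset.sum_le_sum fun ξ _ => mul_le_mul_of_nonneg_left (hb ξ) measureReal_nonneg
    _ = b := by rw [← Finset.sum_mul, hφ.sum_measureReal_inducedBC, one_mul]

lemma IsInfiniteVolume.le_measureReal [Countable V] (hφ : IsInfiniteVolume G p q φ)
    (hp0 : 0 ≤ p) (hp1 : p < 1) (hq : 1 ≤ q) {A : Set (Config G)}
    (hA : DeterminedBy A (E : Set G.edgeSet)) {b : ℝ}
    (hb : ∀ ξ, b ≤ eventProb G p q E ξ A) : b ≤ φ.real A := by
  have := Fintype.ofFinite (BoundaryCondition G E)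
  rw [hφ.measureReal_eq_sum hp0 hp1 hq hA]
  calc b = ∑ ξ : BoundaryCondition G E, φ.real {ω | inducedBC G E ω = ξ} * b := by
        rw [← Finset.sum_mul, hφ.sum_measureReal_inducedBC, one_mul]
    _ ≤ _ := Finset.sum_le_sum fun ξ _ => mul_le_mul_of_nonneg_left (hb ξ) measureReal_nonneg

lemma IsInfiniteVolume.measureReal_le_mul [Countable V] (hφ : IsInfiniteVolume G p q φ)
    (hp0 : 0 ≤ p) (hp1 : p < 1) (hq : 1 ≤ q) {A : Set (Config G)}
    {U : Set (Config G)}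
    (hU : DeterminedBy U (E : Set G.edgeSet)) (hA : DeterminedBy A (E : Set G.edgeSet)) {C : ℝ}
    (hC : ∀ ξ, eventProb G p q E ξ U ≤ C * eventProb G p q E ξ A) : φ.real U ≤ C * φ.real A := by
  have := Fintype.ofFinite (BoundaryCondition G E)
  rw [hφ.measureReal_eq_sum hp0 hp1 hq hU, hφ.measureReal_eq_sum hp0 hp1 hq hA, Finset.mul_sum]
  refine Finset.sum_le_sum fun ξ _ => ?_
  have := mul_le_mul_of_nonneg_left (hC ξ)
    (measureReal_nonneg (μ := φ) (s := {ω | inducedBC G E ω = ξ}))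
  linarith

theorem IsInfiniteVolume.measureReal_le_eventProb_top [Countable V] (hφ : IsInfiniteVolume G p q φ)
    (hp0 : 0 ≤ p) (hp1 : p < 1) (hq : 1 ≤ q) {A : Set (Config G)}
    (hAu : IsUpperSet A)
    (hA : DeterminedBy A (E : Set G.edgeSet)) : φ.real A ≤ eventProb G p q E ⊤ A :=
  hφ.measureReal_le hp0 hp1 hq hA fun _ =>
    eventProb_le_eventProb hp0 le_rfl hp1 hq le_top hAu

theorem IsInfiniteVolume.eventProb_bot_le_measureReal [Countable V]
    (hφ : IsInfiniteVolume G p q φ) (hp0 : 0 ≤ p) (hp1 : p < 1) (hq : 1 ≤ q)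
    {A : Set (Config G)} (hA : IsUpperSet A) : eventProb G p q E ⊥ A ≤ φ.real A := by
  have := hφ.isProbabilityMeasure
  set A' : Set (Config G) := {ω | extend G E (E.restrict ω) ∈ A}
  have hA' : IsUpperSet A' := fun ω ω' h hω => hA (extend_mono E fun e => h e) hω
  have hAA' : eventProb G p q E ⊥ A = eventProb G p q E ⊥ A' := by
    simp only [eventProb, expect_eq_sum_prob]
    refine Finset.sum_congr rfl fun η _ => ?_
    have hη : E.restrict (extend G E η) = η := funext fun e => extend_of_mem η e.2
    have hmem : extend G E η ∈ A' ↔ extend G E η ∈ A := by rw [Set.mem_ofPred_eq, hη]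
    by_cases h : extend G E η ∈ A <;> simp [hmem, h]
  calc eventProb G p q E ⊥ A = eventProb G p q E ⊥ A' := hAA'
    _ ≤ φ.real A' :=
      hφ.le_measureReal hp0 hp1 hq (determinedBy_extend_preimage E A) fun _ =>
        eventProb_le_eventProb hp0 le_rfl hp1 hq bot_le hA'
    _ ≤ φ.real A := measureReal_mono fun ω hω => hA (extend_restrict_le E ω) hω

end DLR

section Automorphism

/-- The action of an automorphism on configurations. -/
def pull (σ : G ≃g G) (ω : Config G) : Config G := fun e => ω (σ.mapEdgeSet e)

lemma pull_mono (σ : G ≃g G) : Monotone (pull σ) := fun _ _ h _ => h _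

lemma openGraph_pull_adj (σ : G ≃g G) (ω : Config G) (x y : V) :
    (openGraph G (pull σ ω)).Adj x y ↔ (openGraph G ω).Adj (σ x) (σ y) :=
  ⟨fun ⟨h, ho⟩ => ⟨σ.map_adj_iff.2 h, ho⟩, fun ⟨h, ho⟩ => ⟨σ.map_adj_iff.1 h, ho⟩⟩

lemma mem_mapEdgeSet_iff (σ : G ≃g G) (x : V) (e : G.edgeSet) :
    σ x ∈ (σ.mapEdgeSet e : Sym2 V) ↔ x ∈ (e : Sym2 V) := by
  have : (σ.mapEdgeSet e : Sym2 V) = Sym2.map σ (e : Sym2 V) := rfl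
  rw [this, Sym2.mem_map]
  constructor
  · rintro ⟨y, hy, h⟩
    rwa [← σ.injective h]
  · intro h
    exact ⟨x, h, rfl⟩

/-- The image of a finite set of edges under an automorphism. -/
def mapEdges (σ : G ≃g G) (E : Finset G.edgeSet) : Finset G.edgeSet :=
  E.map σ.mapEdgeSet.toEmbedding

lemma mapEdgeSet_mem_mapEdges (σ : G ≃g G) (E : Finset G.edgeSet) (e : G.edgeSet) :
    σ.mapEdgeSet e ∈ mapEdges σ E ↔ e ∈ E :=
  Finset.mem_map_equiv.trans (by rw [Equiv.symm_apply_apply])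

lemma mem_verts_mapEdges (σ : G ≃g G) (E : Finset G.edgeSet) (x : V) :
    σ x ∈ verts G (mapEdges σ E) ↔ x ∈ verts G E := by
  constructor
  · rintro ⟨e, he, hx⟩
    obtain ⟨e, rfl⟩ := σ.mapEdgeSet.surjective e
    exact ⟨e, (mapEdgeSet_mem_mapEdges σ E e).1 he, (mem_mapEdgeSet_iff σ x e).1 hx⟩
  · rintro ⟨e, he, hx⟩
    exact ⟨_, (mapEdgeSet_mem_mapEdges σ E e).2 he, (mem_mapEdgeSet_iff σ x e).2 hx⟩

lemma mem_boundary_mapEdges (σ : G ≃g G) (E : Finset G.edgeSet) (x : V) :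
    σ x ∈ boundary G (mapEdges σ E) ↔ x ∈ boundary G E := by
  unfold boundary
  refine and_congr (mem_verts_mapEdges σ E x) ?_
  constructor
  · rintro ⟨e, he, hx⟩
    obtain ⟨e, rfl⟩ := σ.mapEdgeSet.surjective e
    exact ⟨e, fun h => he ((mapEdgeSet_mem_mapEdges σ E e).2 h), (mem_mapEdgeSet_iff σ x e).1 hx⟩
  · rintro ⟨e, he, hx⟩
    exact ⟨_, fun h => he ((mapEdgeSet_mem_mapEdges σ E e).1 h), (mem_mapEdgeSet_iff σ x e).2 hx⟩

/-- The bijection between `E` and its image under an automorphism. -/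
def mapEdgesEquiv (σ : G ≃g G) (E : Finset G.edgeSet) : E ≃ mapEdges σ E :=
  σ.mapEdgeSet.subtypeEquiv fun e => (mapEdgeSet_mem_mapEdges σ E e).symm

lemma pull_extend (σ : G ≃g G) (E : Finset G.edgeSet) (η : mapEdges σ E → Bool) :
    pull σ (extend G (mapEdges σ E) η) = extend G E (η ∘ mapEdgesEquiv σ E) := by
  funext e
  by_cases he : e ∈ E
  · rw [extend_of_mem _ he, pull, extend_of_mem _ ((mapEdgeSet_mem_mapEdges σ E e).2 he)]
    rfl
  · rw [extend_of_notMem _ he, pull,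
      extend_of_notMem _ fun h => he ((mapEdgeSet_mem_mapEdges σ E e).1 h)]

/-- The map induced on boundary vertices by an automorphism; boundary conditions are transported
along it by `Setoid.comap`. -/
def boundaryMap (σ : G ≃g G) (E : Finset G.edgeSet) (x : boundary G E) :
    boundary G (mapEdges σ E) :=
  ⟨σ x, (mem_boundary_mapEdges σ E x).2 x.2⟩

lemma boundaryMap_injective (σ : G ≃g G) (E : Finset G.edgeSet) :
    Function.Injective (boundaryMap σ E) :=
  fun _ _ h => Subtype.ext (σ.injective (congrArg Subtype.val h))

lemma clusters_mapEdges (σ : G ≃g G) (E : Finset G.edgeSet)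
    (ξ : BoundaryCondition G (mapEdges σ E)) (η : mapEdges σ E → Bool) :
    clusters G (mapEdges σ E) ξ η =
      clusters G E (ξ.comap (boundaryMap σ E)) (η ∘ mapEdgesEquiv σ E) := by
  have hrel (x y : V) : (∃ (hx : x ∈ boundary G E) (hy : y ∈ boundary G E),
      ξ.comap (boundaryMap σ E) ⟨x, hx⟩ ⟨y, hy⟩) ↔
      ∃ (hx : σ x ∈ boundary G (mapEdges σ E)) (hy : σ y ∈ boundary G (mapEdges σ E)),
        ξ ⟨σ x, hx⟩ ⟨σ y, hy⟩ :=
    exists_prop_congr (fun _ => exists_prop_congr (fun _ => Iff.rfl)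
      (mem_boundary_mapEdges σ E y).symm) (mem_boundary_mapEdges σ E x).symm
  let iso : wiredGraph G E (ξ.comap (boundaryMap σ E)) (η ∘ mapEdgesEquiv σ E) ≃g
      wiredGraph G (mapEdges σ E) ξ η :=
    { toEquiv := σ.toEquiv.subtypeEquiv fun x => (mem_verts_mapEdges σ E x).symm
      map_rel_iff' := by
        rintro ⟨x, hx⟩ ⟨y, hy⟩
        simp only [wiredGraph, SimpleGraph.comap_adj, Function.Embedding.subtype_apply,
          SimpleGraph.sup_adj, SimpleGraph.fromRel_adj, Equiv.subtypeEquiv_apply]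
        rw [← pull_extend, openGraph_pull_adj, hrel, hrel]
        exact or_congr Iff.rfl (and_congr σ.injective.ne_iff Iff.rfl) }
  exact Nat.card_congr iso.connectedComponentEquiv.symm

lemma weight_mapEdges (p q : ℝ) (σ : G ≃g G) (E : Finset G.edgeSet)
    (ξ : BoundaryCondition G (mapEdges σ E)) (η : mapEdges σ E → Bool) :
    weight G p q (mapEdges σ E) ξ η =
      weight G p q E (ξ.comap (boundaryMap σ E)) (η ∘ mapEdgesEquiv σ E) := by
  rw [weight_eq, weight_eq, clusters_mapEdges, bernoulli, bernoulli]
  congr 1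
  exact (Equiv.prod_comp (mapEdgesEquiv σ E) fun e => if η e = true then p else 1 - p).symm

theorem expect_mapEdges (p q : ℝ) (σ : G ≃g G) (E : Finset G.edgeSet)
    (ξ : BoundaryCondition G (mapEdges σ E)) (f : Config G → ℝ) :
    expect G p q (mapEdges σ E) ξ (fun ω => f (pull σ ω)) =
      expect G p q E (ξ.comap (boundaryMap σ E)) f := by
  classical
  let e : (mapEdges σ E → Bool) ≃ (E → Bool) :=
    (mapEdgesEquiv σ E).symm.arrowCongr (Equiv.refl Bool)
  have he (η : mapEdges σ E → Bool) : e η = η ∘ mapEdgesEquiv σ E := rfl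
  simp only [expect, Finset.centerMass, smul_eq_mul, weight_mapEdges, pull_extend, ← he]
  rw [Equiv.sum_comp e fun η => weight G p q E _ η * f (extend G E η),
    Equiv.sum_comp e fun η => weight G p q E _ η]

lemma mapEdges_symm (σ : G ≃g G) (E : Finset G.edgeSet) :
    mapEdges σ (mapEdges σ.symm E) = E := by
  ext e
  have he : e = σ.mapEdgeSet (σ.symm.mapEdgeSet e) := (σ.mapEdgeSet.apply_symm_apply e).symm
  conv_lhs => rw [he]
  rw [mapEdgeSet_mem_mapEdges, mapEdgeSet_mem_mapEdges]

lemma expect_bot_pull (p q : ℝ) (σ : G ≃g G) (E : Finset G.edgeSet) (f : Config G → ℝ) :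
    expect G p q E ⊥ (fun ω => f (pull σ ω)) = expect G p q (mapEdges σ.symm E) ⊥ f := by
  have h := expect_mapEdges p q σ (mapEdges σ.symm E) ⊥ f
  have hbot : Setoid.comap (boundaryMap σ (mapEdges σ.symm E)) ⊥ = ⊥ :=
    Setoid.ext fun _ _ => (boundaryMap_injective σ _).eq_iff
  rwa [hbot, mapEdges_symm] at h

lemma expect_top_pull (p q : ℝ) (σ : G ≃g G) (E : Finset G.edgeSet) (f : Config G → ℝ) :
    expect G p q E ⊤ (fun ω => f (pull σ ω)) = expect G p q (mapEdges σ.symm E) ⊤ f := by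
  have h := expect_mapEdges p q σ (mapEdges σ.symm E) ⊤ f
  have htop : Setoid.comap (boundaryMap σ (mapEdges σ.symm E)) ⊤ = ⊤ := rfl
  rwa [htop, mapEdges_symm] at h

end Automorphism

end FK

namespace IsPlanarLattice

variable {V : Type*} {G : SimpleGraph V} {pos : V → ℂ}

lemma finite_of_bounded (hG : IsPlanarLattice G pos) {S : Set V} {r : ℝ}
    (h : ∀ x ∈ S, |(pos x).re| ≤ r ∧ |(pos x).im| ≤ r) : S.Finite :=
  (hG.finite_in_ball (r + r)).subset fun x hx =>
    (Complex.norm_le_abs_re_add_abs_im (pos x)).trans (add_le_add (h x hx).1 (h x hx).2)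

lemma finite_of_box (hG : IsPlanarLattice G pos) {S : Set V} (a b c d : ℝ)
    (h : ∀ x ∈ S, (a ≤ (pos x).re ∧ (pos x).re ≤ b) ∧ c ≤ (pos x).im ∧ (pos x).im ≤ d) :
    S.Finite := by
  refine hG.finite_of_bounded (r := |a| + |b| + |c| + |d|) fun x hx => ?_
  obtain ⟨⟨h1, h2⟩, h3, h4⟩ := h x hx
  have := neg_abs_le a
  have := le_abs_self b
  have := neg_abs_le c
  have := le_abs_self d
  constructor <;> rw [abs_le] <;> constructor <;>
    linarith [abs_nonneg a, abs_nonneg b, abs_nonneg c, abs_nonneg d]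

lemma countable (hG : IsPlanarLattice G pos) : Countable V := by
  have : (Set.univ : Set V) = ⋃ n : ℕ, {x | ‖pos x‖ ≤ n} := by
    ext x
    simpa using exists_nat_ge ‖pos x‖
  rw [← Set.countable_univ_iff, this]
  exact Set.countable_iUnion fun n => (hG.finite_in_ball n).countable

lemma exists_translate_of_translate {t : ℂ} (h : ∃ φ : G ≃g G, ∀ x, pos (φ x) = pos x + t)
    (a : ℤ) : ∃ φ : G ≃g G, ∀ x, pos (φ x) = pos x + a * t := by
  obtain ⟨φ, hφ⟩ := h
  induction a with
  | zero => exact ⟨SimpleGraph.Iso.refl, fun x => by simp⟩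
  | succ n ih =>
    obtain ⟨ψ, hψ⟩ := ih
    refine ⟨ψ.trans φ, fun x => ?_⟩
    rw [RelIso.trans_apply, hφ, hψ]
    push_cast
    ring
  | pred n ih =>
    obtain ⟨ψ, hψ⟩ := ih
    refine ⟨ψ.trans φ.symm, fun x => ?_⟩
    rw [RelIso.trans_apply]
    have := hφ (φ.symm (ψ x))
    rw [RelIso.apply_symm_apply, hψ] at this
    push_cast at this ⊢
    linear_combination -this

lemma exists_translate (hG : IsPlanarLattice G pos) (a b : ℤ) :
    ∃ φ : G ≃g G, ∀ x, pos (φ x) = pos x + (a + b * Complex.I) := by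
  obtain ⟨φ, hφ⟩ := exists_translate_of_translate hG.translate_one a
  obtain ⟨ψ, hψ⟩ := exists_translate_of_translate hG.translate_I b
  exact ⟨φ.trans ψ, fun x => by rw [RelIso.trans_apply, hψ, hφ]; ring⟩

/-- The translation by an integer vector. -/
noncomputable def translate (hG : IsPlanarLattice G pos) (v : ℤ × ℤ) : G ≃g G :=
  (hG.exists_translate v.1 v.2).choose

lemma pos_translate (hG : IsPlanarLattice G pos) (v : ℤ × ℤ) (x : V) :
    pos (hG.translate v x) = pos x + (v.1 + v.2 * Complex.I) :=
  (hG.exists_translate v.1 v.2).choose_spec x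

lemma re_translate (hG : IsPlanarLattice G pos) (v : ℤ × ℤ) (x : V) :
    (pos (hG.translate v x)).re = (pos x).re + v.1 := by
  simp [pos_translate]

lemma im_translate (hG : IsPlanarLattice G pos) (v : ℤ × ℤ) (x : V) :
    (pos (hG.translate v x)).im = (pos x).im + v.2 := by
  simp [pos_translate]

end IsPlanarLattice

namespace FK

variable {V : Type*} {G : SimpleGraph V} {pos : V → ℂ}

/-- The unit cell that contains a vertex. -/
noncomputable def unitCell (pos : V → ℂ) (x : V) : ℤ × ℤ := (⌊(pos x).re⌋, ⌊(pos x).im⌋)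

lemma unitCell_translate (hG : IsPlanarLattice G pos) (v : ℤ × ℤ) (x : V) :
    unitCell pos (hG.translate v x) = unitCell pos x + v := by
  simp [unitCell, hG.re_translate, hG.im_translate, Prod.ext_iff]

lemma finite_unitCell (hG : IsPlanarLattice G pos) (v : ℤ × ℤ) :
    {x | unitCell pos x = v}.Finite := by
  refine hG.finite_of_box v.1 (v.1 + 1) v.2 (v.2 + 1) fun x hx => ?_
  obtain rfl := hx
  exact ⟨⟨Int.floor_le _, (Int.lt_floor_add_one _).le⟩, Int.floor_le _,
    (Int.lt_floor_add_one _).le⟩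

lemma exists_translate_unitCell_eq_zero (hG : IsPlanarLattice G pos) (x : V) :
    ∃ σ : G ≃g G, unitCell pos (σ x) = 0 ∧ ∀ y z, pos (σ y) - pos (σ z) = pos y - pos z :=
  ⟨hG.translate (-unitCell pos x), by rw [unitCell_translate, add_neg_cancel],
    fun y z => by rw [hG.pos_translate, hG.pos_translate, add_sub_add_right_eq_sub]⟩

lemma exists_edge_bound (hG : IsPlanarLattice G pos) : ∃ ℓ : ℕ, 1 ≤ ℓ ∧ ∀ x y, G.Adj x y →
    |(pos x).re - (pos y).re| ≤ ℓ ∧ |(pos x).im - (pos y).im| ≤ ℓ := by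
  have hfin : (⋃ x ∈ {x | unitCell pos x = 0},
      (fun y => ‖pos x - pos y‖) '' G.neighborSet x).Finite :=
    (finite_unitCell hG 0).biUnion fun x _ => (hG.finite_neighbors x).image _
  obtain ⟨r, hr⟩ := hfin.bddAbove
  obtain ⟨ℓ, hℓ⟩ := exists_nat_ge (max r 1)
  refine ⟨ℓ, by exact_mod_cast (le_max_right r 1).trans hℓ, fun x y h => ?_⟩
  have hxy : ‖pos x - pos y‖ ≤ ℓ := by
    obtain ⟨σ, hσx, hσ⟩ := exists_translate_unitCell_eq_zero hG x
    rw [← hσ]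
    exact (hr (Set.mem_biUnion hσx (Set.mem_image_of_mem _ (σ.map_adj_iff.2 h)))).trans
      ((le_max_left r 1).trans hℓ)
  exact ⟨(Complex.abs_re_le_norm (pos x - pos y)).trans hxy,
    (Complex.abs_im_le_norm (pos x - pos y)).trans hxy⟩

lemma exists_degree_bound (hG : IsPlanarLattice G pos) :
    ∃ D : ℕ, ∀ x, (G.neighborSet x).ncard ≤ D := by
  obtain ⟨D, hD⟩ := ((finite_unitCell hG 0).image fun x => (G.neighborSet x).ncard).bddAbove
  refine ⟨D, fun x => ?_⟩
  obtain ⟨σ, hσx, -⟩ := exists_translate_unitCell_eq_zero hG x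
  have hsub : σ '' G.neighborSet x ⊆ G.neighborSet (σ x) := by
    rintro _ ⟨y, hy, rfl⟩
    exact σ.map_adj_iff.2 hy
  calc (G.neighborSet x).ncard = (σ '' G.neighborSet x).ncard :=
        (Set.ncard_image_of_injective _ σ.injective).symm
    _ ≤ (G.neighborSet (σ x)).ncard := Set.ncard_le_ncard hsub (hG.finite_neighbors _)
    _ ≤ D := hD (Set.mem_image_of_mem _ hσx)

lemma finite_unitCell_mem (hG : IsPlanarLattice G pos) (C : Finset (ℤ × ℤ)) :
    {x | unitCell pos x ∈ C}.Finite :=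
  (C.finite_toSet.biUnion fun v _ => finite_unitCell hG v).subset fun _ hx =>
    Set.mem_biUnion hx rfl

lemma ncard_unitCell_mem_le (hG : IsPlanarLattice G pos) (C : Finset (ℤ × ℤ)) :
    {x | unitCell pos x ∈ C}.ncard ≤ C.card * {x | unitCell pos x = 0}.ncard := by
  rw [← Set.ncard_coe_finset C, ← Set.ncard_prod]
  refine Set.ncard_le_ncard_of_injOn
    (fun x => (unitCell pos x, hG.translate (-unitCell pos x) x)) ?_ ?_
    (C.finite_toSet.prod (finite_unitCell hG 0))
  · intro x hx
    refine ⟨hx, ?_⟩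
    change unitCell pos _ = 0
    rw [unitCell_translate, add_neg_cancel]
  · intro x _ y _ h
    obtain ⟨hcell, htranslate⟩ := Prod.ext_iff.1 h
    simp only at hcell htranslate
    rw [hcell] at htranslate
    exact (hG.translate _).injective htranslate

/-- The edges with both end-points in `S`. -/
def edgesIn (G : SimpleGraph V) (S : Set V) : Set G.edgeSet := {e | ∀ x ∈ (e : Sym2 V), x ∈ S}

lemma finite_edgesIn {S : Set V} (hS : S.Finite) : (edgesIn G S).Finite := by
  refine Set.Finite.of_finite_image (f := Subtype.val) ?_ Subtype.val_injective.injOn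
  refine ((hS.prod hS).image fun t : V × V => s(t.1, t.2)).subset ?_
  rintro _ ⟨⟨e, he⟩, h, rfl⟩
  induction e with
  | _ a b => exact ⟨(a, b), ⟨h a (by simp), h b (by simp)⟩, rfl⟩

lemma mem_edgesIn_mapEdgeSet (σ : G ≃g G) (S : Set V) (e : G.edgeSet) :
    σ.mapEdgeSet e ∈ edgesIn G S ↔ e ∈ edgesIn G (σ ⁻¹' S) := by
  constructor
  · intro h x hx
    exact h _ ((mem_mapEdgeSet_iff σ x e).2 hx)
  · intro h x hx
    obtain ⟨x, rfl⟩ := σ.surjective x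
    exact h x ((mem_mapEdgeSet_iff σ x e).1 hx)

lemma exists_adj_notMem_of_mem_boundary {E : Finset G.edgeSet} {S : Set V}
    (hE : (E : Set G.edgeSet) = edgesIn G S) {x : V} (hx : x ∈ boundary G E) :
    x ∈ S ∧ ∃ y, G.Adj x y ∧ y ∉ S := by
  have hmem (e : G.edgeSet) : e ∈ E ↔ e ∈ edgesIn G S := by rw [← hE, Finset.mem_coe]
  obtain ⟨⟨e, he, hxe⟩, ⟨e', heG⟩, he', hxe'⟩ := hx
  have hxS : x ∈ S := (hmem e).1 he x hxe
  obtain ⟨y, rfl⟩ := Sym2.mem_iff_exists.1 hxe'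
  refine ⟨hxS, y, heG, fun hyS => he' ((hmem _).2 fun z hz => ?_)⟩
  rcases Sym2.mem_iff.1 hz with rfl | rfl
  exacts [hxS, hyS]

/-- The vertices in the square `[a, b) × [a, b)`. -/
def square (pos : V → ℂ) (a b : ℤ) : Set V :=
  {x | unitCell pos x ∈ Finset.Ico a b ×ˢ Finset.Ico a b}

lemma mem_square {a b : ℤ} {x : V} : x ∈ square pos a b ↔
    (a ≤ (pos x).re ∧ (pos x).re < b) ∧ a ≤ (pos x).im ∧ (pos x).im < b := by
  simp only [square, unitCell, Set.mem_ofPred_eq, Finset.mem_product, Finset.mem_Ico,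
    Int.le_floor, Int.floor_lt]

lemma ncard_boundary_square_le (hG : IsPlanarLattice G pos) {s : ℕ}
    (hs : ∀ x y, G.Adj x y → |(pos x).re - (pos y).re| ≤ s ∧ |(pos x).im - (pos y).im| ≤ s)
    (n : ℕ) {E : Finset G.edgeSet}
    (hE : (E : Set G.edgeSet) = edgesIn G (square pos (-s) (n + s))) :
    (boundary G E).ncard ≤ (4 * s * n + 4 * s ^ 2) * {x | unitCell pos x = 0}.ncard := by
  set M : Finset (ℤ × ℤ) := Finset.Ico (-s : ℤ) (n + s) ×ˢ Finset.Ico (-s : ℤ) (n + s) with hM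
  set N : Finset (ℤ × ℤ) := Finset.Ico (0 : ℤ) n ×ˢ Finset.Ico (0 : ℤ) n with hN
  have hcard : (M \ N).card = 4 * s * n + 4 * s ^ 2 := by
    have hNM : N ⊆ M := by
      intro v hv
      simp only [hN, hM, Finset.mem_product, Finset.mem_Ico] at hv ⊢
      omega
    have hMc : ((n : ℤ) + s - -s).toNat = n + 2 * s := by omega
    have hNc : ((n : ℤ) - 0).toNat = n := by omega
    rw [Finset.card_sdiff_of_subset hNM, hM, hN, Finset.card_product, Finset.card_product,
      Int.card_Ico, Int.card_Ico, hMc, hNc, Nat.sub_eq_iff_eq_add (by gcongr <;> omega)]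
    ring
  rw [← hcard]
  refine (Set.ncard_le_ncard (fun x hx => ?_) (finite_unitCell_mem hG (M \ N))).trans
    (ncard_unitCell_mem_le hG (M \ N))
  obtain ⟨hxS, y, hxy, hy⟩ := exists_adj_notMem_of_mem_boundary hE hx
  refine Finset.mem_sdiff.2 ⟨hxS, fun hxN => hy ?_⟩
  obtain ⟨hre, him⟩ := hs x y hxy
  rw [abs_le] at hre him
  obtain ⟨⟨hre0, hren⟩, him0, himn⟩ := mem_square.1 hxN
  push_cast at hre0 hren him0 himn
  rw [mem_square]
  push_cast
  refine ⟨⟨?_, ?_⟩, ?_, ?_⟩ <;> linarith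

lemma mem_edgesIn_square_of_translate_mem (hG : IsPlanarLattice G pos) {S : Finset G.edgeSet}
    {s n : ℕ} (hs : ∀ x ∈ verts G S, |(pos x).re| ≤ s ∧ |(pos x).im| ≤ s) {v : ℤ × ℤ}
    (hv : v ∈ Finset.Ico (0 : ℤ) n ×ˢ Finset.Ico (0 : ℤ) n) {e : G.edgeSet} (he : e ∈ S) :
    (hG.translate v).mapEdgeSet e ∈ edgesIn G (square pos (-s) (n + s)) := by
  rw [mem_edgesIn_mapEdgeSet]
  intro x hx
  obtain ⟨hre, him⟩ := hs x ⟨e, he, hx⟩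
  rw [abs_le] at hre him
  simp only [Finset.mem_product, Finset.mem_Ico] at hv
  have hv1 : (0 : ℝ) ≤ v.1 ∧ (v.1 : ℝ) < n := by exact_mod_cast hv.1
  have hv2 : (0 : ℝ) ≤ v.2 ∧ (v.2 : ℝ) < n := by exact_mod_cast hv.2
  rw [Set.mem_preimage, mem_square, hG.re_translate, hG.im_translate]
  push_cast
  refine ⟨⟨?_, ?_⟩, ?_, ?_⟩ <;> linarith

lemma ncard_translates_le (hG : IsPlanarLattice G pos) (N : Finset (ℤ × ℤ))
    (S : Finset G.edgeSet) (e : G.edgeSet) :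
    {v | v ∈ N ∧ e ∈ (hG.translate v).mapEdgeSet '' S}.ncard ≤ (verts G S).ncard := by
  obtain ⟨e, he⟩ := e
  induction e with | _ a b
  refine Set.ncard_le_ncard_of_injOn (fun v => (hG.translate v).symm a) ?_ ?_ (finite_verts S)
  · rintro v ⟨-, e, heS, hev⟩
    refine ⟨e, heS, ?_⟩
    rw [← mem_mapEdgeSet_iff (hG.translate v), hev, RelIso.apply_symm_apply]
    exact Sym2.mem_mk_left a b
  · intro v _ v' _ h
    have hcell (w : ℤ × ℤ) : unitCell pos a = unitCell pos ((hG.translate w).symm a) + w := by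
      rw [← unitCell_translate hG, RelIso.apply_symm_apply]
    have hvv' := (hcell v).symm.trans (hcell v')
    simp only at h
    rwa [h, add_right_inj] at hvv'

section Lipschitz

variable {E : Finset G.edgeSet}

lemma DeterminedBy.indicator_extend_le {A : Set (Config G)} {S : Set G.edgeSet}
    (hA : DeterminedBy A S) (η η' : E → Bool) :
    A.indicator (1 : Config G → ℝ) (extend G E η) ≤ A.indicator 1 (extend G E η') +
      ({e : E | η e ≠ η' e ∧ (e : G.edgeSet) ∈ S}.ncard : ℝ) := by
  rcases Set.eq_empty_or_nonempty {e : E | η e ≠ η' e ∧ (e : G.edgeSet) ∈ S} with h | h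
  · have hagree : ∀ e ∈ S, extend G E η e = extend G E η' e := by
      intro e he
      by_cases heE : e ∈ E
      · rw [extend_of_mem _ heE, extend_of_mem _ heE]
        by_contra hne
        exact (h.subset ⟨hne, he⟩ : (⟨e, heE⟩ : E) ∈ (∅ : Set E))
      · rw [extend_of_notMem _ heE, extend_of_notMem _ heE]
    have hmem := hA.mem_iff hagree
    by_cases hη : extend G E η ∈ A
    · simp [h, hη, hmem.1 hη]
    · simp [h, hη, mt hmem.2 hη]
  · have hone : (1 : ℝ) ≤ {e : E | η e ≠ η' e ∧ (e : G.edgeSet) ∈ S}.ncard :=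
      Nat.one_le_cast.2 ((Set.ncard_pos (Set.toFinite _)).2 h)
    have hle : A.indicator (1 : Config G → ℝ) (extend G E η) ≤ 1 :=
      Set.indicator_le_self' (fun _ _ => zero_le_one) _
    exact (hle.trans hone).trans
      (le_add_of_nonneg_left (Set.indicator_nonneg (fun _ _ => zero_le_one) _))

lemma sum_indicator_extend_le {κ : Type*} (s : Finset κ) {A : κ → Set (Config G)}
    {S : κ → Set G.edgeSet} (hA : ∀ i ∈ s, DeterminedBy (A i) (S i)) {C : ℕ}
    (hC : ∀ e, {i | i ∈ s ∧ e ∈ S i}.ncard ≤ C) (η η' : E → Bool) :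
    ∑ i ∈ s, (A i).indicator (1 : Config G → ℝ) (extend G E η) ≤
      ∑ i ∈ s, (A i).indicator (1 : Config G → ℝ) (extend G E η') + C * hammingDist η η' := by
  classical
  have hdouble : ∑ i ∈ s, {e : E | η e ≠ η' e ∧ (e : G.edgeSet) ∈ S i}.ncard ≤
      C * hammingDist η η' := by
    have hfiber (i : κ) : {e : E | η e ≠ η' e ∧ (e : G.edgeSet) ∈ S i}.ncard =
        ∑ e with η e ≠ η' e, if (e : G.edgeSet) ∈ S i then 1 else 0 := by
      rw [Finset.sum_boole, Finset.filter_filter, ← Set.ncard_coe_finset, Finset.coe_filter,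
        Nat.cast_id]
      simp
    simp only [hfiber]
    rw [Finset.sum_comm, mul_comm, hammingDist, ← smul_eq_mul]
    refine Finset.sum_le_card_nsmul _ _ _ fun e _ => ?_
    rw [Finset.sum_boole, Nat.cast_id, ← Set.ncard_coe_finset, Finset.coe_filter]
    exact hC e
  calc ∑ i ∈ s, (A i).indicator (1 : Config G → ℝ) (extend G E η)
      ≤ ∑ i ∈ s, ((A i).indicator 1 (extend G E η') +
          ({e : E | η e ≠ η' e ∧ (e : G.edgeSet) ∈ S i}.ncard : ℝ)) :=
        Finset.sum_le_sum fun i hi => (hA i hi).indicator_extend_le η η'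
    _ ≤ _ := by
      rw [Finset.sum_add_distrib]
      exact add_le_add_right (by exact_mod_cast hdouble) _

end Lipschitz

lemma DeterminedBy.pull {A : Set (Config G)} {S : Set G.edgeSet} (h : DeterminedBy A S)
    (σ : G ≃g G) : DeterminedBy {ω | pull σ ω ∈ A} (σ.mapEdgeSet '' S) :=
  fun _ _ hω => h _ _ fun _ he => hω _ (Set.mem_image_of_mem _ he)

lemma exists_exp_mul_le {p p' : ℝ} (hpp' : p < p') (C : ℕ) :
    ∃ δ : ℝ, 0 < δ ∧ p * Real.exp (δ * C) * (1 - p') ≤ (1 - p) * p' := by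
  have hlt : p * Real.exp (0 * C) * (1 - p') < (1 - p) * p' := by
    rw [zero_mul, Real.exp_zero]; nlinarith
  have hcont : Continuous fun δ : ℝ => p * Real.exp (δ * C) * (1 - p') := by fun_prop
  have hev : ∀ᶠ δ in nhds (0 : ℝ), p * Real.exp (δ * C) * (1 - p') < (1 - p) * p' :=
    hcont.continuousAt.eventually_lt continuousAt_const hlt
  obtain ⟨δ, h1, h2⟩ := ((hev.filter_mono nhdsWithin_le_nhds).and
    (self_mem_nhdsWithin (a := (0 : ℝ)) (s := Set.Ioi 0))).exists
  exact ⟨δ, h2, h1.le⟩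

lemma le_of_forall_sq_mul_le {a b c d : ℝ}
    (h : ∀ n : ℕ, (n : ℝ) ^ 2 * a ≤ (n : ℝ) ^ 2 * b + (c * n + d)) : a ≤ b := by
  by_contra hlt
  push Not at hlt
  obtain ⟨n, hn⟩ := exists_nat_gt (max 1 ((|c| + |d|) / (a - b)))
  have h1 : (1 : ℝ) < n := (le_max_left _ _).trans_lt hn
  have h2 : |c| + |d| < n * (a - b) := by
    rw [← div_lt_iff₀ (by linarith)]
    exact (le_max_right _ _).trans_lt hn
  have h3 := h n
  have h4 : c * n ≤ |c| * n := mul_le_mul_of_nonneg_right (le_abs_self c) (by linarith)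
  have h5 : d ≤ |d| * n := (le_abs_self d).trans (le_mul_of_one_le_right (abs_nonneg d) h1.le)
  nlinarith

section Domination

variable {p p' q : ℝ} {φ : Measure (Config G)} {A : Set (Config G)} {S : Finset G.edgeSet}

lemma sq_mul_measureReal_le_expect_top (hG : IsPlanarLattice G pos)
    (hφ : IsInfiniteVolume G p q φ) (hp0 : 0 ≤ p) (hp1 : p < 1) (hq : 1 ≤ q)
    (hA : IsUpperSet A) (hS : DeterminedBy A (S : Set G.edgeSet)) {s n : ℕ}
    (hs : ∀ x ∈ verts G S, |(pos x).re| ≤ s ∧ |(pos x).im| ≤ s) {E : Finset G.edgeSet}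
    (hE : (E : Set G.edgeSet) = edgesIn G (square pos (-s) (n + s))) :
    (n : ℝ) ^ 2 * φ.real A ≤ expect G p q E ⊤ fun ω =>
      ∑ v ∈ Finset.Ico (0 : ℤ) n ×ˢ Finset.Ico (0 : ℤ) n,
        A.indicator 1 (pull (hG.translate v) ω) := by
  have := hG.countable
  have htranslate : ∀ v ∈ Finset.Ico (0 : ℤ) n ×ˢ Finset.Ico (0 : ℤ) n,
      φ.real A ≤ expect G p q E ⊤ fun ω => A.indicator 1 (pull (hG.translate v) ω) := by
    intro v hv
    rw [expect_top_pull]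
    refine hφ.measureReal_le_eventProb_top hp0 hp1 hq hA (hS.mono fun e he => ?_)
    rw [Finset.mem_coe, ← mapEdgeSet_mem_mapEdges (hG.translate v), mapEdges_symm,
      ← Finset.mem_coe, hE]
    exact mem_edgesIn_square_of_translate_mem hG hs hv he
  rw [expect_sum]
  refine le_trans (le_of_eq ?_) (Finset.card_nsmul_le_sum _ _ (φ.real A) htranslate)
  simp [sq]

lemma expect_bot_le_sq_mul (hG : IsPlanarLattice G pos) {b : ℝ}
    (hb : ∀ E : Finset G.edgeSet, eventProb G p q E ⊥ A ≤ b) (n : ℕ) (E : Finset G.edgeSet) :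
    (expect G p q E ⊥ fun ω => ∑ v ∈ Finset.Ico (0 : ℤ) n ×ˢ Finset.Ico (0 : ℤ) n,
      A.indicator 1 (pull (hG.translate v) ω)) ≤ (n : ℝ) ^ 2 * b := by
  rw [expect_sum]
  refine (Finset.sum_le_card_nsmul _ _ b fun v _ =>
    (expect_bot_pull p q (hG.translate v) E _).le.trans (hb _)).trans (le_of_eq ?_)
  simp [sq]

lemma mul_expect_top_le_add_mul_expect_bot {E : Finset G.edgeSet} (hp0 : 0 ≤ p) (hp1 : p < 1)
    (hp'0 : 0 ≤ p') (hp'1 : p' < 1) (hq : 1 ≤ q) {C δ : ℝ} (hδ0 : 0 ≤ δ)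
    (hδ : p * Real.exp (δ * C) * (1 - p') ≤ (1 - p) * p') {f : Config G → ℝ} (hf : Monotone f)
    (hLip : ∀ η η' : E → Bool, f (extend G E η) ≤ f (extend G E η') + C * hammingDist η η') :
    δ * expect G p q E ⊤ f ≤ (boundary G E).ncard * Real.log q + δ * expect G p' q E ⊥ f := by
  have hq0 := zero_lt_one.trans_le hq
  refine Real.exp_le_exp.1 ?_
  calc Real.exp (δ * expect G p q E ⊤ f)
      = Real.exp (expect G p q E ⊤ fun ω => δ * f ω) := by rw [expect_const_mul]
    _ ≤ expect G p q E ⊤ (fun ω => Real.exp (δ * f ω)) := exp_expect_le hp0 hp1 hq _ _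
    _ ≤ q ^ (boundary G E).ncard * expect G p q E ⊥ (fun ω => Real.exp (δ * f ω)) :=
      expect_top_le_mul_expect_bot hp0 hp1 hq fun _ => (Real.exp_pos _).le
    _ ≤ q ^ (boundary G E).ncard * Real.exp (δ * expect G p' q E ⊥ f) :=
      mul_le_mul_of_nonneg_left
        (expect_exp_le hp0 hp1 hp'0 hp'1 hq ⊥ hδ0 hδ hf fun η η' _ => hLip η η')
        (pow_nonneg hq0.le _)
    _ = Real.exp ((boundary G E).ncard * Real.log q + δ * expect G p' q E ⊥ f) := by
      rw [Real.exp_add, Real.exp_nat_mul, Real.exp_log hq0]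

/-- The number of translates of `A` by vectors of an `n × n` square is, up to the boundary cost
`q ^ |∂E| = exp (O(n))`, controlled at `p` with wired boundary conditions by its expectation at
`p'` with free ones; dividing by `n ^ 2` removes that cost. -/
theorem IsInfiniteVolume.measureReal_le_of_eventProb_bot_le (hG : IsPlanarLattice G pos)
    (hp0 : 0 ≤ p) (hpp' : p < p') (hp'1 : p' < 1) (hq : 1 ≤ q) (hφ : IsInfiniteVolume G p q φ)
    (hA : IsUpperSet A) (hS : DeterminedBy A (S : Set G.edgeSet)) {b : ℝ}
    (hb : ∀ E : Finset G.edgeSet, eventProb G p' q E ⊥ A ≤ b) : φ.real A ≤ b := by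
  obtain ⟨δ, hδ0, hδ⟩ := exists_exp_mul_le hpp' (verts G S).ncard
  obtain ⟨s, hs_edge, hs_verts⟩ : ∃ s : ℕ,
      (∀ x y, G.Adj x y → |(pos x).re - (pos y).re| ≤ s ∧ |(pos x).im - (pos y).im| ≤ s) ∧
      ∀ x ∈ verts G S, |(pos x).re| ≤ s ∧ |(pos x).im| ≤ s := by
    obtain ⟨ℓ, -, hℓ⟩ := exists_edge_bound hG
    obtain ⟨r, hr⟩ := ((finite_verts S).image fun x => max |(pos x).re| |(pos x).im|).bddAbove
    obtain ⟨s, hs⟩ := exists_nat_ge (max r ℓ)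
    exact ⟨s, fun x y h => (hℓ x y h).imp ((le_max_right r _).trans hs).trans'
      ((le_max_right r _).trans hs).trans', fun x hx => max_le_iff.1
        ((hr (Set.mem_image_of_mem _ hx)).trans ((le_max_left r _).trans hs))⟩
  set D := {x | unitCell pos x = 0}.ncard
  refine le_of_forall_sq_mul_le (c := Real.log q / δ * D * (4 * s))
    (d := Real.log q / δ * D * (4 * s ^ 2)) fun n => ?_
  set E : Finset G.edgeSet :=
    (finite_edgesIn (G := G) (finite_unitCell_mem hG _ : (square pos (-s) (n + s)).Finite)).toFinset
  have hE : (E : Set G.edgeSet) = edgesIn G (square pos (-s) (n + s)) := Set.Finite.coe_toFinset _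
  set N := Finset.Ico (0 : ℤ) n ×ˢ Finset.Ico (0 : ℤ) n
  have hcompare := mul_expect_top_le_add_mul_expect_bot (E := E) hp0 (hpp'.trans hp'1)
    (hp0.trans hpp'.le) hp'1 hq hδ0.le hδ
    (f := fun ω => ∑ v ∈ N, A.indicator 1 (pull (hG.translate v) ω))
    (fun ω ω' h => Finset.sum_le_sum fun v _ => monotone_indicator_one hA (pull_mono _ h))
    (sum_indicator_extend_le N (A := fun v => {ω | pull (hG.translate v) ω ∈ A})
      (fun v _ => hS.pull _) (ncard_translates_le hG N S))
  have hlow := sq_mul_measureReal_le_expect_top hG hφ hp0 (hpp'.trans hp'1) hq hA hS hs_verts hE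
  have hup := expect_bot_le_sq_mul hG hb n E
  have hboundary : ((boundary G E).ncard : ℝ) ≤ (4 * s * n + 4 * s ^ 2) * D := by
    exact_mod_cast ncard_boundary_square_le hG hs_edge n hE
  refine le_of_mul_le_mul_left ?_ hδ0
  calc δ * ((n : ℝ) ^ 2 * φ.real A) ≤ δ * expect G p q E ⊤ _ := by gcongr
    _ ≤ (boundary G E).ncard * Real.log q + δ * expect G p' q E ⊥ _ := hcompare
    _ ≤ (4 * s * n + 4 * s ^ 2) * D * Real.log q + δ * ((n : ℝ) ^ 2 * b) := by
      gcongr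
      exact Real.log_nonneg hq
    _ = _ := by
      field_simp
      ring

end Domination

section Within

/-- The edges of `H` with both end-points in `S`. -/
def within (H : SimpleGraph V) (S : Set V) : SimpleGraph V where
  Adj x y := H.Adj x y ∧ x ∈ S ∧ y ∈ S
  symm := ⟨fun _ _ h => ⟨h.1.symm, h.2.2, h.2.1⟩⟩
  loopless := ⟨fun x h => H.loopless.irrefl x h.1⟩

lemma within_le (H : SimpleGraph V) (S : Set V) : within H S ≤ H := fun _ _ h => h.1

lemma within_mono {H H' : SimpleGraph V} {S S' : Set V} (h : H ≤ H') (hS : S ⊆ S') :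
    within H S ≤ within H' S' :=
  fun _ _ hxy => ⟨h hxy.1, hS hxy.2.1, hS hxy.2.2⟩

lemma forall_reachable_of_closed {H : SimpleGraph V} {P : V → Prop} {x y : V}
    (hstep : ∀ a b, H.Adj a b → P a → P b) (hxy : H.Reachable x y) (hx : P x) : P y := by
  obtain ⟨w⟩ := hxy
  induction w with
  | nil => exact hx
  | cons h _ ih => exact ih (hstep _ _ h hx)

lemma reachable_within_of_forall {H : SimpleGraph V} {S : Set V} {x y : V}
    (hS : ∀ z, H.Reachable x z → z ∈ S) (hxy : H.Reachable x y) :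
    (within H S).Reachable x y := by
  refine (forall_reachable_of_closed (P := fun z => H.Reachable x z ∧ (within H S).Reachable x z)
    ?_ hxy ⟨.refl _, .refl _⟩).2
  rintro a b hab ⟨hxa, hxa'⟩
  have hxb := hxa.trans hab.reachable
  exact ⟨hxb, hxa'.trans (SimpleGraph.Adj.reachable ⟨hab, hS a hxa, hS b hxb⟩)⟩

lemma exists_reachable_within_strip {H : SimpleGraph V} (h : V → ℝ) {α β : ℝ} {x y : V}
    (hjump : ∀ a b, H.Adj a b → h a ≤ α → h b < β) (hxy : H.Reachable x y) (hαβ : α < β)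
    (hx : h x ≤ α) (hy : β ≤ h y) :
    ∃ z x' y' z', H.Adj z x' ∧ h z ≤ α ∧ H.Adj y' z' ∧ β ≤ h z' ∧
      (α < h x' ∧ h x' < β) ∧ (α < h y' ∧ h y' < β) ∧
      (within H {w | α < h w ∧ h w < β}).Reachable x' y' := by
  by_contra hno
  have key : h y ≤ α ∨ (α < h y ∧ h y < β) ∧ ∃ z x', H.Adj z x' ∧ h z ≤ α ∧
      (α < h x' ∧ h x' < β) ∧ (within H {w | α < h w ∧ h w < β}).Reachable x' y := by
    refine forall_reachable_of_closed (P := fun y => h y ≤ α ∨ (α < h y ∧ h y < β) ∧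
      ∃ z x', H.Adj z x' ∧ h z ≤ α ∧ (α < h x' ∧ h x' < β) ∧
        (within H {w | α < h w ∧ h w < β}).Reachable x' y) ?_ hxy (Or.inl hx)
    intro a b hab ha
    rcases le_or_gt (h b) α with hb | hb
    · exact Or.inl hb
    rcases ha with ha | ⟨ha, z, x', hz, hzα, hx', hr⟩
    · have hb' := hjump a b hab ha
      exact Or.inr ⟨⟨hb, hb'⟩, a, b, hab, ha, ⟨hb, hb'⟩, .refl _⟩
    · rcases lt_or_ge (h b) β with hb' | hb'
      · exact Or.inr ⟨⟨hb, hb'⟩, z, x', hz, hzα, hx',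
          hr.trans (SimpleGraph.Adj.reachable ⟨hab, ha, hb, hb'⟩)⟩
      · exact absurd ⟨z, x', a, b, hz, hzα, hab, hb', hx', ha, hr⟩ hno
  rcases key with hyα | ⟨⟨-, hyβ⟩, -⟩
  exacts [absurd (hy.trans hyα) (not_le.2 hαβ), absurd hy (not_le.2 hyβ)]

lemma exists_exit {H : SimpleGraph V} {S : Set V} {x y : V} (hxy : H.Reachable x y) (hx : x ∈ S)
    (hy : y ∉ S) : ∃ z z', (within H S).Reachable x z ∧ z ∈ S ∧ H.Adj z z' ∧ z' ∉ S := by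
  by_contra hno
  refine hy (forall_reachable_of_closed (P := fun y => y ∈ S ∧ (within H S).Reachable x y)
    ?_ hxy ⟨hx, .refl _⟩).1
  rintro a b hab ⟨ha, hr⟩
  by_cases hb : b ∈ S
  · exact ⟨hb, hr.trans (SimpleGraph.Adj.reachable ⟨hab, ha, hb⟩)⟩
  · exact absurd ⟨a, b, hr, ha, hab, hb⟩ hno

lemma within_openGraph_congr {S : Set V} {ω ω' : Config G}
    (h : ∀ e ∈ edgesIn G S, ω e = ω' e) :
    within (openGraph G ω) S ≤ within (openGraph G ω') S := by
  rintro x y ⟨⟨hG, ho⟩, hx, hy⟩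
  refine ⟨⟨hG, ?_⟩, hx, hy⟩
  rw [← h _ ?_, ho]
  intro z hz
  rcases Sym2.mem_iff.1 hz with rfl | rfl
  exacts [hx, hy]

/-- The event that some pair of vertices satisfying `P` is connected inside `S`. -/
def connectedWithin (G : SimpleGraph V) (S : Set V) (P : V → V → Prop) : Set (Config G) :=
  {ω | ∃ x y, P x y ∧ (within (openGraph G ω) S).Reachable x y}

lemma isUpperSet_connectedWithin (S : Set V) (P : V → V → Prop) :
    IsUpperSet (connectedWithin G S P) := by
  rintro ω ω' h ⟨x, y, hP, hr⟩
  exact ⟨x, y, hP, hr.mono (within_mono (openGraph_mono h) le_rfl)⟩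

lemma determinedBy_connectedWithin (S : Set V) (P : V → V → Prop) :
    DeterminedBy (connectedWithin G S P) (edgesIn G S) := by
  rintro ω ω' h ⟨x, y, hP, hr⟩
  exact ⟨x, y, hP, hr.mono (within_openGraph_congr h)⟩

lemma pull_mem_connectedWithin (σ : G ≃g G) {S S' : Set V} {P P' : V → V → Prop} {ω : Config G}
    (hS : ∀ x, σ x ∈ S' → x ∈ S) (hP : ∀ x y, P' (σ x) (σ y) → P x y)
    (h : ω ∈ connectedWithin G S' P') : pull σ ω ∈ connectedWithin G S P := by
  obtain ⟨x, y, hxy, hr⟩ := h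
  let f : within (openGraph G ω) S' →g within (openGraph G (pull σ ω)) S :=
    { toFun := σ.symm
      map_rel' := by
        rintro a b ⟨hab, ha, hb⟩
        obtain ⟨a, rfl⟩ := σ.surjective a
        obtain ⟨b, rfl⟩ := σ.surjective b
        rw [RelIso.symm_apply_apply, RelIso.symm_apply_apply]
        exact ⟨(openGraph_pull_adj σ ω a b).2 hab, hS a ha, hS b hb⟩ }
  refine ⟨σ.symm x, σ.symm y, hP _ _ ?_, hr.map f⟩
  rwa [RelIso.apply_symm_apply, RelIso.apply_symm_apply]

end Within

section WeakCrossing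

/-- The rectangle of width `2L` in the coordinate `t` and height `L` in the coordinate `h`, with
lower left corner `(γ, α)`. -/
def rect (t h : V → ℝ) (γ α L : ℝ) : Set V :=
  {z | (γ ≤ t z ∧ t z ≤ γ + 2 * L) ∧ α ≤ h z ∧ h z ≤ α + L}

/-- The event that a rectangle is crossed in its short direction, up to a margin `j`. -/
def weakCross (G : SimpleGraph V) (t h : V → ℝ) (γ α L j : ℝ) : Set (Config G) :=
  connectedWithin G (rect t h γ α L) fun x y => h x ≤ α + j ∧ α + L - j ≤ h y

lemma mem_weakCross_of_reachable {ω : Config G} {H : SimpleGraph V} (hH : H ≤ openGraph G ω)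
    {t h : V → ℝ} {γ α L j : ℝ} (hrect : ∀ u v, H.Adj u v → u ∈ rect t h γ α L) {x y : V}
    (hxy : H.Reachable x y) (hx : h x ≤ α + j) (hy : α + L - j ≤ h y) :
    ω ∈ weakCross G t h γ α L j :=
  ⟨x, y, ⟨hx, hy⟩, hxy.mono fun u v huv => ⟨hH huv, hrect u v huv, hrect v u huv.symm⟩⟩

/-- If the cluster of a crossing of the strip `n L < h < (n + 1) L` avoids one side of the `3L × L`
rectangle, it crosses a `2L × L` rectangle upwards; otherwise it crosses the middle square
sideways. -/
lemma exists_weakCross_of_strip {ω : Config G} {H : SimpleGraph V} (hH : H ≤ openGraph G ω)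
    {t h : V → ℝ} {L ℓ : ℝ} (hL : 4 * ℓ < L) (hℓ : 0 < ℓ)
    (ht : ∀ x y, G.Adj x y → |t x - t y| ≤ ℓ) (hh : ∀ x y, G.Adj x y → |h x - h y| ≤ ℓ)
    {a n : ℤ} (hHt : ∀ x y, H.Adj x y → (a - 1) * L ≤ t x ∧ t x ≤ (a + 2) * L)
    {x y : V} (hxy : H.Reachable x y) (hx : h x ≤ n * L + ℓ) (hy : (n + 1) * L - ℓ ≤ h y) :
    ∃ m : ℤ, |m - a| ≤ 1 ∧ (ω ∈ weakCross G t h (m * L) (n * L) L (2 * ℓ) ∨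
      ω ∈ weakCross G h t (n * L) (m * L) L (2 * ℓ)) := by
  have hstep (f : V → ℝ) (hf : ∀ x y, G.Adj x y → |f x - f y| ≤ ℓ) (u v : V) (huv : H.Adj u v) :
      -ℓ ≤ f u - f v ∧ f u - f v ≤ ℓ := abs_le.1 (hf u v (openGraph_le ω (hH huv)))
  obtain ⟨z, x', y', z', hz, hzα, hz', hzβ, -, -, hr⟩ :=
    exists_reachable_within_strip h (α := n * L + ℓ) (β := (n + 1) * L - ℓ)
      (fun u v huv hu => by linarith [hstep h hh u v huv]) hxy (by linarith) hx hy
  set K := within H {w | n * L + ℓ < h w ∧ h w < (n + 1) * L - ℓ}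
  have hKω : K ≤ openGraph G ω := (within_le _ _).trans hH
  have hKh (u v : V) (huv : K.Adj u v) : n * L ≤ h u ∧ h u ≤ n * L + L :=
    ⟨by linarith [huv.2.1.1], by linarith [huv.2.1.2]⟩
  have hKt (u v : V) (huv : K.Adj u v) : (a - 1) * L ≤ t u ∧ t u ≤ (a + 2) * L := hHt u v huv.1
  have hx' : h x' ≤ n * L + 2 * ℓ := by linarith [hstep h hh z x' hz]
  have hy' : n * L + L - 2 * ℓ ≤ h y' := by linarith [hstep h hh y' z' hz']
  by_cases hright : ∀ w, K.Reachable x' w → t w ≤ (a + 1) * L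
  · refine ⟨a - 1, by simp, Or.inl (mem_weakCross_of_reachable ((within_le _ _).trans hKω)
      (fun u v huv => ⟨?_, hKh u v huv.1⟩) (reachable_within_of_forall hright hr) hx' hy')⟩
    have hu : t u ≤ (a + 1) * L := huv.2.1
    push_cast
    exact ⟨(hKt u v huv.1).1, by linarith⟩
  by_cases hleft : ∀ w, K.Reachable x' w → a * L ≤ t w
  · refine ⟨a, by simp, Or.inl (mem_weakCross_of_reachable ((within_le _ _).trans hKω)
      (fun u v huv => ⟨⟨huv.2.1, ?_⟩, hKh u v huv.1⟩) (reachable_within_of_forall hleft hr)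
      hx' hy')⟩
    linarith [hKt u v huv.1]
  push Not at hright hleft
  obtain ⟨w₁, hw₁, hw₁'⟩ := hright
  obtain ⟨w₂, hw₂, hw₂'⟩ := hleft
  obtain ⟨z₁, x₁, y₁, z₂, hz₁, hz₁α, hz₂, hz₂β, -, -, hr₁⟩ :=
    exists_reachable_within_strip t (α := a * L) (β := (a + 1) * L)
      (fun u v huv hu => by linarith [hstep t ht u v huv.1])
      (hw₂.symm.trans hw₁) (by linarith) hw₂'.le hw₁'.le
  refine ⟨a, by simp, Or.inr (mem_weakCross_of_reachable ((within_le _ _).trans hKω)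
    (fun u v huv => ⟨?_, huv.2.1.1.le, ?_⟩) hr₁ ?_ ?_)⟩
  · exact ⟨(hKh u v huv.1).1, by linarith [(hKh u v huv.1).2]⟩
  · linarith [huv.2.1.2]
  · linarith [hstep t ht _ _ hz₁.1]
  · linarith [hstep t ht _ _ hz₂.1]

lemma exists_weakCross {ω : Config G} {t h : V → ℝ} {L ℓ : ℝ} (hL : 4 * ℓ < L) (hℓ : 0 < ℓ)
    (ht : ∀ x y, G.Adj x y → |t x - t y| ≤ ℓ) (hh : ∀ x y, G.Adj x y → |h x - h y| ≤ ℓ)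
    {H : SimpleGraph V} (hH : H ≤ openGraph G ω)
    {a b : ℤ} {u v : V} (huv : H.Reachable u v) (hut : a * L ≤ t u ∧ t u ≤ (a + 1) * L)
    (huh : b * L ≤ h u ∧ h u ≤ (b + 1) * L)
    (hv : ¬ (((a - 1) * L ≤ t v ∧ t v ≤ (a + 2) * L) ∧ (b - 1) * L ≤ h v ∧ h v ≤ (b + 2) * L)) :
    ∃ m n : ℤ, |m - a| ≤ 1 ∧ |n - b| ≤ 1 ∧
      (ω ∈ weakCross G t h (m * L) (n * L) L (2 * ℓ) ∨
        ω ∈ weakCross G h t (n * L) (m * L) L (2 * ℓ)) := by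
  set Q : Set V := {w | ((a - 1) * L ≤ t w ∧ t w ≤ (a + 2) * L) ∧
    (b - 1) * L ≤ h w ∧ h w ≤ (b + 2) * L}
  obtain ⟨z, z', hr, -, hzz', hz'⟩ := exists_exit huv
    (show u ∈ Q from ⟨⟨by linarith, by linarith⟩, by linarith, by linarith⟩) hv
  have hQ : within H Q ≤ openGraph G ω := (within_le H Q).trans hH
  have hside : (b + 2) * L - ℓ ≤ h z ∨ h z ≤ (b - 1) * L + ℓ ∨ (a + 2) * L - ℓ ≤ t z ∨
      t z ≤ (a - 1) * L + ℓ := by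
    by_contra! hno
    have hzz't := abs_le.1 (ht _ _ (openGraph_le ω (hH hzz')))
    have hzz'h := abs_le.1 (hh _ _ (openGraph_le ω (hH hzz')))
    exact hz' ⟨⟨by linarith, by linarith⟩, by linarith, by linarith⟩
  have vertical {n : ℤ} {x y : V} (hn : |n - b| ≤ 1) (hxy : (within H Q).Reachable x y)
      (hx : h x ≤ n * L + ℓ) (hy : (n + 1) * L - ℓ ≤ h y) : ∃ m n : ℤ, |m - a| ≤ 1 ∧
      |n - b| ≤ 1 ∧ (ω ∈ weakCross G t h (m * L) (n * L) L (2 * ℓ) ∨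
        ω ∈ weakCross G h t (n * L) (m * L) L (2 * ℓ)) := by
    obtain ⟨m, hm, hcross⟩ :=
      exists_weakCross_of_strip hQ hL hℓ ht hh (fun _ _ h => h.2.1.1) hxy hx hy
    exact ⟨m, n, hm, hn, hcross⟩
  have horizontal {m : ℤ} {x y : V} (hm : |m - a| ≤ 1) (hxy : (within H Q).Reachable x y)
      (hx : t x ≤ m * L + ℓ) (hy : (m + 1) * L - ℓ ≤ t y) : ∃ m n : ℤ, |m - a| ≤ 1 ∧
      |n - b| ≤ 1 ∧ (ω ∈ weakCross G t h (m * L) (n * L) L (2 * ℓ) ∨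
        ω ∈ weakCross G h t (n * L) (m * L) L (2 * ℓ)) := by
    obtain ⟨n, hn, hcross⟩ :=
      exists_weakCross_of_strip hQ hL hℓ hh ht (fun _ _ h => h.2.1.2) hxy hx hy
    exact ⟨m, n, hm, hn, hcross.symm⟩
  rcases hside with hup | hdown | hright | hleft
  · exact vertical (n := b + 1) (by simp) hr (by push_cast; linarith) (by push_cast; linarith)
  · exact vertical (n := b - 1) (by simp) hr.symm (by push_cast; linarith)
      (by push_cast; linarith)
  · exact horizontal (m := a + 1) (by simp) hr (by push_cast; linarith) (by push_cast; linarith)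
  · exact horizontal (m := a - 1) (by simp) hr.symm (by push_cast; linarith)
      (by push_cast; linarith)

end WeakCrossing

end FK

namespace IsPlanarLattice

section Zigzag

/-- The triangle wave of period `2j`: the distance to the multiples of `2j`, taken as the norm in
`ℝ / 2jℤ`. It is the height of a folded point. -/
noncomputable def zigzag (j s : ℝ) : ℝ :=
  ‖(s : AddCircle (2 * j))‖

variable {j s : ℝ}

lemma zigzag_nonneg (j s : ℝ) : 0 ≤ zigzag j s :=
  norm_nonneg _

lemma zigzag_le (hj : 0 < j) (s : ℝ) : zigzag j s ≤ j :=
  (AddCircle.norm_le_half_period _ (by positivity)).trans_eq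
    (by rw [abs_of_pos (by positivity), mul_div_cancel_left₀ _ two_ne_zero])

lemma zigzag_eq_abs_sub (hj : 0 < j) (n : ℤ) (hs : |s - n * (2 * j)| ≤ j) :
    zigzag j s = |s - n * (2 * j)| := by
  rw [← (AddCircle.norm_coe_eq_abs_iff (2 * j) (by positivity)).2
    (by rwa [abs_of_pos (by positivity : 0 < 2 * j), mul_div_cancel_left₀ _ two_ne_zero]),
    ← zsmul_eq_mul, AddCircle.coe_sub, AddCircle.coe_zsmul, AddCircle.coe_period, smul_zero,
    sub_zero, zigzag]

lemma zigzag_sub_self (j s : ℝ) (n : ℤ) : zigzag j (n * (2 * j) - s) = zigzag j s := by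
  rw [zigzag, ← zsmul_eq_mul, AddCircle.coe_sub, AddCircle.coe_zsmul, AddCircle.coe_period,
    smul_zero, zero_sub, norm_neg, zigzag]

end Zigzag

variable {V : Type*} {G : SimpleGraph V} {pos : V → ℂ}

lemma exists_conj (hG : IsPlanarLattice G pos) (n : ℤ) :
    ∃ σ : G ≃g G, ∀ x, (pos (σ x)).re = (pos x).re ∧ (pos (σ x)).im = n - (pos x).im := by
  obtain ⟨ρ, hρ⟩ := hG.rotate
  obtain ⟨r, hr⟩ := hG.reflect
  refine ⟨((r.trans ρ).trans ρ).trans (hG.translate (0, n)), fun x => ?_⟩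
  simp [hG.pos_translate, hρ, hr, neg_add_eq_sub]

lemma exists_swap (hG : IsPlanarLattice G pos) :
    ∃ σ : G ≃g G, ∀ x, (pos (σ x)).re = (pos x).im ∧ (pos (σ x)).im = (pos x).re := by
  obtain ⟨ρ, hρ⟩ := hG.rotate
  obtain ⟨r, hr⟩ := hG.reflect
  exact ⟨((r.trans ρ).trans ρ).trans ρ, fun x => by simp [hρ, hr]⟩

lemma eq_of_re_im (hG : IsPlanarLattice G pos) {x y : V} (hre : (pos x).re = (pos y).re)
    (him : (pos x).im = (pos y).im) : x = y :=
  hG.pos_injective (Complex.ext hre him)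

/-- Otherwise the edge and its mirror image would be distinct edges meeting on the axis. -/
lemma reflect_eq_of_im_lt_of_lt_im (hG : IsPlanarLattice G pos) {ρ : G ≃g G} {c : ℝ}
    (hρ : ∀ x, (pos (ρ x)).re = (pos x).re ∧ (pos (ρ x)).im = 2 * c - (pos x).im) {a b : V}
    (hab : G.Adj a b) (ha : (pos a).im < c) (hb : c < (pos b).im) : ρ a = b := by
  by_contra hne
  have hdistinct : s(a, b) ≠ s(ρ a, ρ b) := by
    intro h
    rcases Sym2.eq_iff.1 h with ⟨h, -⟩ | ⟨-, h⟩
    · have := (hρ a).2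
      rw [← h] at this
      linarith
    · exact hne h.symm
  set θ : ℝ := (c - (pos a).im) / ((pos b).im - (pos a).im)
  have hd : 0 < (pos b).im - (pos a).im := by linarith
  have hθ0 : 0 ≤ θ := div_nonneg (by linarith) hd.le
  have hθ1 : θ ≤ 1 := (div_le_one hd).2 (by linarith)
  have hθ : θ * ((pos b).im - (pos a).im) = c - (pos a).im := div_mul_cancel₀ _ hd.ne'
  set z : ℂ := (1 - θ) • pos a + θ • pos b with hz
  have hzim : z.im = c := by
    simp only [hz, Complex.add_im, Complex.smul_im, smul_eq_mul]
    linarith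
  have hmem : z ∈ segment ℝ (pos a) (pos b) := ⟨1 - θ, θ, by linarith, hθ0, by ring, rfl⟩
  have hmem' : z ∈ segment ℝ (pos (ρ a)) (pos (ρ b)) := by
    refine ⟨1 - θ, θ, by linarith, hθ0, by ring, Complex.ext ?_ ?_⟩
    · simp [hz, (hρ a).1, (hρ b).1]
    · rw [hzim]
      simp only [Complex.add_im, Complex.smul_im, smul_eq_mul, (hρ a).2, (hρ b).2]
      linear_combination -hθ
  rcases (hG.planar a b (ρ a) (ρ b) hab (ρ.map_adj_iff.2 hab) hdistinct ⟨hmem, hmem'⟩).1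
    with h | h <;> rw [h] at hzim <;> linarith

/-- Folding is a translation in the slabs with even `k`, and a reflection in those with odd `k`. -/
lemma exists_fold_slab (hG : IsPlanarLattice G pos) (B : ℤ) {j : ℕ} (hj : 1 ≤ j) (k : ℤ) :
    ∃ σ : G ≃g G, ∀ x, B + j * k ≤ (pos x).im → (pos x).im ≤ B + j * (k + 1) →
      (pos (σ x)).re = (pos x).re ∧ (pos (σ x)).im = B + zigzag j ((pos x).im - B) := by
  have hj0 : (0 : ℝ) < j := by exact_mod_cast hj
  rcases Int.even_or_odd' k with ⟨n, rfl | rfl⟩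
  · refine ⟨hG.translate (0, -(j * (2 * n))), fun x hx hx' => ⟨by simp [hG.re_translate], ?_⟩⟩
    push_cast at hx hx'
    have hpos : 0 ≤ (pos x).im - B - n * (2 * j) := by linarith
    rw [zigzag_eq_abs_sub hj0 n (by rw [abs_of_nonneg hpos]; linarith), abs_of_nonneg hpos,
      hG.im_translate]
    push_cast
    ring
  · obtain ⟨σ, hσ⟩ := hG.exists_conj (2 * B + 2 * j * (n + 1))
    refine ⟨σ, fun x hx hx' => ⟨(hσ x).1, ?_⟩⟩
    push_cast at hx hx'
    have hneg : (pos x).im - B - (n + 1 : ℤ) * (2 * j) ≤ 0 := by push_cast; linarith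
    rw [zigzag_eq_abs_sub hj0 (n + 1) (by rw [abs_of_nonpos hneg]; push_cast; linarith),
      abs_of_nonpos hneg, (hσ x).2]
    push_cast
    ring

lemma exists_int_slab {j : ℝ} (hj : 0 < j) (B s : ℝ) :
    ∃ k : ℤ, B + j * k ≤ s ∧ s < B + j * (k + 1) := by
  refine ⟨⌊(s - B) / j⌋, ?_, ?_⟩
  · linarith [(le_div_iff₀' hj).1 (Int.floor_le ((s - B) / j))]
  · linarith [(div_lt_iff₀' hj).1 (Int.lt_floor_add_one ((s - B) / j))]

lemma exists_fold_im (hG : IsPlanarLattice G pos) (B : ℤ) {j : ℕ} (hj : 1 ≤ j) :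
    ∃ Φ : V → V, (∀ x, (pos (Φ x)).re = (pos x).re) ∧
      (∀ x, B ≤ (pos (Φ x)).im ∧ (pos (Φ x)).im ≤ B + j) ∧
      (∀ x, B ≤ (pos x).im → (pos x).im ≤ B + j → Φ x = x) ∧
      ∀ a b, G.Adj a b → Φ a = Φ b ∨ G.Adj (Φ a) (Φ b) := by
  have hj0 : (0 : ℝ) < j := by exact_mod_cast hj
  have hslab (x : V) := exists_int_slab hj0 B (pos x).im
  have hexists (x : V) :
      ∃ y, (pos y).re = (pos x).re ∧ (pos y).im = B + zigzag j ((pos x).im - B) := by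
    obtain ⟨k, hk, hk'⟩ := hslab x
    obtain ⟨σ, hσ⟩ := hG.exists_fold_slab B hj k
    exact ⟨σ x, hσ x hk hk'.le⟩
  choose Φ hre him using hexists
  have hΦ {x y : V} (hyre : (pos y).re = (pos x).re)
      (hyim : (pos y).im = B + zigzag j ((pos x).im - B)) : Φ x = y :=
    hG.eq_of_re_im ((hre x).trans hyre.symm) ((him x).trans hyim.symm)
  have hadj (a b : V) (hab : G.Adj a b) (hle : (pos a).im ≤ (pos b).im) :
      Φ a = Φ b ∨ G.Adj (Φ a) (Φ b) := by
    obtain ⟨k, hk, hk'⟩ := hslab a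
    rcases le_or_gt (pos b).im (B + j * (k + 1)) with hb | hb
    · obtain ⟨σ, hσ⟩ := hG.exists_fold_slab B hj k
      obtain ⟨hare, haim⟩ := hσ a hk hk'.le
      obtain ⟨hbre, hbim⟩ := hσ b (hk.trans hle) hb
      rw [hΦ hare haim, hΦ hbre hbim]
      exact Or.inr (σ.map_adj_iff.2 hab)
    · obtain ⟨ρ, hρ⟩ := hG.exists_conj (2 * B + 2 * (j * (k + 1)))
      have hb : ρ a = b := hG.reflect_eq_of_im_lt_of_lt_im
        (fun x => ⟨(hρ x).1, by rw [(hρ x).2]; push_cast; ring⟩) hab hk' hb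
      refine Or.inl (hΦ (by rw [hre, ← hb, (hρ a).1]) ?_)
      rw [him, ← zigzag_sub_self j ((pos a).im - B) (k + 1), ← hb, (hρ a).2]
      push_cast
      ring_nf
  refine ⟨Φ, hre, fun x => ?_, fun x hx hx' => hΦ rfl ?_, fun a b hab => ?_⟩
  · rw [him]
    exact ⟨by linarith [zigzag_nonneg j ((pos x).im - B)],
      by linarith [zigzag_le hj0 ((pos x).im - B)]⟩
  · have habs : |(pos x).im - B - (0 : ℤ) * (2 * j)| = (pos x).im - B := by
      simpa using hx
    rw [zigzag_eq_abs_sub hj0 0 (by linarith), habs]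
    ring
  · rcases le_total (pos a).im (pos b).im with h | h
    · exact hadj a b hab h
    · exact (hadj b a hab.symm h).imp Eq.symm SimpleGraph.Adj.symm

lemma exists_fold (hG : IsPlanarLattice G pos) (B : ℤ) {j m : ℕ} (hj : 1 ≤ j) (hm : 1 ≤ m) :
    ∃ Φ : V → V, (∀ x, (0 ≤ (pos (Φ x)).re ∧ (pos (Φ x)).re ≤ m) ∧
        B ≤ (pos (Φ x)).im ∧ (pos (Φ x)).im ≤ B + j) ∧
      (∀ x, 0 ≤ (pos x).re → (pos x).re ≤ m → B ≤ (pos x).im → (pos x).im ≤ B + j → Φ x = x) ∧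
      (∀ x, B ≤ (pos x).im → (pos x).im ≤ B + j → (pos (Φ x)).im = (pos x).im) ∧
      ∀ a b, G.Adj a b → Φ a = Φ b ∨ G.Adj (Φ a) (Φ b) := by
  obtain ⟨Φ, hΦre, hΦim, hΦfix, hΦadj⟩ := hG.exists_fold_im B hj
  obtain ⟨Ψ, hΨre, hΨim, hΨfix, hΨadj⟩ := hG.exists_fold_im 0 hm
  obtain ⟨σ, hσ⟩ := hG.exists_swap
  have him (x : V) : (pos (σ (Ψ (σ x)))).im = (pos x).im := by
    rw [(hσ _).2, hΨre, (hσ _).1]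
  refine ⟨fun x => Φ (σ (Ψ (σ x))), fun x => ⟨?_, hΦim _⟩, fun x hx0 hxm hxB hxj => ?_,
    fun x hxB hxj => ?_, fun a b hab => ?_⟩
  · rw [hΦre, (hσ _).1]
    simpa using hΨim (σ x)
  · have hΨσ : Ψ (σ x) = σ x := hΨfix _ (by simpa [(hσ x).2] using hx0)
      (by simpa [(hσ x).2] using hxm)
    have hσσ : σ (σ x) = x :=
      hG.eq_of_re_im ((hσ _).1.trans (hσ _).2) ((hσ _).2.trans (hσ _).1)
    simp only [hΨσ, hσσ]
    exact hΦfix x hxB hxj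
  · simp only
    rw [hΦfix _ (by rwa [him]) (by rwa [him]), him]
  · rcases hΨadj _ _ (σ.map_adj_iff.2 hab) with h | h
    · exact Or.inl (by simp only [h])
    · exact hΦadj _ _ (σ.map_adj_iff.2 h)

lemma exists_dist_le (hG : IsPlanarLattice G pos) (haxis : ∃ x, (pos x).im = 0) (j : ℕ) :
    ∃ D : ℕ, ∀ (B T : ℤ) (z : V), (T = B ∨ T = B + j) → B ≤ (pos z).im → (pos z).im ≤ B + j →
      ∃ x, (pos x).im = T ∧ G.dist z x ≤ D := by
  obtain ⟨x₀, hx₀⟩ := haxis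
  have hfin : {z | (0 ≤ (pos z).re ∧ (pos z).re ≤ 1) ∧ 0 ≤ (pos z).im ∧ (pos z).im ≤ j}.Finite :=
    hG.finite_of_box 0 1 0 j fun _ hx => hx
  obtain ⟨D, hD⟩ := (hfin.image fun z =>
    max (G.dist z x₀) (G.dist z (hG.translate (0, (j : ℤ)) x₀))).bddAbove
  refine ⟨D, fun B T z hT hzB hzj => ?_⟩
  set σ := hG.translate (-⌊(pos z).re⌋, -B) with hσ
  have hσim (x : V) : (pos (σ x)).im = (pos x).im - B := by
    rw [hσ, hG.im_translate]; push_cast; ring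
  have hmax := hD (Set.mem_image_of_mem _ (show σ z ∈ _ from
    ⟨by simp [hσ, hG.re_translate, Int.floor_le, (Int.lt_floor_add_one (pos z).re).le, add_comm],
      by rw [hσim]; linarith, by rw [hσim]; linarith⟩))
  have hpreimage (y : V) (hy : (pos y).im = T - B) (hdist : G.dist (σ z) y ≤ D) :
      ∃ x, (pos x).im = T ∧ G.dist z x ≤ D := by
    obtain ⟨x, rfl⟩ := σ.surjective y
    obtain ⟨w, hw⟩ := hG.connected.exists_walk_length_eq_dist (σ z) (σ x)
    refine ⟨x, by rw [hσim] at hy; linarith, (SimpleGraph.dist_le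
      ((w.map σ.symm.toHom).copy (σ.symm_apply_apply z) (σ.symm_apply_apply x))).trans ?_⟩
    rwa [SimpleGraph.Walk.length_copy, SimpleGraph.Walk.length_map, hw]
  rcases hT with rfl | rfl
  · exact hpreimage x₀ (by rw [hx₀]; ring) ((le_max_left _ _).trans hmax)
  · refine hpreimage (hG.translate (0, (j : ℤ)) x₀) ?_ ((le_max_right _ _).trans hmax)
    rw [hG.im_translate, hx₀]
    push_cast
    ring

end IsPlanarLattice

namespace FK

variable {V : Type*} {G : SimpleGraph V} {pos : V → ℂ}

section Corridors

lemma mk_mem_edgesIn {S : Set V} {x y : V} (h : G.Adj x y) (hx : x ∈ S) (hy : y ∈ S) :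
    (⟨s(x, y), h⟩ : G.edgeSet) ∈ edgesIn G S := by
  intro z hz
  rcases Sym2.mem_iff.1 hz with rfl | rfl
  exacts [hx, hy]

lemma edgesIn_mono {S T : Set V} (h : S ⊆ T) : edgesIn G S ⊆ edgesIn G T :=
  fun _ he x hx => h (he x hx)

lemma exists_edges_of_walk {S : Set V} {Φ : V → V} (hS : ∀ x, Φ x ∈ S)
    (hΦ : ∀ a b, G.Adj a b → Φ a = Φ b ∨ G.Adj (Φ a) (Φ b)) {x y : V} (w : G.Walk x y) :
    ∃ F : Finset G.edgeSet, F.card ≤ w.length ∧ ↑F ⊆ edgesIn G S ∧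
      ∀ ω : Config G, (∀ e ∈ F, ω e = true) →
        (within (openGraph G ω) S).Reachable (Φ x) (Φ y) := by
  classical
  induction w with
  | nil => exact ⟨∅, by simp, by simp, fun _ _ => .refl _⟩
  | @cons a b c hab w ih =>
    obtain ⟨F, hcard, hFS, hF⟩ := ih
    rcases hΦ a b hab with h | h
    · exact ⟨F, hcard.trans (by simp), hFS, fun ω hω => h ▸ hF ω hω⟩
    · refine ⟨insert ⟨s(Φ a, Φ b), h⟩ F, ?_, ?_, fun ω hω => ?_⟩
      · exact (Finset.card_insert_le _ _).trans (by simpa using hcard)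
      · rw [Finset.coe_insert]
        exact Set.insert_subset (mk_mem_edgesIn h (hS a) (hS b)) hFS
      · have hadj : (within (openGraph G ω) S).Adj (Φ a) (Φ b) :=
          ⟨⟨h, hω _ (Finset.mem_insert_self _ _)⟩, hS a, hS b⟩
        exact hadj.reachable.trans (hF ω fun e he => hω e (Finset.mem_insert_of_mem he))

/-- The rectangle `[0,m] × [B,B+j]`. -/
def corridor (pos : V → ℂ) (m B j : ℝ) : Set V :=
  {x | (0 ≤ (pos x).re ∧ (pos x).re ≤ m) ∧ B ≤ (pos x).im ∧ (pos x).im ≤ B + j}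

lemma exists_corridor (hG : IsPlanarLattice G pos) (haxis : ∃ x, (pos x).im = 0) {j : ℕ}
    (hj : 1 ≤ j) : ∃ D : ℕ, ∀ (m : ℕ) (B T : ℤ), 1 ≤ m → (T = B ∨ T = B + j) →
      ∀ z ∈ corridor pos m B j, ∃ F : Finset G.edgeSet, F.card ≤ D ∧
        ↑F ⊆ edgesIn G (corridor pos m B j) ∧
        ∃ x ∈ corridor pos m B j, (pos x).im = T ∧ ∀ ω : Config G, (∀ e ∈ F, ω e = true) →
          (within (openGraph G ω) (corridor pos m B j)).Reachable z x := by
  obtain ⟨D, hD⟩ := hG.exists_dist_le haxis j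
  refine ⟨D, fun m B T hm hT z hz => ?_⟩
  obtain ⟨Φ, hΦmem, hΦfix, hΦim, hΦadj⟩ := hG.exists_fold B hj hm
  obtain ⟨x, hx, hzx⟩ := hD B T z hT hz.2.1 hz.2.2
  obtain ⟨w, hw⟩ := hG.connected.exists_walk_length_eq_dist z x
  obtain ⟨F, hcard, hFS, hF⟩ :=
    exists_edges_of_walk (S := corridor pos m B j) (Φ := Φ) hΦmem hΦadj w
  have hxB : B ≤ (pos x).im ∧ (pos x).im ≤ B + j := by
    have : (0 : ℝ) ≤ j := Nat.cast_nonneg j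
    rcases hT with rfl | rfl <;> rw [hx] <;> push_cast <;> constructor <;> linarith
  rw [hΦfix z hz.1.1 hz.1.2 hz.2.1 hz.2.2] at hF
  exact ⟨F, hcard.trans (hw.trans_le hzx), hFS, Φ x, hΦmem x,
    (hΦim x hxB.1 hxB.2).trans hx, hF⟩

/-- The vertices of `R` with a neighbour in `S`. -/
def gate (G : SimpleGraph V) (S R : Set V) : Set V := {x | x ∈ R ∧ ∃ z ∈ S, G.Adj z x}

lemma exists_link (hG : IsPlanarLattice G pos) (haxis : ∃ x, (pos x).im = 0) {j : ℕ}
    (hj : 1 ≤ j) : ∃ D : ℕ, ∀ (m : ℕ) (B T : ℤ) (R : Set V), 1 ≤ m → (T = B ∨ T = B + j) →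
      corridor pos m B j ⊆ R → ∀ x ∈ gate G (corridor pos m B j) R,
        ∃ F : Finset G.edgeSet, F.card ≤ D ∧ ↑F ⊆ edgesIn G R ∧
          (∀ S, Disjoint S (corridor pos m B j) → Disjoint (↑F) (edgesIn G S)) ∧
          ∃ y ∈ R, (pos y).im = T ∧ ∀ ω : Config G, (∀ e ∈ F, ω e = true) →
            (within (openGraph G ω) R).Reachable x y := by
  classical
  obtain ⟨D, hD⟩ := exists_corridor hG haxis hj
  refine ⟨D + 1, ?_⟩
  rintro m B T R hm hT hR x ⟨hxR, z, hz, hzx⟩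
  obtain ⟨F, hcard, hFS, y, hy, hyT, hF⟩ := hD m B T hm hT z hz
  refine ⟨insert ⟨s(z, x), hzx⟩ F, (Finset.card_insert_le _ _).trans (by lia), ?_,
    fun S hS => Set.disjoint_left.2 fun e he heS => ?_, y, hR hy, hyT, fun ω hω => ?_⟩
  · rw [Finset.coe_insert]
    exact Set.insert_subset (mk_mem_edgesIn hzx (hR hz) hxR) (hFS.trans (edgesIn_mono hR))
  · rcases Finset.mem_insert.1 he with rfl | he
    · exact Set.disjoint_left.1 hS (heS z (by simp)) hz
    · exact Set.disjoint_left.1 hS (heS _ (Sym2.out_fst_mem _)) (hFS he _ (Sym2.out_fst_mem _))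
  · have hadj : (within (openGraph G ω) R).Adj x z :=
      SimpleGraph.Adj.symm ⟨⟨hzx, hω _ (Finset.mem_insert_self _ _)⟩, hR hz, hxR⟩
    exact hadj.reachable.trans ((hF ω fun e he => hω e (Finset.mem_insert_of_mem he)).mono
      (within_mono le_rfl hR))

end Corridors

section StrongCrossing

/-- The abscissa of a vertex. -/
def reC (pos : V → ℂ) (x : V) : ℝ := (pos x).re

/-- The ordinate of a vertex. -/
def imC (pos : V → ℂ) (x : V) : ℝ := (pos x).im

lemma rect_eq_corridor (L : ℝ) :
    rect (reC pos) (imC pos) 0 0 L = corridor pos (2 * L) 0 L := by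
  simp [rect, corridor, reC, imC]

/-- The event that `[0,2L] × [0,L]` is crossed vertically, as an event of connection inside a set of
vertices. -/
def strongCross (G : SimpleGraph V) (pos : V → ℂ) (L : ℝ) : Set (Config G) :=
  connectedWithin G (corridor pos (2 * L) 0 L) fun x y =>
    x ∈ corridor pos (2 * L) 0 L ∧ (pos x).im = 0 ∧ (pos y).im = L

lemma exists_walk_of_reachable_within {H : SimpleGraph V} {S : Set V} {x y : V} (hx : x ∈ S)
    (h : (within H S).Reachable x y) : ∃ w : H.Walk x y, ∀ z ∈ w.support, z ∈ S := by
  obtain ⟨w⟩ := h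
  induction w with
  | nil => exact ⟨.nil, by simpa using hx⟩
  | cons h _ ih =>
    obtain ⟨w, hw⟩ := ih h.2.2
    exact ⟨.cons h.1 w, by simpa [hx] using hw⟩

lemma strongCross_subset_crossV (L : ℝ) : strongCross G pos L ⊆ crossV G pos (2 * L) L := by
  rintro ω ⟨x, y, ⟨hxR, hx, hy⟩, hr⟩
  obtain ⟨w, hw⟩ := exists_walk_of_reachable_within hxR hr
  exact ⟨x, y, hx, hy, w, fun z hz => ⟨(hw z hz).1, (hw z hz).2.1,
    (hw z hz).2.2.trans_eq (zero_add _)⟩⟩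

/-- The vertices of `[0,2L] × (j,L-j)`. -/
def band (pos : V → ℂ) (L j : ℝ) : Set V :=
  {z ∈ corridor pos (2 * L) 0 L | j < (pos z).im ∧ (pos z).im < L - j}

/-- The event that `x` and `y` are connected inside `[0,2L] × (j,L-j)`. -/
def bandConnected (G : SimpleGraph V) (pos : V → ℂ) (L j : ℝ) (x y : V) : Set (Config G) :=
  {ω | (within (openGraph G ω) (band pos L j)).Reachable x y}

lemma exists_bandConnected_of_mem_weakCross {L j ℓ : ℝ} (hL : 2 * j + ℓ < L) (hℓ0 : 0 ≤ ℓ)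
    (hℓ : ∀ x y, G.Adj x y → |(pos x).im - (pos y).im| ≤ ℓ) {ω : Config G}
    (hω : ω ∈ weakCross G (reC pos) (imC pos) 0 0 L j) :
    ∃ x ∈ gate G (corridor pos (2 * L) 0 j) (corridor pos (2 * L) 0 L),
      ∃ y ∈ gate G (corridor pos (2 * L) (L - j) j) (corridor pos (2 * L) 0 L),
        ω ∈ bandConnected G pos L j x y := by
  rw [weakCross, rect_eq_corridor] at hω
  obtain ⟨u, v, ⟨hu, hv⟩, huv⟩ := hω
  obtain ⟨z, x, y, z', hzx, hz, hyz', hz', -, -, hxy⟩ :=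
    exists_reachable_within_strip (imC pos) (α := j) (β := L - j) (fun a b hab ha => by
      have := abs_le.1 (hℓ a b (openGraph_le ω hab.1))
      simp only [imC] at ha ⊢
      linarith) huv (by linarith) (by linarith) (by linarith)
  refine ⟨x, ⟨hzx.2.2, z, ⟨hzx.2.1.1, hzx.2.1.2.1, by simpa [imC] using hz⟩, openGraph_le ω hzx.1⟩,
    y, ⟨hyz'.2.1, z', ⟨hyz'.2.2.1, hz', ?_⟩, (openGraph_le ω hyz'.1).symm⟩, hxy.mono ?_⟩
  · linarith [hyz'.2.2.2.2]
  · rintro a b ⟨⟨hab, ha, hb⟩, ha', hb'⟩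
    exact ⟨hab, ⟨ha, ha'⟩, hb, hb'⟩

/-- A crossing of the band is continued to the sides of the rectangle by opening boundedly many
edges outside the band. -/
lemma exists_link_strongCross (hG : IsPlanarLattice G pos) (haxis : ∃ x, (pos x).im = 0) {j : ℕ}
    (hj : 1 ≤ j) : ∃ D : ℕ, ∀ L : ℕ, 2 * j ≤ L →
      ∀ x ∈ gate G (corridor pos (2 * L) 0 j) (corridor pos (2 * L) 0 L),
      ∀ y ∈ gate G (corridor pos (2 * L) (L - j) j) (corridor pos (2 * L) 0 L),
        ∃ F : Finset G.edgeSet, F.card ≤ D ∧ ↑F ⊆ edgesIn G (corridor pos (2 * L) 0 L) ∧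
          Disjoint (↑F) (edgesIn G (band pos L j)) ∧
          ∀ ω ∈ bandConnected G pos L j x y, openOn F ω ∈ strongCross G pos L := by
  classical
  obtain ⟨D, hD⟩ := exists_link hG haxis hj
  refine ⟨D + D, fun L hL x hx y hy => ?_⟩
  have hLj : (2 * j : ℝ) ≤ L := by exact_mod_cast hL
  have hL0 : 1 ≤ 2 * L := by lia
  have hbot := hD (2 * L) 0 0 (corridor pos (2 * L) 0 L) hL0 (.inl rfl)
  have htop := hD (2 * L) (L - j) L (corridor pos (2 * L) 0 L) hL0 (.inr (by ring))
  push_cast at hbot htop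
  obtain ⟨F, hFD, hFR, hFdisj, x', hx', hx'0, hF⟩ :=
    hbot (fun z hz => ⟨hz.1, hz.2.1, by linarith [hz.2.2]⟩) x hx
  obtain ⟨F', hF'D, hF'R, hF'disj, y', -, hy'L, hF'⟩ :=
    htop (fun z hz => ⟨hz.1, by linarith [hz.2.1], by linarith [hz.2.2]⟩) y hy
  refine ⟨F ∪ F', (Finset.card_union_le _ _).trans (add_le_add hFD hF'D), ?_, ?_, fun ω hω => ?_⟩
  · rw [Finset.coe_union]
    exact Set.union_subset hFR hF'R
  · rw [Finset.coe_union, Set.disjoint_union_left]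
    exact ⟨hFdisj _ (Set.disjoint_left.2 fun z hz hz' => by linarith [hz.2.1, hz'.2.2]),
      hF'disj _ (Set.disjoint_left.2 fun z hz hz' => by linarith [hz.2.2, hz'.2.1])⟩
  · have hxx' := hF (openOn (F ∪ F') ω) fun e he => openOn_of_mem (Finset.mem_union_left _ he) ω
    have hyy' := hF' (openOn (F ∪ F') ω) fun e he => openOn_of_mem (Finset.mem_union_right _ he) ω
    have hle : ω ≤ openOn (F ∪ F') ω := fun e => by
      by_cases he : e ∈ F ∪ F' <;> simp [openOn, he]
    have hxy :
        (within (openGraph G (openOn (F ∪ F') ω)) (corridor pos (2 * L) 0 L)).Reachable x y :=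
      hω.mono (within_mono (openGraph_mono hle) fun z hz => hz.1)
    exact ⟨x', y', ⟨hx', hx'0, hy'L⟩, hxx'.symm.trans (hxy.trans hyy')⟩

lemma finite_corridor (hG : IsPlanarLattice G pos) (m B j : ℝ) : (corridor pos m B j).Finite :=
  hG.finite_of_box 0 m B (B + j) fun _ hx => hx

theorem exists_weakCross_le (hG : IsPlanarLattice G pos) (haxis : ∃ x, (pos x).im = 0)
    {p q : ℝ} (hp0 : 0 < p) (hp1 : p < 1) (hq : 1 ≤ q) {j : ℕ} (hj : 1 ≤ j) :
    ∃ C : ℝ, 0 < C ∧ ∃ L₀ : ℕ, ∀ L : ℕ, L₀ ≤ L → ∀ φ : Measure (Config G),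
      IsInfiniteVolume G p q φ →
      φ.real (weakCross G (reC pos) (imC pos) 0 0 L j) ≤ C * φ.real (crossV G pos (2 * L) L) := by
  have hcount := hG.countable
  obtain ⟨ℓ, -, hℓ⟩ := exists_edge_bound hG
  obtain ⟨D, hD⟩ := exists_link_strongCross hG haxis hj
  refine ⟨(2 * (q ^ 2 / p)) ^ D, by positivity, 2 * j + ℓ + 1, fun L hL φ hφ => ?_⟩
  have hprob := hφ.isProbabilityMeasure
  have hLr : (2 * j + ℓ + 1 : ℝ) ≤ L := by exact_mod_cast hL
  set E : Finset G.edgeSet :=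
    (finite_edgesIn (G := G) (finite_corridor hG (2 * L) 0 L)).toFinset with hE
  have hEcoe : (E : Set G.edgeSet) = edgesIn G (corridor pos (2 * L) 0 L) := by simp [hE]
  let τ := gate G (corridor pos (2 * L) 0 j) (corridor pos (2 * L) 0 L) ×
    gate G (corridor pos (2 * L) (L - j) j) (corridor pos (2 * L) 0 L)
  have hlink (t : τ) := hD L (by lia) t.1 t.1.2 t.2 t.2.2
  choose F hFD hFE hFdisj hF using hlink
  have hinv (s t : τ) (ω : Config G) :
      openOn (F s) ω ∈ bandConnected G pos L j t.1 t.2 ↔ ω ∈ bandConnected G pos L j t.1 t.2 := by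
    have hagree (e : G.edgeSet) (he : e ∈ edgesIn G (band pos L j)) : openOn (F s) ω e = ω e :=
      openOn_of_notMem (fun heF => Set.disjoint_left.1 (hFdisj s) heF he) ω
    rw [bandConnected, Set.mem_ofPred_eq, Set.mem_ofPred_eq, le_antisymm
      (within_openGraph_congr hagree) (within_openGraph_congr fun e he => (hagree e he).symm)]
  have hcover : weakCross G (reC pos) (imC pos) 0 0 L j ⊆
      ⋃ t : τ, bandConnected G pos L j t.1 t.2 := fun ω hω => by
    obtain ⟨x, hx, y, hy, hxy⟩ := exists_bandConnected_of_mem_weakCross (by linarith)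
      (Nat.cast_nonneg ℓ) (fun x y h => (hℓ x y h).2) hω
    exact Set.mem_iUnion.2 ⟨(⟨x, hx⟩, ⟨y, hy⟩), hxy⟩
  refine (hφ.measureReal_le_mul (E := E) hp0.le hp1 hq (A := strongCross G pos L) ?_ ?_
    fun ξ => (eventProb_mono hp0.le hp1 hq ξ hcover).trans
      (eventProb_iUnion_le_of_openOn hp0 hp1 hq ξ D _ F ?_ hFD hinv hF)).trans
    (mul_le_mul_of_nonneg_left (measureReal_mono (strongCross_subset_crossV _)) (by positivity))
  · rw [hEcoe, weakCross, rect_eq_corridor]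
    exact determinedBy_connectedWithin _ _
  · rw [hEcoe]
    exact determinedBy_connectedWithin _ _
  · exact fun t e he => by simpa [hE] using hFE t he

end StrongCrossing

section UnionAndIntersection

variable {p p' q : ℝ} {E : Finset G.edgeSet} {κ : Type*}

lemma eventProb_union_le (hp0 : 0 ≤ p) (hp1 : p < 1) (hq : 1 ≤ q) (ξ : BoundaryCondition G E)
    (A B : Set (Config G)) :
    eventProb G p q E ξ (A ∪ B) ≤ eventProb G p q E ξ A + eventProb G p q E ξ B := by
  have h : (A ∪ B).indicator (1 : Config G → ℝ) ≤
      fun ω => ∑ b : Bool, (if b then A else B).indicator 1 ω := fun ω => by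
    by_cases hA : ω ∈ A <;> by_cases hB : ω ∈ B <;> simp [hA, hB]
  refine (expect_mono hp0 hp1 hq ξ h).trans_eq ?_
  rw [expect_sum]
  simp [eventProb]

lemma eventProb_biUnion_le (hp0 : 0 ≤ p) (hp1 : p < 1) (hq : 1 ≤ q) (ξ : BoundaryCondition G E)
    (s : Finset κ) (A : κ → Set (Config G)) :
    eventProb G p q E ξ (⋃ i ∈ s, A i) ≤ ∑ i ∈ s, eventProb G p q E ξ (A i) := by
  classical
  induction s using Finset.induction_on with
  | empty => simp [eventProb, expect_const hp0 hp1 hq]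
  | insert i s hi ih =>
    rw [Finset.set_biUnion_insert, Finset.sum_insert hi]
    grw [eventProb_union_le hp0 hp1 hq, ih]

/-- The concentration step: the number of events that occur has exponential moments controlled by
its mean at a larger parameter, so they can all occur only at an exponential cost. -/
lemma eventProb_biInter_le (hp0 : 0 ≤ p) (hp1 : p < 1) (hp'0 : 0 ≤ p') (hp'1 : p' < 1)
    (hq : 1 ≤ q) (ξ : BoundaryCondition G E) (s : Finset κ) {A : κ → Set (Config G)}
    {S : κ → Set G.edgeSet} (hA : ∀ i, IsUpperSet (A i)) (hS : ∀ i, DeterminedBy (A i) (S i))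
    {C : ℕ} (hC : ∀ e, {i | i ∈ s ∧ e ∈ S i}.ncard ≤ C) {δ b : ℝ} (hδ0 : 0 ≤ δ)
    (hδ : p * Real.exp (δ * C) * (1 - p') ≤ (1 - p) * p')
    (hb : ∀ i ∈ s, eventProb G p' q E ξ (A i) ≤ b) :
    eventProb G p q E ξ (⋂ i ∈ s, A i) ≤ Real.exp (-(δ * (1 - b) * s.card)) := by
  set N : Config G → ℝ := fun ω => ∑ i ∈ s, (A i).indicator 1 ω with hN
  have hmoment : expect G p q E ξ (fun ω => Real.exp (δ * N ω)) ≤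
      Real.exp (δ * expect G p' q E ξ N) :=
    expect_exp_le hp0 hp1 hp'0 hp'1 hq ξ hδ0 hδ
      (fun ω ω' h => Finset.sum_le_sum fun i _ => monotone_indicator_one (hA i) h)
      fun η η' _ => sum_indicator_extend_le s (fun i _ => hS i) hC η η'
  have hmean : expect G p' q E ξ N ≤ s.card * b := by
    rw [hN, expect_sum, ← nsmul_eq_mul]
    exact Finset.sum_le_card_nsmul _ _ _ hb
  have hmarkov : Real.exp (δ * s.card) * eventProb G p q E ξ (⋂ i ∈ s, A i) ≤
      expect G p q E ξ (fun ω => Real.exp (δ * N ω)) := by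
    rw [eventProb, ← expect_const_mul]
    refine expect_mono hp0 hp1 hq ξ fun ω => ?_
    by_cases hω : ω ∈ ⋂ i ∈ s, A i
    · have hNω : N ω = s.card := by
        rw [hN]
        simp only [Finset.sum_congr rfl fun i hi =>
          Set.indicator_of_mem (Set.mem_iInter₂.1 hω i hi) (1 : Config G → ℝ)]
        simp
      simp [hω, hNω]
    · simp [hω, Real.exp_nonneg]
  have hbound := hmarkov.trans (hmoment.trans
    (Real.exp_le_exp.2 (mul_le_mul_of_nonneg_left hmean hδ0)))
  rw [← le_div_iff₀' (Real.exp_pos _), ← Real.exp_sub] at hbound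
  exact hbound.trans_eq (by ring_nf)

end UnionAndIntersection

section Annuli

/-- The signed sup-distance of a vertex to the cell `[c₁R, (c₁+1)R] × [c₂R, (c₂+1)R]`. -/
noncomputable def cellDist (pos : V → ℂ) (R : ℝ) (c : ℤ × ℤ) (z : V) : ℝ :=
  max (max (c.1 * R - (pos z).re) ((pos z).re - (c.1 + 1) * R))
    (max (c.2 * R - (pos z).im) ((pos z).im - (c.2 + 1) * R))

lemma cellDist_le_iff {R : ℝ} {c : ℤ × ℤ} {z : V} {r : ℝ} : cellDist pos R c z ≤ r ↔
    (c.1 * R - r ≤ (pos z).re ∧ (pos z).re ≤ (c.1 + 1) * R + r) ∧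
      c.2 * R - r ≤ (pos z).im ∧ (pos z).im ≤ (c.2 + 1) * R + r := by
  simp only [cellDist, max_le_iff, sub_le_iff_le_add, add_comm r]

lemma cellDist_le_add {R r : ℝ} {c : ℤ × ℤ} {x y : V} (hre : |(pos x).re - (pos y).re| ≤ r)
    (him : |(pos x).im - (pos y).im| ≤ r) : cellDist pos R c y ≤ cellDist pos R c x + r := by
  rw [abs_le] at hre him
  obtain ⟨⟨hleft, hright⟩, hbelow, habove⟩ := cellDist_le_iff.1 (le_refl (cellDist pos R c x))
  refine cellDist_le_iff.2 ⟨⟨?_, ?_⟩, ?_, ?_⟩ <;> linarith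

/-- The index of the cell of side `R` that contains a vertex. -/
noncomputable def cell (pos : V → ℂ) (R : ℝ) (z : V) : ℤ × ℤ :=
  (⌊(pos z).re / R⌋, ⌊(pos z).im / R⌋)

lemma floor_div_mul_le {R : ℝ} (hR : 0 < R) (t : ℝ) : ⌊t / R⌋ * R ≤ t :=
  sub_nonneg.1 (Int.sub_floor_div_mul_nonneg t hR)

lemma lt_floor_div_add_one_mul {R : ℝ} (hR : 0 < R) (t : ℝ) : t < (⌊t / R⌋ + 1) * R := by
  linarith [Int.sub_floor_div_mul_lt t hR]

lemma abs_sub_floor_div_le {R t : ℝ} (hR : 0 < R) {k : ℤ} (hlow : k * R - R < t)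
    (hup : t < (k + 1) * R + R) : |k - ⌊t / R⌋| ≤ 1 := by
  have hk : k < ⌊t / R⌋ + 2 := by
    have : (k : ℝ) < ⌊t / R⌋ + 2 :=
      lt_of_mul_lt_mul_right (by linarith [lt_floor_div_add_one_mul hR t]) hR.le
    exact_mod_cast this
  have hfloor : ⌊t / R⌋ < k + 2 := by
    have : (⌊t / R⌋ : ℝ) < k + 2 :=
      lt_of_mul_lt_mul_right (by linarith [floor_div_mul_le hR t]) hR.le
    exact_mod_cast this
  rw [abs_le]
  lia

lemma cellDist_cell_nonpos {R : ℝ} (hR : 0 < R) (z : V) : cellDist pos R (cell pos R z) z ≤ 0 := by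
  rw [cellDist_le_iff]
  simp only [cell, sub_zero, add_zero]
  exact ⟨⟨floor_div_mul_le hR _, (lt_floor_div_add_one_mul hR _).le⟩, floor_div_mul_le hR _,
    (lt_floor_div_add_one_mul hR _).le⟩

/-- The sup-distance between two cell indices. -/
def kingDist (c c' : ℤ × ℤ) : ℕ := max (c.1 - c'.1).natAbs (c.2 - c'.2).natAbs

lemma kingDist_comm (c c' : ℤ × ℤ) : kingDist c c' = kingDist c' c := by
  simp only [kingDist]
  lia

lemma kingDist_triangle (c c' c'' : ℤ × ℤ) :
    kingDist c c'' ≤ kingDist c c' + kingDist c' c'' := by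
  simp only [kingDist]
  lia

lemma kingDist_cell_le {R : ℝ} (hR : 0 < R) {c : ℤ × ℤ} {z : V} (h : cellDist pos R c z < R) :
    kingDist c (cell pos R z) ≤ 1 := by
  simp only [cellDist, max_lt_iff] at h
  obtain ⟨⟨hleft, hright⟩, hbelow, habove⟩ := h
  have hre := abs_sub_floor_div_le hR (by linarith) (t := (pos z).re) (k := c.1) (by linarith)
  have him := abs_sub_floor_div_le hR (by linarith) (t := (pos z).im) (k := c.2) (by linarith)
  rw [abs_le] at hre him
  simp only [kingDist, cell]
  lia

/-- The square block of the nine cells at distance at most one from `c`. -/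
noncomputable def nearCells (c : ℤ × ℤ) : Finset (ℤ × ℤ) :=
  Finset.Icc (c.1 - 1) (c.1 + 1) ×ˢ Finset.Icc (c.2 - 1) (c.2 + 1)

lemma mem_nearCells {c c' : ℤ × ℤ} : c' ∈ nearCells c ↔ kingDist c c' ≤ 1 := by
  simp only [nearCells, kingDist, Finset.mem_product, Finset.mem_Icc]
  lia

lemma card_nearCells (c : ℤ × ℤ) : (nearCells c).card = 9 := by
  have hcard (k : ℤ) : (Finset.Icc (k - 1) (k + 1)).card = 3 := by
    rw [Int.card_Icc]
    lia
  simp [nearCells, hcard]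

/-- The `i`-th annulus of width `W` around the cell `c` of side `R`. -/
def annulus (pos : V → ℂ) (R W : ℝ) (c : ℤ × ℤ) (i : ℕ) : Set V :=
  {z | i * W < cellDist pos R c z ∧ cellDist pos R c z < (i + 1) * W}

/-- The event that the `i`-th annulus of width `W` around the cell `c` is crossed, up to a margin
`ℓ`. -/
def annulusCross (G : SimpleGraph V) (pos : V → ℂ) (R W ℓ : ℝ) (c : ℤ × ℤ) (i : ℕ) :
    Set (Config G) :=
  connectedWithin G (annulus pos R W c i) fun x y =>
    cellDist pos R c x ≤ i * W + ℓ ∧ (i + 1) * W - ℓ ≤ cellDist pos R c y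

lemma mem_annulusCross_of_reachable {ω : Config G} {R W ℓ : ℝ} (hℓ : 0 ≤ ℓ) (hW : ℓ < W)
    (hedge : ∀ x y, G.Adj x y → |(pos x).re - (pos y).re| ≤ ℓ ∧ |(pos x).im - (pos y).im| ≤ ℓ)
    {c : ℤ × ℤ} {i : ℕ} {x y : V} (hxy : (openGraph G ω).Reachable x y)
    (hx : cellDist pos R c x ≤ 0) (hy : (i + 1) * W ≤ cellDist pos R c y) :
    ω ∈ annulusCross G pos R W ℓ c i := by
  have hlip (a b) (hab : (openGraph G ω).Adj a b) :
      cellDist pos R c b ≤ cellDist pos R c a + ℓ :=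
    cellDist_le_add (hedge a b (openGraph_le ω hab)).1 (hedge a b (openGraph_le ω hab)).2
  have hi : 0 ≤ i * W := mul_nonneg (Nat.cast_nonneg i) (by linarith)
  obtain ⟨z, x', y', z', hz, hzα, hz', hzβ, -, -, hr⟩ :=
    exists_reachable_within_strip (cellDist pos R c) (α := i * W) (β := (i + 1) * W)
      (fun a b hab ha => by linarith [hlip a b hab]) hxy (by linarith) (by linarith) hy
  exact ⟨x', y', ⟨by linarith [hlip _ _ hz], by linarith [hlip _ _ hz']⟩, hr⟩

lemma finite_annulus (hG : IsPlanarLattice G pos) (R W : ℝ) (c : ℤ × ℤ) (i : ℕ) :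
    (annulus pos R W c i).Finite :=
  hG.finite_of_box _ _ _ _ fun _ hz => cellDist_le_iff.1 hz.2.le

lemma eq_of_mem_annulus {R W : ℝ} (hW : 0 ≤ W) {c : ℤ × ℤ} {i j : ℕ} {z : V}
    (hi : z ∈ annulus pos R W c i) (hj : z ∈ annulus pos R W c j) : i = j := by
  have hij : (i : ℝ) < j + 1 := lt_of_mul_lt_mul_right (hi.1.trans hj.2) hW
  have hji : (j : ℝ) < i + 1 := lt_of_mul_lt_mul_right (hj.1.trans hi.2) hW
  norm_cast at hij hji
  lia

lemma ncard_annuli_le {R W : ℝ} (hR : 0 < R) (hW : 0 ≤ W) {K : ℕ} (hK : K * W ≤ R)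
    (Γ : Finset (ℤ × ℤ)) (e : G.edgeSet) :
    {t | t ∈ Γ ×ˢ Finset.range K ∧ e ∈ edgesIn G (annulus pos R W t.1 t.2)}.ncard ≤ 9 := by
  set x := (e : Sym2 V).out.1
  have hx (c i) (he : e ∈ edgesIn G (annulus pos R W c i)) : x ∈ annulus pos R W c i :=
    he x (Sym2.out_fst_mem _)
  rw [← card_nearCells (cell pos R x), ← Set.ncard_coe_finset]
  refine Set.ncard_le_ncard_of_injOn Prod.fst ?_ ?_ (Finset.finite_toSet _)
  · rintro ⟨c, i⟩ ⟨hmem, he⟩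
    have hi : ((i : ℝ) + 1) * W ≤ K * W :=
      mul_le_mul_of_nonneg_right
        (by exact_mod_cast Finset.mem_range.1 (Finset.mem_product.1 hmem).2) hW
    rw [Finset.mem_coe, mem_nearCells, kingDist_comm]
    exact kingDist_cell_le hR ((hx c i he).2.trans_le (hi.trans hK))
  · rintro ⟨c, i⟩ ⟨-, he⟩ ⟨c', i'⟩ ⟨-, he'⟩ rfl
    exact Prod.ext rfl (eq_of_mem_annulus hW (hx c i he) (hx c i' he'))

/-- The event that the first `K` annuli around each of the cells of `Γ` are crossed. -/
def chainCross (G : SimpleGraph V) (pos : V → ℂ) (R W ℓ : ℝ) (K : ℕ) (Γ : Finset (ℤ × ℤ)) :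
    Set (Config G) :=
  ⋂ t ∈ Γ ×ˢ Finset.range K, annulusCross G pos R W ℓ t.1 t.2

lemma isUpperSet_chainCross (R W ℓ : ℝ) (K : ℕ) (Γ : Finset (ℤ × ℤ)) :
    IsUpperSet (chainCross G pos R W ℓ K Γ) :=
  isUpperSet_iInter₂ fun _ _ => isUpperSet_connectedWithin _ _

lemma exists_determinedBy_chainCross (hG : IsPlanarLattice G pos) (R W ℓ : ℝ) (K : ℕ)
    (Γ : Finset (ℤ × ℤ)) : ∃ S : Finset G.edgeSet,
      DeterminedBy (chainCross G pos R W ℓ K Γ) (S : Set G.edgeSet) := by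
  have hfin : (⋃ t ∈ Γ ×ˢ Finset.range K, edgesIn G (annulus pos R W t.1 t.2)).Finite :=
    (Γ ×ˢ Finset.range K).finite_toSet.biUnion fun t _ =>
      finite_edgesIn (finite_annulus hG R W t.1 t.2)
  refine ⟨hfin.toFinset, fun ω ω' h hω => Set.mem_iInter₂.2 fun t ht =>
    determinedBy_connectedWithin _ _ ω ω' (fun e he => h e ?_) (Set.mem_iInter₂.1 hω t ht)⟩
  rw [Set.Finite.coe_toFinset]
  exact Set.mem_biUnion (Finset.mem_coe.2 ht) he

theorem eventProb_chainCross_le {p p' q δ : ℝ} (hp0 : 0 ≤ p) (hp1 : p < 1) (hp'0 : 0 ≤ p')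
    (hp'1 : p' < 1) (hq : 1 ≤ q) (hδ0 : 0 ≤ δ)
    (hδ : p * Real.exp (δ * (9 : ℕ)) * (1 - p') ≤ (1 - p) * p') {R W ℓ : ℝ} (hR : 0 < R)
    (hW : 0 ≤ W) {K : ℕ} (hK : K * W ≤ R) (Γ : Finset (ℤ × ℤ)) (E : Finset G.edgeSet)
    (hE : ∀ c, ∀ i < K, eventProb G p' q E ⊥ (annulusCross G pos R W ℓ c i) ≤ 1 / 2) :
    eventProb G p q E ⊥ (chainCross G pos R W ℓ K Γ) ≤
      Real.exp (-(δ * K / 2 * Γ.card)) := by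
  refine (eventProb_biInter_le hp0 hp1 hp'0 hp'1 hq ⊥ (Γ ×ˢ Finset.range K)
    (fun _ => isUpperSet_connectedWithin _ _) (fun _ => determinedBy_connectedWithin _ _)
    (ncard_annuli_le hR hW hK Γ) hδ0 hδ fun t ht =>
      hE _ _ (Finset.mem_range.1 (Finset.mem_product.1 ht).2)).trans_eq ?_
  rw [Finset.card_product, Finset.card_range]
  push_cast
  ring_nf

end Annuli

section CrossingProbability

variable {p q : ℝ} {φ : Measure (Config G)}

lemma IsInfiniteVolume.eventProb_bot_le_of_pull [Countable V] (hφ : IsInfiniteVolume G p q φ)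
    (hp0 : 0 ≤ p) (hp1 : p < 1) (hq : 1 ≤ q) (E : Finset G.edgeSet) (σ : G ≃g G)
    {A A' : Set (Config G)} (hA : IsUpperSet A) (h : ∀ ω ∈ A', pull σ ω ∈ A) :
    eventProb G p q E ⊥ A' ≤ φ.real A :=
  calc eventProb G p q E ⊥ A' ≤ eventProb G p q E ⊥ (pull σ ⁻¹' A) :=
        eventProb_mono hp0 hp1 hq ⊥ h
    _ = eventProb G p q (mapEdges σ.symm E) ⊥ A := expect_bot_pull p q σ E (A.indicator 1)
    _ ≤ φ.real A := hφ.eventProb_bot_le_measureReal hp0 hp1 hq hA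

lemma eventProb_bot_weakCross_le (hG : IsPlanarLattice G pos) (hp0 : 0 ≤ p) (hp1 : p < 1)
    (hq : 1 ≤ q) (hφ : IsInfiniteVolume G p q φ) (E : Finset G.edgeSet) (L : ℕ) (j : ℝ)
    (m n : ℤ) : eventProb G p q E ⊥ (weakCross G (reC pos) (imC pos) (m * L) (n * L) L j) ≤
      φ.real (weakCross G (reC pos) (imC pos) 0 0 L j) := by
  have := hG.countable
  refine hφ.eventProb_bot_le_of_pull hp0 hp1 hq E (hG.translate (m * L, n * L))
    (isUpperSet_connectedWithin _ _) fun ω => pull_mem_connectedWithin _ ?_ ?_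
  · rintro x ⟨⟨hleft, hright⟩, hbelow, habove⟩
    simp only [reC, imC, hG.re_translate, hG.im_translate] at hleft hright hbelow habove
    push_cast at hleft hright hbelow habove
    refine ⟨⟨?_, ?_⟩, ?_, ?_⟩ <;> simp only [reC, imC] <;> linarith
  · rintro x y ⟨hx, hy⟩
    simp only [imC, hG.im_translate] at hx hy
    push_cast at hx hy
    constructor <;> simp only [imC] <;> linarith

lemma eventProb_bot_weakCross_swap_le (hG : IsPlanarLattice G pos) (hp0 : 0 ≤ p) (hp1 : p < 1)
    (hq : 1 ≤ q) (hφ : IsInfiniteVolume G p q φ) (E : Finset G.edgeSet) (L : ℕ) (j : ℝ)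
    (m n : ℤ) : eventProb G p q E ⊥ (weakCross G (imC pos) (reC pos) (n * L) (m * L) L j) ≤
      φ.real (weakCross G (reC pos) (imC pos) 0 0 L j) := by
  have := hG.countable
  obtain ⟨s, hs⟩ := hG.exists_swap
  refine (hφ.eventProb_bot_le_of_pull hp0 hp1 hq E (s.trans (hG.translate (m * L, n * L)))
    (isUpperSet_connectedWithin _ _) fun ω => pull_mem_connectedWithin _ ?_ ?_)
  · rintro x ⟨⟨hbelow, habove⟩, hleft, hright⟩
    simp only [reC, imC, RelIso.trans_apply, hG.re_translate, hG.im_translate, (hs x).1, (hs x).2]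
      at hleft hright hbelow habove
    push_cast at hleft hright hbelow habove
    refine ⟨⟨?_, ?_⟩, ?_, ?_⟩ <;> simp only [reC, imC] <;> linarith
  · rintro x y ⟨hx, hy⟩
    simp only [reC, RelIso.trans_apply, hG.re_translate, (hs x).1, (hs y).1] at hx hy
    push_cast at hx hy
    constructor <;> simp only [imC] <;> linarith

/-- The indices `m` of the intervals `[mL, (m+1)L]` that are close to the three intervals
`[k'R, (k'+1)R]` with `|k' - k| ≤ 1`, where `R = 4KL`. -/
noncomputable def blockRange (K : ℕ) (k : ℤ) : Finset ℤ :=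
  Finset.Icc (4 * K * (k - 1) - 1) (4 * K * (k + 2) + 1)

lemma card_blockRange (K : ℕ) (k : ℤ) : (blockRange K k).card = 12 * K + 3 := by
  rw [blockRange, Int.card_Icc]
  ring_nf
  lia

lemma mem_blockRange {K : ℕ} {k m : ℤ} {L R t : ℝ} (hL : 0 < L) (hR : R = 4 * K * L)
    (hlow : k * R - R ≤ t) (hup : t ≤ (k + 1) * R + R) (hm : |m - ⌊t / L⌋| ≤ 1) :
    m ∈ blockRange K k := by
  subst hR
  have hfloor_low : 4 * K * (k - 1) < ⌊t / L⌋ + 1 := by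
    have : (4 * K * (k - 1) : ℝ) < ⌊t / L⌋ + 1 :=
      lt_of_mul_lt_mul_right (by linarith [lt_floor_div_add_one_mul hL t]) hL.le
    exact_mod_cast this
  have hfloor_up : ⌊t / L⌋ ≤ 4 * K * (k + 2) := by
    have : (⌊t / L⌋ : ℝ) ≤ 4 * K * (k + 2) :=
      le_of_mul_le_mul_right (by linarith [floor_div_mul_le hL t]) hL
    exact_mod_cast this
  rw [abs_le] at hm
  exact Finset.mem_Icc.2 ⟨by linarith, by linarith⟩

lemma exists_weakCross_of_mem_annulusCross {L R ℓ : ℝ} {K : ℕ} (hℓ : 0 < ℓ) (hL : 4 * ℓ < L)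
    (hR : R = 4 * K * L)
    (hedge : ∀ x y, G.Adj x y → |(pos x).re - (pos y).re| ≤ ℓ ∧ |(pos x).im - (pos y).im| ≤ ℓ)
    {c : ℤ × ℤ} {i : ℕ} (hi : i < K) {ω : Config G}
    (hω : ω ∈ annulusCross G pos R (4 * L) ℓ c i) :
    ∃ t ∈ blockRange K c.1 ×ˢ blockRange K c.2,
      ω ∈ weakCross G (reC pos) (imC pos) (t.1 * L) (t.2 * L) L (2 * ℓ) ∪
        weakCross G (imC pos) (reC pos) (t.2 * L) (t.1 * L) L (2 * ℓ) := by
  have hL0 : 0 < L := by linarith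
  obtain ⟨x, y, ⟨hx, hy⟩, hxy⟩ := hω
  have hxR : cellDist pos R c x ≤ R := by
    have hiK : ((i : ℝ) + 1) * (4 * L) ≤ K * (4 * L) :=
      mul_le_mul_of_nonneg_right (by exact_mod_cast hi) (by linarith)
    linarith
  have hre := floor_div_mul_le hL0 (pos x).re
  have hre' := lt_floor_div_add_one_mul hL0 (pos x).re
  have him := floor_div_mul_le hL0 (pos x).im
  have him' := lt_floor_div_add_one_mul hL0 (pos x).im
  obtain ⟨m, n, hm, hn, hcross⟩ := exists_weakCross (t := reC pos) (h := imC pos)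
    (a := ⌊(pos x).re / L⌋) (b := ⌊(pos x).im / L⌋) hL hℓ (fun a b hab => (hedge a b hab).1)
    (fun a b hab => (hedge a b hab).2) (within_le (openGraph G ω) _) hxy ⟨hre, hre'.le⟩
    ⟨him, him'.le⟩ (by
      rintro ⟨⟨hleft, hright⟩, hbelow, habove⟩
      simp only [reC, imC] at hleft hright hbelow habove
      have hdist : cellDist pos R c y ≤ cellDist pos R c x + 2 * L :=
        cellDist_le_add (abs_le.2 ⟨by linarith, by linarith⟩)
          (abs_le.2 ⟨by linarith, by linarith⟩)
      linarith)
  obtain ⟨⟨hleft, hright⟩, hbelow, habove⟩ := cellDist_le_iff.1 hxR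
  exact ⟨(m, n), Finset.mem_product.2 ⟨mem_blockRange hL0 hR hleft hright hm,
    mem_blockRange hL0 hR hbelow habove hn⟩, hcross⟩

theorem eventProb_bot_annulusCross_le (hG : IsPlanarLattice G pos) (hp0 : 0 ≤ p) (hp1 : p < 1)
    (hq : 1 ≤ q) (hφ : IsInfiniteVolume G p q φ) (E : Finset G.edgeSet)
    {L K : ℕ} {ℓ : ℝ} (hℓ : 0 < ℓ) (hL : 4 * ℓ < L)
    (hedge : ∀ x y, G.Adj x y → |(pos x).re - (pos y).re| ≤ ℓ ∧ |(pos x).im - (pos y).im| ≤ ℓ)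
    (c : ℤ × ℤ) {i : ℕ} (hi : i < K) :
    eventProb G p q E ⊥ (annulusCross G pos (4 * K * L) (4 * L) ℓ c i) ≤
      2 * (12 * K + 3) ^ 2 * φ.real (weakCross G (reC pos) (imC pos) 0 0 L (2 * ℓ)) := by
  set b := φ.real (weakCross G (reC pos) (imC pos) 0 0 L (2 * ℓ))
  set X : ℤ × ℤ → Set (Config G) := fun t =>
    weakCross G (reC pos) (imC pos) (t.1 * L) (t.2 * L) L (2 * ℓ) ∪
      weakCross G (imC pos) (reC pos) (t.2 * L) (t.1 * L) L (2 * ℓ)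
  have hX (t) : eventProb G p q E ⊥ (X t) ≤ b + b :=
    (eventProb_union_le hp0 hp1 hq ⊥ _ _).trans (add_le_add
      (eventProb_bot_weakCross_le hG hp0 hp1 hq hφ E L (2 * ℓ) t.1 t.2)
      (eventProb_bot_weakCross_swap_le hG hp0 hp1 hq hφ E L (2 * ℓ) t.1 t.2))
  set T := blockRange K c.1 ×ˢ blockRange K c.2 with hT
  calc eventProb G p q E ⊥ (annulusCross G pos (4 * K * L) (4 * L) ℓ c i)
      ≤ eventProb G p q E ⊥ (⋃ t ∈ T, X t) :=
        eventProb_mono hp0 hp1 hq ⊥ fun ω hω => by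
          simpa only [Set.mem_iUnion₂, exists_prop] using
            exists_weakCross_of_mem_annulusCross hℓ hL rfl hedge hi hω
    _ ≤ ∑ t ∈ T, eventProb G p q E ⊥ (X t) := eventProb_biUnion_le hp0 hp1 hq ⊥ _ _
    _ ≤ ∑ _t ∈ T, (b + b) := Finset.sum_le_sum fun t _ => hX t
    _ = 2 * (12 * K + 3) ^ 2 * b := by
        rw [Finset.sum_const, hT, Finset.card_product, card_blockRange, card_blockRange,
          nsmul_eq_mul]
        push_cast
        ring

end CrossingProbability

section Chains

/-- The graph of cells in which two cells are adjacent if they share a side or a corner. -/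
def kingGraph : SimpleGraph (ℤ × ℤ) where
  Adj c c' := kingDist c c' = 1
  symm := ⟨fun c c' h => by rwa [kingDist_comm]⟩
  loopless := ⟨fun c h => by simp [kingDist] at h⟩

lemma kingDist_le_length {H : SimpleGraph (ℤ × ℤ)} (hH : H ≤ kingGraph) {c c' : ℤ × ℤ}
    (w : H.Walk c c') : kingDist c c' ≤ w.length := by
  induction w with
  | nil => simp [kingDist]
  | @cons c d c' h w ih =>
    have hcd : kingDist c d = 1 := hH h
    rw [SimpleGraph.Walk.length_cons]
    linarith [kingDist_triangle c d c']

/-- The vertex sets of the self-avoiding chains of `k` cells started from `c`, consecutive cells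
being at distance at most one. -/
noncomputable def chains (c : ℤ × ℤ) : ℕ → Finset (Finset (ℤ × ℤ))
  | 0 => {∅}
  | k + 1 => (nearCells c).biUnion fun c' => {Γ ∈ chains c' k | c ∉ Γ}.image (insert c)

lemma card_chains_le (c : ℤ × ℤ) (k : ℕ) : (chains c k).card ≤ 9 ^ k := by
  induction k generalizing c with
  | zero => simp [chains]
  | succ k ih =>
    rw [chains, pow_succ']
    refine (Finset.card_biUnion_le_card_mul _ _ (9 ^ k) fun c' _ =>
      Finset.card_image_le.trans ((Finset.card_filter_le _ _).trans (ih c'))).trans_eq ?_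
    rw [card_nearCells]

lemma card_of_mem_chains {c : ℤ × ℤ} {k : ℕ} {Γ : Finset (ℤ × ℤ)} (hΓ : Γ ∈ chains c k) :
    Γ.card = k := by
  induction k generalizing c Γ with
  | zero => simpa [chains] using hΓ
  | succ k ih =>
    simp only [chains, Finset.mem_biUnion, Finset.mem_image, Finset.mem_filter] at hΓ
    obtain ⟨c', -, Γ, ⟨hΓ, hc⟩, rfl⟩ := hΓ
    rw [Finset.card_insert_of_notMem hc, ih hΓ]

lemma exists_mem_chains_of_isPath {S : Set (ℤ × ℤ)} {c c' : ℤ × ℤ}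
    {w : (within kingGraph S).Walk c c'} (hw : w.IsPath) {k : ℕ} (hk : k ≤ w.length) :
    ∃ Γ ∈ chains c k, ∀ d ∈ Γ, d ∈ S ∧ d ∈ w.support := by
  induction w generalizing k with
  | nil =>
    obtain rfl : k = 0 := by simpa using hk
    exact ⟨∅, by simp [chains], by simp⟩
  | @cons c d c' h w ih =>
    rcases k with _ | k
    · exact ⟨∅, by simp [chains], by simp⟩
    rw [SimpleGraph.Walk.cons_isPath_iff] at hw
    obtain ⟨Γ, hΓ, hΓS⟩ := ih hw.1 (by simpa using hk)
    have hc : c ∉ Γ := fun hc => hw.2 (hΓS c hc).2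
    have hd : d ∈ nearCells c := mem_nearCells.2 (le_of_eq h.1)
    refine ⟨insert c Γ, Finset.mem_biUnion.2 ⟨d, hd, Finset.mem_image_of_mem _
      (Finset.mem_filter.2 ⟨hΓ, hc⟩)⟩, fun e he => ?_⟩
    rcases Finset.mem_insert.1 he with rfl | he
    · exact ⟨h.2.1, by simp⟩
    · exact ⟨(hΓS e he).1, by simp [(hΓS e he).2]⟩

/-- The cells visited by the open cluster of `x`. -/
def clusterCells (pos : V → ℂ) (R : ℝ) (ω : Config G) (x : V) : Set (ℤ × ℤ) :=
  {c | ∃ z, (openGraph G ω).Reachable x z ∧ cell pos R z = c}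

lemma reachable_clusterCells {ω : Config G} {R ℓ : ℝ} (hR : 0 < R) (hℓR : ℓ < R)
    (hedge : ∀ x y, G.Adj x y → |(pos x).re - (pos y).re| ≤ ℓ ∧ |(pos x).im - (pos y).im| ≤ ℓ)
    {x y : V} (hxy : (openGraph G ω).Reachable x y) :
    (within kingGraph (clusterCells pos R ω x)).Reachable (cell pos R x) (cell pos R y) := by
  refine (forall_reachable_of_closed (P := fun z => (openGraph G ω).Reachable x z ∧
    (within kingGraph (clusterCells pos R ω x)).Reachable (cell pos R x) (cell pos R z)) ?_ hxy
    ⟨.refl _, .refl _⟩).2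
  rintro a b hab ⟨hxa, hcells⟩
  have hxb := hxa.trans hab.reachable
  refine ⟨hxb, ?_⟩
  by_cases hcell : cell pos R a = cell pos R b
  · rwa [← hcell]
  obtain ⟨hre, him⟩ := hedge a b (openGraph_le ω hab)
  have hle : kingDist (cell pos R a) (cell pos R b) ≤ 1 := kingDist_cell_le hR <|
    (cellDist_le_add hre him).trans_lt (by linarith [cellDist_cell_nonpos (pos := pos) hR a])
  have hadj : kingGraph.Adj (cell pos R a) (cell pos R b) := by
    refine hle.antisymm (Nat.one_le_iff_ne_zero.2 fun h0 => hcell ?_)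
    simp only [kingDist] at h0
    exact Prod.ext (by lia) (by lia)
  exact hcells.trans (SimpleGraph.Adj.reachable ⟨hadj, ⟨a, hxa, rfl⟩, ⟨b, hxb, rfl⟩⟩)

/-- A cluster that visits two distant cells leaves the neighbourhood of each cell that it visits. -/
lemma exists_mem_chainCross {ω : Config G} {R W ℓ : ℝ} {K : ℕ} (hK : 1 ≤ K) (hℓ : 0 ≤ ℓ)
    (hW : ℓ < W)
    (hedge : ∀ x y, G.Adj x y → |(pos x).re - (pos y).re| ≤ ℓ ∧ |(pos x).im - (pos y).im| ≤ ℓ)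
    (hKW : K * W = R) {x y : V} (hxy : (openGraph G ω).Reachable x y) {k : ℕ} (hk3 : 3 ≤ k)
    (hk : k ≤ kingDist (cell pos R x) (cell pos R y)) :
    ∃ Γ ∈ chains (cell pos R x) k, ω ∈ chainCross G pos R W ℓ K Γ := by
  have hWR : W ≤ R := hKW ▸ le_mul_of_one_le_left (by linarith) (by exact_mod_cast hK)
  have hR : 0 < R := by linarith
  obtain ⟨w, hw⟩ := (reachable_clusterCells hR (by linarith) hedge hxy).exists_isPath
  obtain ⟨Γ, hΓ, hΓS⟩ :=
    exists_mem_chains_of_isPath hw (hk.trans (kingDist_le_length (within_le _ _) w))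
  refine ⟨Γ, hΓ, Set.mem_iInter₂.2 fun ⟨c, i⟩ ht => ?_⟩
  obtain ⟨hc, hi⟩ := Finset.mem_product.1 ht
  obtain ⟨z, hxz, rfl⟩ := (hΓS c hc).1
  obtain ⟨u, hzu, hu⟩ :
      ∃ u, (openGraph G ω).Reachable z u ∧ R ≤ cellDist pos R (cell pos R z) u := by
    by_contra! hnear
    have hzx := kingDist_cell_le hR (hnear x hxz.symm)
    have hzy := kingDist_cell_le hR (hnear y (hxz.symm.trans hxy))
    have := kingDist_triangle (cell pos R x) (cell pos R z) (cell pos R y)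
    rw [kingDist_comm] at hzx
    lia
  refine mem_annulusCross_of_reachable hℓ hW hedge hzu (cellDist_cell_nonpos hR z)
    (le_trans ?_ hu)
  rw [← hKW]
  exact mul_le_mul_of_nonneg_right (by exact_mod_cast Finset.mem_range.1 hi) (by linarith)

lemma norm_sub_le_of_kingDist {R : ℝ} (hR : 0 < R) (x y : V) :
    ‖pos x - pos y‖ ≤ 2 * (kingDist (cell pos R x) (cell pos R y) + 1) * R := by
  set k := kingDist (cell pos R x) (cell pos R y)
  have hcoord (a b : ℝ) (h : (⌊a / R⌋ - ⌊b / R⌋).natAbs ≤ k) : |a - b| ≤ (k + 1) * R := by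
    have hfloor : |(⌊a / R⌋ : ℝ) * R - ⌊b / R⌋ * R| ≤ k * R := by
      rw [← sub_mul, abs_mul, abs_of_pos hR]
      refine mul_le_mul_of_nonneg_right ?_ hR.le
      rw [← Int.cast_sub, ← Int.cast_abs, Int.abs_eq_natAbs]
      exact_mod_cast h
    rw [abs_le] at hfloor ⊢
    constructor <;> linarith [floor_div_mul_le hR a, lt_floor_div_add_one_mul hR a,
      floor_div_mul_le hR b, lt_floor_div_add_one_mul hR b]
  have hnorm := Complex.norm_le_abs_re_add_abs_im (pos x - pos y)
  rw [Complex.sub_re, Complex.sub_im] at hnorm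
  have hre := hcoord (pos x).re (pos y).re (le_max_left _ _)
  have him := hcoord (pos x).im (pos y).im (le_max_right _ _)
  linarith

end Chains

section ShortDistances

variable {p q : ℝ} {φ : Measure (Config G)}

lemma prob_le_eventProb (hp0 : 0 ≤ p) (hp1 : p < 1) (hq : 1 ≤ q) {E : Finset G.edgeSet}
    (ξ : BoundaryCondition G E) (η : E → Bool) :
    prob G p q E ξ η ≤ eventProb G p q E ξ {ω | E.restrict ω = η} := by
  classical
  have hmem : extend G E η ∈ {ω | E.restrict ω = η} := funext fun e => extend_of_mem η e.2
  have hprob (η') : 0 ≤ prob G p q E ξ η' :=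
    div_nonneg (weight_nonneg hp0 hp1 hq ξ η') (sum_weight_pos hp0 hp1 hq ξ).le
  rw [eventProb, expect_eq_sum_prob]
  refine le_trans (by simp [hmem]) (Finset.single_le_sum (f := fun η' => prob G p q E ξ η' *
    {ω : Config G | E.restrict ω = η}.indicator 1 (extend G E η')) (fun η' _ => ?_)
    (Finset.mem_univ η))
  exact mul_nonneg (hprob η') (Set.indicator_nonneg (fun _ _ => zero_le_one) _)

lemma IsInfiniteVolume.pow_le_measureReal_closed [Countable V] (hφ : IsInfiniteVolume G p q φ)
    (hp0 : 0 ≤ p) (hp1 : p < 1) (hq : 1 ≤ q) (E : Finset G.edgeSet) :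
    (1 - p) ^ E.card ≤ φ.real {ω | E.restrict ω = ⊥} := by
  refine hφ.le_measureReal hp0 hp1 hq (E := E) (fun ω ω' h hω => ?_) fun ξ =>
    (le_prob_bot hp0 hp1 hq ξ).trans (prob_le_eventProb hp0 hp1 hq ξ ⊥)
  have hrestrict : E.restrict ω = E.restrict ω' := funext fun e => h e e.2
  exact hrestrict.symm.trans hω

lemma exists_finset_incident {x : V} (hfin : (G.neighborSet x).Finite) :
    ∃ E : Finset G.edgeSet, E.card ≤ (G.neighborSet x).ncard ∧
      ∀ z (h : G.Adj x z), (⟨s(x, z), h⟩ : G.edgeSet) ∈ E := by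
  classical
  have := hfin.fintype
  refine ⟨Finset.univ.image fun z : G.neighborSet x => ⟨s(x, z), z.2⟩, ?_, fun z h =>
    Finset.mem_image.2 ⟨⟨z, h⟩, Finset.mem_univ _, rfl⟩⟩
  refine Finset.card_image_le.trans_eq ?_
  rw [Finset.card_univ, Set.ncard_eq_toFinset_card', Set.toFinset_card]

lemma measureReal_connected_le [Countable V] (hφ : IsInfiniteVolume G p q φ) (hp0 : 0 ≤ p)
    (hp1 : p < 1) (hq : 1 ≤ q) {x y : V} (hxy : x ≠ y) (hfin : (G.neighborSet x).Finite) :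
    φ.real (connected G x y) ≤ 1 - (1 - p) ^ (G.neighborSet x).ncard := by
  have := hφ.isProbabilityMeasure
  obtain ⟨E, hcard, hE⟩ := exists_finset_incident hfin
  have hsub : connected G x y ⊆ {ω | E.restrict ω = ⊥}ᶜ := by
    rintro ω ⟨w⟩ hω
    cases w with
    | nil => exact hxy rfl
    | cons h _ =>
      obtain ⟨hG, hopen⟩ := h
      have hclosed : ω ⟨_, hG⟩ = false := congrFun hω ⟨_, hE _ hG⟩
      simp [hopen] at hclosed
  calc φ.real (connected G x y) ≤ φ.real {ω | E.restrict ω = ⊥}ᶜ := measureReal_mono hsub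
    _ = 1 - φ.real {ω | E.restrict ω = ⊥} :=
        probReal_compl_eq_one_sub (measurableSet_restrict_eq E _)
    _ ≤ 1 - (1 - p) ^ E.card :=
        sub_le_sub_left (hφ.pow_le_measureReal_closed hp0 hp1 hq E) 1
    _ ≤ 1 - (1 - p) ^ (G.neighborSet x).ncard :=
        sub_le_sub_left (pow_le_pow_of_le_one (by linarith) (by linarith) hcard) 1

end ShortDistances

section Decay

variable {p p₀ q : ℝ} {φ₀ : Measure (Config G)}

lemma exists_measureReal_crossV_le
    (hcross : Filter.liminf (fun n : ℕ => φ₀ (crossV G pos (2 * n) n)) Filter.atTop = 0)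
    {ε : ℝ} (hε : 0 < ε) (m : ℕ) : ∃ L ≥ m, φ₀.real (crossV G pos (2 * L) L) ≤ ε := by
  have hfreq : ∃ᶠ n : ℕ in Filter.atTop, φ₀ (crossV G pos (2 * n) n) < ENNReal.ofReal ε := by
    refine Filter.frequently_lt_of_liminf_lt (by isBoundedDefault) ?_
    rw [hcross]
    exact ENNReal.ofReal_pos.2 hε
  obtain ⟨L, hL, hmL⟩ := (hfreq.and_eventually (Filter.eventually_ge_atTop m)).exists
  exact ⟨L, hmL, ENNReal.toReal_le_of_le_ofReal hε.le hL.le⟩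

lemma exists_scale_annulusCross_le_half (hG : IsPlanarLattice G pos)
    (haxis : ∃ x, (pos x).im = 0) (hp0 : 0 < p₀) (hp1 : p₀ < 1) (hq : 1 ≤ q)
    (hφ₀ : IsInfiniteVolume G p₀ q φ₀)
    (hcross : Filter.liminf (fun n : ℕ => φ₀ (crossV G pos (2 * n) n)) Filter.atTop = 0)
    {ℓ : ℕ} (hℓ : 1 ≤ ℓ)
    (hedge : ∀ x y, G.Adj x y → |(pos x).re - (pos y).re| ≤ ℓ ∧ |(pos x).im - (pos y).im| ≤ ℓ)
    (K : ℕ) :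
    ∃ L : ℕ, 4 * ℓ < L ∧ ∀ (E : Finset G.edgeSet) c, ∀ i < K,
      eventProb G p₀ q E ⊥ (annulusCross G pos (4 * K * L) (4 * L) ℓ c i) ≤ 1 / 2 := by
  obtain ⟨C, hC0, L₀, hC⟩ := exists_weakCross_le hG haxis hp0 hp1 hq (j := 2 * ℓ) (by lia)
  set N : ℝ := 2 * (12 * K + 3) ^ 2 * C with hN
  have hN0 : 0 < N := by positivity
  obtain ⟨L, hL, hLcross⟩ := exists_measureReal_crossV_le hcross
    (show 0 < 1 / (2 * N) by positivity) (max L₀ (4 * ℓ + 1))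
  obtain ⟨hLL₀, hLℓ⟩ := max_le_iff.1 hL
  refine ⟨L, hLℓ, fun E c i hi => ?_⟩
  have hweak := hC L hLL₀ φ₀ hφ₀
  push_cast at hweak
  calc eventProb G p₀ q E ⊥ (annulusCross G pos (4 * K * L) (4 * L) ℓ c i)
      ≤ 2 * (12 * K + 3) ^ 2 * φ₀.real (weakCross G (reC pos) (imC pos) 0 0 L (2 * ℓ)) :=
        eventProb_bot_annulusCross_le hG hp0.le hp1 hq hφ₀ E (by exact_mod_cast hℓ)
          (by exact_mod_cast hLℓ) hedge c hi
    _ ≤ 2 * (12 * K + 3) ^ 2 * (C * φ₀.real (crossV G pos (2 * L) L)) := by gcongr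
    _ = N * φ₀.real (crossV G pos (2 * L) L) := by rw [hN]; ring
    _ ≤ N * (1 / (2 * N)) := by gcongr
    _ = 1 / 2 := by field_simp

lemma IsInfiniteVolume.measureReal_chainCross_le {φ : Measure (Config G)} {p' δ R W ℓ : ℝ}
    {K : ℕ} (hφ : IsInfiniteVolume G p q φ) (hG : IsPlanarLattice G pos) (hp0 : 0 ≤ p)
    (hpp' : p < p') (hp'p₀ : p' < p₀) (hp₀1 : p₀ < 1) (hq : 1 ≤ q) (hδ0 : 0 ≤ δ)
    (hδ : p' * Real.exp (δ * 9) * (1 - p₀) ≤ (1 - p') * p₀) (hR : 0 < R) (hW : 0 ≤ W)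
    (hKW : K * W ≤ R)
    (hann : ∀ (E : Finset G.edgeSet) c, ∀ i < K,
      eventProb G p₀ q E ⊥ (annulusCross G pos R W ℓ c i) ≤ 1 / 2) (Γ : Finset (ℤ × ℤ)) :
    φ.real (chainCross G pos R W ℓ K Γ) ≤ Real.exp (-(δ * K / 2 * Γ.card)) := by
  obtain ⟨S, hS⟩ := exists_determinedBy_chainCross hG R W ℓ K Γ
  exact IsInfiniteVolume.measureReal_le_of_eventProb_bot_le hG hp0 hpp' (hp'p₀.trans hp₀1) hq hφ
    (isUpperSet_chainCross R W ℓ K Γ) hS fun E =>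
      eventProb_chainCross_le (by linarith) (by linarith) (by linarith) hp₀1 hq hδ0 hδ hR hW hKW Γ
        E fun c => hann E c

lemma measureReal_connected_le_of_chainCross {φ : Measure (Config G)} [IsFiniteMeasure φ]
    {R W ℓ a : ℝ} {K : ℕ} (hK : 1 ≤ K) (hℓ : 0 ≤ ℓ) (hW : ℓ < W) (hKW : K * W = R)
    (hedge : ∀ x y, G.Adj x y → |(pos x).re - (pos y).re| ≤ ℓ ∧ |(pos x).im - (pos y).im| ≤ ℓ)
    (ha : 1 + Real.log 9 ≤ a)
    (hchain : ∀ Γ, φ.real (chainCross G pos R W ℓ K Γ) ≤ Real.exp (-(a * Γ.card)))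
    {x y : V} (h3 : 3 ≤ kingDist (cell pos R x) (cell pos R y)) :
    φ.real (connected G x y) ≤ Real.exp (-kingDist (cell pos R x) (cell pos R y)) := by
  set k := kingDist (cell pos R x) (cell pos R y) with hk
  have hsub : connected G x y ⊆
      ⋃ Γ ∈ chains (cell pos R x) k, chainCross G pos R W ℓ K Γ := fun ω hω => by
    obtain ⟨Γ, hΓ, hωΓ⟩ := exists_mem_chainCross hK hℓ hW hedge hKW hω h3 hk.le
    exact Set.mem_biUnion (Finset.mem_coe.2 hΓ) hωΓ
  calc φ.real (connected G x y)
      ≤ ∑ Γ ∈ chains (cell pos R x) k, φ.real (chainCross G pos R W ℓ K Γ) :=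
        (measureReal_mono hsub (measure_ne_top _ _)).trans
          (measureReal_biUnion_finset_le _ _)
    _ ≤ (chains (cell pos R x) k).card • Real.exp (-(a * k)) :=
        Finset.sum_le_card_nsmul _ _ _ fun Γ hΓ => (hchain Γ).trans_eq (by
          rw [card_of_mem_chains hΓ])
    _ ≤ 9 ^ k * Real.exp (-(a * k)) := by
        rw [nsmul_eq_mul]
        gcongr
        exact_mod_cast card_chains_le _ _
    _ = Real.exp (k * Real.log 9 + -(a * k)) := by
        rw [Real.exp_add, Real.exp_nat_mul, Real.exp_log (by norm_num)]
    _ ≤ Real.exp (-k) := by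
        refine Real.exp_le_exp.2 ?_
        linarith [mul_le_mul_of_nonneg_right ha (Nat.cast_nonneg (α := ℝ) k)]

lemma exists_measureReal_connected_le_exp_neg_kingDist (hG : IsPlanarLattice G pos)
    (haxis : ∃ x, (pos x).im = 0) (hq : 1 ≤ q) (hp₀1 : p₀ < 1)
    (hφ₀ : IsInfiniteVolume G p₀ q φ₀)
    (hcross : Filter.liminf (fun n : ℕ => φ₀ (crossV G pos (2 * n) n)) Filter.atTop = 0)
    (hp : 0 ≤ p) (hpp₀ : p < p₀) :
    ∃ R : ℝ, 0 < R ∧ ∀ φ : Measure (Config G), IsInfiniteVolume G p q φ → ∀ x y : V,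
      3 ≤ kingDist (cell pos R x) (cell pos R y) →
        φ.real (connected G x y) ≤ Real.exp (-kingDist (cell pos R x) (cell pos R y)) := by
  obtain ⟨p', hpp', hp'p₀⟩ := exists_between hpp₀
  obtain ⟨δ, hδ0, hδ⟩ := exists_exp_mul_le hp'p₀ 9
  obtain ⟨ℓ, hℓ1, hedge⟩ := exists_edge_bound hG
  obtain ⟨K, hK⟩ := exists_nat_ge (max 1 ((1 + Real.log 9) / (δ / 2)))
  obtain ⟨hK1, hKδ⟩ := max_le_iff.1 hK
  rw [div_le_iff₀ (by positivity)] at hKδ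
  obtain ⟨L, hL, hann⟩ := exists_scale_annulusCross_le_half hG haxis (hp.trans_lt hpp₀) hp₀1 hq
    hφ₀ hcross hℓ1 hedge K
  have hLℓ : 4 * (ℓ : ℝ) < L := by exact_mod_cast hL
  have hℓ0 : (0 : ℝ) ≤ ℓ := ℓ.cast_nonneg
  have hKL : (K : ℝ) * (4 * L) = 4 * K * L := by ring
  have hR : (0 : ℝ) < 4 * K * L := mul_pos (by linarith) (by linarith)
  refine ⟨4 * K * L, hR, fun φ hφ x y h3 => ?_⟩
  have := hφ.isProbabilityMeasure
  exact measureReal_connected_le_of_chainCross (by exact_mod_cast hK1) hℓ0 (by linarith) hKL hedge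
    (by linarith) (hφ.measureReal_chainCross_le hG hp hpp' hp'p₀ hp₀1 hq hδ0.le
      (by exact_mod_cast hδ) hR (by linarith) hKL.le hann) h3

lemma exists_measureReal_connected_le_exp_neg (hG : IsPlanarLattice G pos)
    (hp0 : 0 ≤ p) (hp1 : p < 1) (hq : 1 ≤ q) :
    ∃ κ : ℝ, 0 < κ ∧ ∀ φ : Measure (Config G), IsInfiniteVolume G p q φ → ∀ x y : V, x ≠ y →
      φ.real (connected G x y) ≤ Real.exp (-κ) := by
  have := hG.countable
  obtain ⟨D, hD⟩ := exists_degree_bound hG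
  refine ⟨(1 - p) ^ D, pow_pos (by linarith) D, fun φ hφ x y hxy => ?_⟩
  calc φ.real (connected G x y) ≤ 1 - (1 - p) ^ (G.neighborSet x).ncard :=
        measureReal_connected_le hφ hp0 hp1 hq hxy (hG.finite_neighbors x)
    _ ≤ 1 - (1 - p) ^ D :=
        sub_le_sub_left (pow_le_pow_of_le_one (by linarith) (by linarith) (hD x)) 1
    _ ≤ Real.exp (-(1 - p) ^ D) := Real.one_sub_le_exp_neg _

end Decay

end FK

open FK in
theorem proposition3p1 {V : Type*} (G : SimpleGraph V) (pos : V → ℂ)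
    (hG : IsPlanarLattice G pos) (haxis : ∃ x, (pos x).im = 0)
    (q : ℝ) (hq : 1 ≤ q) (p₀ : ℝ) (hp₀ : p₀ ∈ Set.Ioo (0 : ℝ) 1)
    (φ₀ : MeasureTheory.Measure (FK.Config G)) (hφ₀ : FK.IsInfiniteVolume G p₀ q φ₀)
    (hcross : Filter.liminf (fun n : ℕ => φ₀ (FK.crossV G pos (2 * n) n)) Filter.atTop = 0)
    (p : ℝ) (hp : 0 ≤ p) (hpp₀ : p < p₀) :
    ∃ c : ℝ, 0 < c ∧
      ∀ φ : MeasureTheory.Measure (FK.Config G), FK.IsInfiniteVolume G p q φ →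
        ∀ x y : V, φ.real (FK.connected G x y) ≤ Real.exp (-c * ‖pos x - pos y‖) := by
  obtain ⟨R, hR, hfar⟩ := exists_measureReal_connected_le_exp_neg_kingDist hG haxis hq hp₀.2
    hφ₀ hcross hp hpp₀
  obtain ⟨κ, hκ, hnear⟩ :=
    exists_measureReal_connected_le_exp_neg hG hp (hpp₀.trans hp₀.2) hq
  set C := max (6 * R / κ) (4 * R)
  have hC : 0 < C := by positivity
  refine ⟨C⁻¹, inv_pos.2 hC, fun φ hφ x y => ?_⟩
  have := hφ.isProbabilityMeasure
  rcases eq_or_ne x y with rfl | hxy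
  · simp [measureReal_le_one]
  suffices ∃ m, φ.real (connected G x y) ≤ Real.exp (-m) ∧ ‖pos x - pos y‖ ≤ C * m by
    obtain ⟨m, hm, hnorm⟩ := this
    refine hm.trans (Real.exp_le_exp.2 ?_)
    rwa [neg_mul, neg_le_neg_iff, inv_mul_le_iff₀ hC]
  have hnorm := norm_sub_le_of_kingDist (pos := pos) hR x y
  rcases lt_or_ge (kingDist (cell pos R x) (cell pos R y)) 3 with h3 | h3
  · have h2 : (kingDist (cell pos R x) (cell pos R y) : ℝ) ≤ 2 := by
      exact_mod_cast Nat.lt_succ_iff.1 h3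
    exact ⟨κ, hnear φ hφ x y hxy, hnorm.trans <| (by nlinarith : _ ≤ 6 * R).trans <|
      (div_le_iff₀ hκ).1 (le_max_left _ _)⟩
  · have h3' : (3 : ℝ) ≤ kingDist (cell pos R x) (cell pos R y) := by exact_mod_cast h3
    exact ⟨_, hfar φ hφ x y h3, hnorm.trans <| (by nlinarith : _ ≤ 4 * R * _).trans <|
      mul_le_mul_of_nonneg_right (le_max_right _ _) (by positivity)⟩
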